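/- **Conventions.** A *skew multicategory* $\mathbb C$ has objects, tight multimap sets $\mathbb C^t_n(a_1,\dots,a_n;b)$ for $n\ge 1$, loose multimap sets $\mathbb C^l_n(a_1,\dots,a_n;b)$ for $n\ge 0$, comparisons $j\colon\mathbb C^t_n\to\mathbb C^l_n$, tight identities, and substitutions $g\circ_i f$ ($g$ of type $x$, $f$ of type $y$) of type $x\circ_i y$, where $x\circ_i y=t$ if $x=t$ and ($i\neq1$ or $y=t$), and $x\circ_i y=l$ otherwise; these satisfy the usual unit and associativity axioms and are compatible with $j$. Its underlying category $\mathcal C$ has the tight unary maps as morphisms. A multimap $\theta\in\mathbb C^x_n(\bar a;m)$ is a *classifier* if $-\circ_1\theta\colon\mathbb C^t_1(m;b)\to\mathbb C^x_n(\bar a;b)$ is bijective for all $b$, and is *left universal* if $-\circ_1\theta\colon\mathbb C^t_{1+r}(m,\bar x;b)\to\mathbb C^x_{n+r}(\bar a,\bar x;b)$ is bijective for all $r\ge0$, $\bar x$, $b$. $\mathbb C$ is *left representable* if all $\bar a$ and $x$ (with $n\ge1$ if $x=t$) have a classifier and all classifiers are left universal. It is *closed* if for all $b,c$ there are an object $[b,c]$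 and $e\in\mathbb C^t_2([b,c],b;c)$ with $e\circ_1-\colon\mathbb C^x_n(\bar a;[b,c])\to\mathbb C^x_{n+1}(\bar a,b;c)$ bijective for all $x$, $\bar a$. The morphisms (skew multifunctors) preserve all the structure. A *short skew multicategory* consists of a category $\mathcal C$, functors $\mathbb C^t_n\colon(\mathcal C^n)^{op}\times\mathcal C\to\mathbf{Set}$ for $1\le n\le4$ with $\mathbb C^t_1=\mathcal C(-,-)$, functors $\mathbb C^l_n$ for $n=0,1,2$, natural comparisons $j_n\colon\mathbb C^t_n\to\mathbb C^l_n$ for $n=1,2$, and substitutions $g\circ_i f$, natural in all variables and dinatural in the one substituted into, in the following cases: tight binary into tight binary or tight ternary; tight ternary into tight binary; nullary into tight binary or tight ternary; nullary into loose unary; loose unary into tight binary; tight binary into loose unary. When the unary argument is in the image of $j_1$, the last three are compatible with the functorial action of $\mathcal C$: $g\circ_2jp=g\circ_2p$, $g\circ_1jp=j(g\circ_1p)$, $jp\circ g=j(p\circ g)$, $jp\circ v=p\circ v$ for $g$ tight binary, $p$ in $\mathcal C$, $v$ nullary. For $f$ tight binary one requires $f\circ_i(g\circ_jh)=(f\circ_ig)\circ_{i+j-1}h$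 for $g$ tight binary and $h$ tight binary or nullary, and $(f\circ_1g)\circ_{n+1}h=(f\circ_2h)\circ_1g$ for $g,h$ each tight binary or nullary, $n$ being the arity of $g$. Morphisms preserve all the structure. Such a $\mathbb C$ is *left representable* if all $a,b$ have a tight binary map $\theta_{a,b}\colon a,b\to ab$ such that $-\circ_1\theta_{a,b}\colon\mathbb C^t_n(ab,\bar x;d)\to\mathbb C^t_{n+1}(a,b,\bar x;d)$ is bijective for $n=1,2,3$, and there is a nullary map $u\colon\diamond\to i$ such that $-\circ_1u\colon\mathbb C^t_{n+1}(i,\bar x;d)\to\mathbb C^l_n(\bar x;d)$ is bijective for $n=0,1,2$. It is *closed* if for all $b,c$ there are an object $[b,c]$ and $e\in\mathbb C^t_2([b,c],b;c)$ with $e\circ_1-\colon\mathbb C^x_n(\bar a;[b,c])\to\mathbb C^x_{n+1}(\bar a,b;c)$ bijective for $x=t$, $n=1,2,3$ and for $x=l$, $n=0,1$. Let $\mathbf{SMulti}_{lr}$, $\mathbf{FSMulti}_{lr}$ be the categories of left representable skew, respectively short skew, multicategories and all their morphisms, $\mathbf{SMulti}^{cl}_{lr}$, $\mathbf{FSMulti}^{cl}_{lr}$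 the full subcategories of closed ones, $\mathbf{SkMon}$ the category of (left) skew monoidal categories and lax monoidal functors, and $\mathbf{SkMon}^{cl}$ the full subcategory of the closed ones, that is, of those in which every functor $-\otimes b$ has a right adjoint. Let $U^{s,cl}_{lr}\colon\mathbf{SMulti}^{cl}_{lr}\to\mathbf{FSMulti}^{cl}_{lr}$ be the forgetful functor. Fix a choice of left universal classifiers $\theta_{a,b}\colon a,b\to ab$ and $u\colon\diamond\to i$ in each left representable short skew multicategory. The functor $K^s\colon\mathbf{FSMulti}_{lr}\to\mathbf{SkMon}$ sends $\mathbb C$ to $\mathcal C$ with $a\otimes b=ab$ and unit $i$, where $f\otimes g$, $\alpha$, $\lambda$, $\rho$ are determined by $$(f\otimes g)\circ\theta=(\theta\circ_1f)\circ_2g,\quad \alpha\circ(\theta_{ab,c}\circ_1\theta_{a,b})=\theta_{a,bc}\circ_2\theta_{b,c},\quad (\lambda_a\circ\theta_{i,a})\circ_1u=j(1_a),\quad \rho_a=\theta_{a,i}\circ_2u;$$ it sends a morphism $F$ to its underlying functor with $f_2\circ\theta_{Fa,Fb}=F(\theta_{a,b})$ and $f_0\circ u=F(u)$. The Bourke–Lack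 functor $T^s\colon\mathbf{SMulti}_{lr}\to\mathbf{SkMon}$ is defined by the same equations, for a choice of tight binary map classifiers and nullary map classifiers in each left representable skew multicategory. **Theorem.** The functor $K^s$ is an equivalence of categories, and it sends closed left representable short skew multicategories to closed skew monoidal categories. The resulting functor $$K^s_c\colon\mathbf{FSMulti}^{cl}_{lr}\longrightarrow\mathbf{SkMon}^{cl}$$ is an equivalence of categories. The forgetful functor $U^{s,cl}_{lr}$ is an equivalence. For every choice of classifiers in left representable skew multicategories, $T^s$ also preserves closedness and restricts to an equivalence $T^s_c\colon\mathbf{SMulti}^{cl}_{lr}\to\mathbf{SkMon}^{cl}$, and the triangle commutes: $K^s_c\circ U^{s,cl}_{lr}\cong T^s_c$, with equality $K^s_c\circ U^{s,cl}_{lr}=T^s_c$ when the classifiers chosen in each left representable skew multicategory are those chosen in its underlying short skew multicategory. -/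

import Mathlib

open CategoryTheory

universe v u

set_option linter.checkUnivs false
set_option linter.unusedSimpArgs false

inductive Tightness where
  | tight
  | loose

namespace Tightness

/-- The type `x ∘ᵢ y` of the substitution of a `y`-map into the `i`-th variable of an `x`-map, where
`l` is the list of the variables before the `i`-th one (so `i = 1` exactly when `l = []`). -/
def sub {α : Type*} : Tightness → List α → Tightness → Tightness
  | tight, [], y => y
  | tight, _ :: _, _ => tight
  | loose, _, _ => loose

/-- The order with `tight ≤ loose`. -/
def le : Tightness → Tightness → Prop
  | loose, tight => False
  | _, _ => True

/-- The comparison `S x → S x'` for `x ≤ x'` induced by `j : S tight → S loose`. -/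
def loosen {S : Tightness → Type v} (j : S tight → S loose) :
    ∀ {x x' : Tightness}, x.le x' → S x → S x'
  | tight, tight, _, f => f
  | tight, loose, _, f => j f
  | loose, loose, _, f => f

theorem sub_tight {α : Type*} (x : Tightness) (l : List α) : x = x.sub l tight := by
  cases x <;> cases l <;> rfl

theorem sub_congr {α β : Type*} (x y : Tightness) {l : List α} {l' : List β}
    (h : l.length = l'.length) : x.sub l y = x.sub l' y := by
  cases x <;> cases l <;> cases l' <;> simp_all [sub]

end Tightness

open Tightness (tight loose)

structure SkewMulticategory where
  Obj : Type u
  /-- The `x`-multimaps `as → b`. -/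
  Hom : Tightness → List Obj → Obj → Type v
  /-- Nullary maps are loose: the tight nullary sets carry no data. -/
  isEmpty_nil : ∀ b, IsEmpty (Hom tight [] b)
  j : ∀ {as : List Obj} {b : Obj}, Hom tight as b → Hom loose as b
  id : ∀ a, Hom tight [a] a
  /-- The substitution `g ∘ᵢ f`, where `l` and `r` are the variables of `g` before and after the
  `i`-th. The result type `z`, the domain `bs` of `g` and the domain `cs` of the result are only
  required to be equal to the expected ones, so that no equation involves a transport. -/
  sub : ∀ (l r : List Obj) {x y z : Tightness} {as bs cs : List Obj} {b c : Obj}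
    (_ : z = x.sub l y) (_ : bs = l ++ b :: r) (_ : cs = l ++ as ++ r),
    Hom x bs c → Hom y as b → Hom z cs c
  id_sub : ∀ {x : Tightness} {as : List Obj} {b : Obj} (hz : x = tight.sub ([] : List Obj) x)
    (hb : [b] = [] ++ b :: []) (hc : as = [] ++ as ++ []) (f : Hom x as b),
    sub [] [] hz hb hc (id b) f = f
  sub_id : ∀ (l r : List Obj) {x : Tightness} {bs : List Obj} {b c : Obj} (hz : x = x.sub l tight)
    (hb : bs = l ++ b :: r) (hc : bs = l ++ [b] ++ r) (g : Hom x bs c),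
    sub l r hz hb hc g (id b) = g
  /-- `h ∘ᵢ (g ∘ⱼ f) = (h ∘ᵢ g) ∘ᵢ₊ⱼ₋₁ f`. -/
  assoc : ∀ (l r l' r' : List Obj) {x y z w w' o : Tightness}
    {as bs gs cs hs os : List Obj} {b c d : Obj}
    (hw : w = y.sub l' z) (hgs : gs = l' ++ b :: r') (hcs : cs = l' ++ as ++ r')
    (ho : o = x.sub l w) (hbs : bs = l ++ c :: r) (hos : os = l ++ cs ++ r)
    (hw' : w' = x.sub l y) (hhs : hs = l ++ gs ++ r)
    (ho' : o = w'.sub (l ++ l') z) (hhs' : hs = (l ++ l') ++ b :: (r' ++ r))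
    (hos' : os = (l ++ l') ++ as ++ (r' ++ r))
    (h : Hom x bs d) (g : Hom y gs c) (f : Hom z as b),
    sub l r ho hbs hos h (sub l' r' hw hgs hcs g f) =
      sub (l ++ l') (r' ++ r) ho' hhs' hos' (sub l r hw' hbs hhs h g) f
  /-- `(h ∘ᵢ g) ∘ₙ₊ⱼ₋₁ f = (h ∘ⱼ f) ∘ᵢ g` for `i < j`, where `g` is `n`-ary. -/
  comm : ∀ (l m r : List Obj) {x y z w w' o : Tightness}
    {as gs bs hs hs' os : List Obj} {b c d : Obj}
    (hw : w = x.sub l y) (hbs : bs = l ++ b :: (m ++ c :: r)) (hhs : hs = l ++ gs ++ (m ++ c :: r))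
    (ho : o = w.sub (l ++ gs ++ m) z) (hhs' : hs = (l ++ gs ++ m) ++ c :: r)
    (hos : os = (l ++ gs ++ m) ++ as ++ r)
    (hw' : w' = x.sub (l ++ b :: m) z) (hbs' : bs = (l ++ b :: m) ++ c :: r)
    (hks : hs' = (l ++ b :: m) ++ as ++ r)
    (ho' : o = w'.sub l y) (hks' : hs' = l ++ b :: (m ++ as ++ r))
    (hos' : os = l ++ gs ++ (m ++ as ++ r))
    (h : Hom x bs d) (g : Hom y gs b) (f : Hom z as c),
    sub (l ++ gs ++ m) r ho hhs' hos (sub l (m ++ c :: r) hw hbs hhs h g) f =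
      sub l (m ++ as ++ r) ho' hks' hos' (sub (l ++ b :: m) r hw' hbs' hks h f) g
  /-- Substitution commutes with the comparisons viewing tight multimaps as loose. -/
  loosen_sub : ∀ (l r : List Obj) {x x' y y' z z' : Tightness} {as bs cs : List Obj} {b c : Obj}
    (hz : z = x.sub l y) (hz' : z' = x'.sub l y') (hbs : bs = l ++ b :: r)
    (hcs : cs = l ++ as ++ r) (hx : x.le x') (hy : y.le y') (hzz : z.le z')
    (g : Hom x bs c) (f : Hom y as b),
    Tightness.loosen (S := fun x => Hom x cs c) j hzz (sub l r hz hbs hcs g f) =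
      sub l r hz' hbs hcs (Tightness.loosen (S := fun x => Hom x bs c) j hx g)
        (Tightness.loosen (S := fun x => Hom x as b) j hy f)

/-- A skew multifunctor. As in `SkewMulticategory.sub`, the domain `as'` of the image of a multimap
is only required to be equal to the image of its domain. -/
@[ext]
structure SkewMultifunctor (M N : SkewMulticategory.{v, u}) where
  obj : M.Obj → N.Obj
  map : ∀ {x : Tightness} {as : List M.Obj} {b : M.Obj} {as' : List N.Obj},
    as' = as.map obj → M.Hom x as b → N.Hom x as' (obj b)
  map_id : ∀ a (h : [obj a] = [a].map obj), map h (M.id a) = N.id (obj a)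
  map_j : ∀ {as : List M.Obj} {b : M.Obj} {as' : List N.Obj} (h : as' = as.map obj)
    (f : M.Hom tight as b), map h (M.j f) = N.j (map h f)
  map_sub : ∀ (l r : List M.Obj) {x y z : Tightness} {as bs cs : List M.Obj} {b c : M.Obj}
    {as' bs' cs' : List N.Obj} (hz : z = x.sub l y) (hbs : bs = l ++ b :: r)
    (hcs : cs = l ++ as ++ r) (has' : as' = as.map obj) (hbs' : bs' = bs.map obj)
    (hcs' : cs' = cs.map obj) (hz' : z = x.sub (l.map obj) y)
    (hbs'' : bs' = l.map obj ++ obj b :: r.map obj)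
    (hcs'' : cs' = l.map obj ++ as' ++ r.map obj)
    (g : M.Hom x bs c) (f : M.Hom y as b),
    map hcs' (M.sub l r hz hbs hcs g f) =
      N.sub (l.map obj) (r.map obj) hz' hbs'' hcs'' (map hbs' g) (map has' f)

namespace SkewMultifunctor

variable {M N P : SkewMulticategory.{v, u}}

def id (M : SkewMulticategory.{v, u}) : SkewMultifunctor M M where
  obj a := a
  map h f := (h.trans (List.map_id _)) ▸ f
  map_id _ _ := rfl
  map_j h f := by
    have := h.trans (List.map_id _); subst this; rfl
  map_sub l r _ _ _ _ _ _ _ _ _ _ _ hz hbs hcs has' hbs' hcs' hz' hbs'' hcs'' g f := by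
    have h1 := has'.trans (List.map_id _)
    have h2 := hbs'.trans (List.map_id _)
    have h3 := hcs'.trans (List.map_id _)
    subst h1 h2 h3
    have hl : l.map (fun a => a) = l := List.map_id _
    have hr : r.map (fun a => a) = r := List.map_id _
    have key : ∀ l' r' (hl : l' = l) (hr : r' = r) hz' hbs'' hcs'',
        M.sub l r hz hbs hcs g f = M.sub l' r' hz' hbs'' hcs'' g f := by
      intro l' r' hl hr; subst hl hr; intros; rfl
    exact key _ _ hl hr hz' hbs'' hcs''

def comp (F : SkewMultifunctor M N) (G : SkewMultifunctor N P) : SkewMultifunctor M P where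
  obj a := G.obj (F.obj a)
  map {_ as _ _} h f := G.map (as := as.map F.obj) (by simpa [Function.comp_def] using h) (F.map rfl f)
  map_id a h := by
    rw [F.map_id, G.map_id]
  map_j h f := by rw [F.map_j, G.map_j]
  map_sub l r x y z as bs cs b c as' bs' cs' hz hbs hcs has' hbs' hcs' hz' hbs'' hcs'' g f := by
    rw [F.map_sub l r hz hbs hcs rfl rfl rfl (hz.trans (Tightness.sub_congr _ _ (by simp)))
      (by subst hbs; simp) (by subst hcs; simp)]
    have e : ∀ t : List M.Obj, t.map (fun a => G.obj (F.obj a)) = (t.map F.obj).map G.obj := by simp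
    have key : ∀ l' r' (hl : l.map (fun a => G.obj (F.obj a)) = l')
        (hr : r.map (fun a => G.obj (F.obj a)) = r') hz1 hbs1 hcs1 (g : P.Hom x bs' (G.obj (F.obj c)))
        (f : P.Hom y as' (G.obj (F.obj b))),
        P.sub l' r' hz1 hbs1 hcs1 g f =
          P.sub (l.map (fun a => G.obj (F.obj a))) (r.map (fun a => G.obj (F.obj a)))
            hz' hbs'' hcs'' g f := by
      intro l' r' hl hr; subst hl hr; intros; rfl
    rw [← key _ _ (e l) (e r) (hz.trans (Tightness.sub_congr _ _ (by simp))) (by rw [hbs'', e, e])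
      (by rw [hcs'', e, e])]
    exact G.map_sub (l.map F.obj) (r.map F.obj) _ _ _ (has'.trans (e _)) (hbs'.trans (e _))
      (hcs'.trans (e _)) _ _ _ _ _

end SkewMultifunctor

instance : Category SkewMulticategory.{v, u} where
  Hom := SkewMultifunctor
  id := SkewMultifunctor.id
  comp := SkewMultifunctor.comp
  id_comp F := by
    refine SkewMultifunctor.ext rfl (heq_of_eq ?_)
    funext x as b as' h f
    have key : ∀ {bs : List _} (e : bs = as) (h' : as' = bs.map F.obj),
      F.map h' (e ▸ f) = F.map h f := by intro bs e h'; subst e; rfl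
    exact key (List.map_id _) _
  comp_id F := by
    refine SkewMultifunctor.ext rfl (heq_of_eq ?_)
    funext x as b as' h f
    subst h; rfl
  assoc F G H := by
    refine SkewMultifunctor.ext rfl (heq_of_eq ?_)
    funext x as b as' h f
    have key : ∀ {bs cs : List _} (e : cs = bs) (h1 : as' = bs.map H.obj) (h2 : as' = cs.map H.obj)
      (h3 : bs = (as.map F.obj).map G.obj) (h4 : cs = (as.map F.obj).map G.obj) ,
      H.map h1 (G.map h3 (F.map rfl f)) = H.map h2 (G.map h4 (F.map rfl f)) := by
        intro bs cs e h1 h2; subst e; intros; rfl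
    exact key (List.map_map (l := as) (f := F.obj) (g := G.obj)) _ _ _ _

/-- A (left) skew monoidal category. -/
structure SkewMonoidalCat where
  Obj : Type u
  [category : Category.{v} Obj]
  tensorObj : Obj → Obj → Obj
  tensorHom : ∀ {a a' b b' : Obj}, (a ⟶ a') → (b ⟶ b') → (tensorObj a b ⟶ tensorObj a' b')
  tensorHom_id : ∀ a b : Obj, tensorHom (𝟙 a) (𝟙 b) = 𝟙 (tensorObj a b)
  tensorHom_comp : ∀ {a a' a'' b b' b'' : Obj} (f : a ⟶ a') (f' : a' ⟶ a'') (g : b ⟶ b')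
    (g' : b' ⟶ b''), tensorHom (f ≫ f') (g ≫ g') = tensorHom f g ≫ tensorHom f' g'
  unit : Obj
  α : ∀ a b c : Obj, tensorObj (tensorObj a b) c ⟶ tensorObj a (tensorObj b c)
  lam : ∀ a : Obj, tensorObj unit a ⟶ a
  ρ : ∀ a : Obj, a ⟶ tensorObj a unit
  α_naturality : ∀ {a a' b b' c c' : Obj} (f : a ⟶ a') (g : b ⟶ b') (h : c ⟶ c'),
    tensorHom (tensorHom f g) h ≫ α a' b' c' = α a b c ≫ tensorHom f (tensorHom g h)
  lam_naturality : ∀ {a a' : Obj} (f : a ⟶ a'), tensorHom (𝟙 unit) f ≫ lam a' = lam a ≫ f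
  ρ_naturality : ∀ {a a' : Obj} (f : a ⟶ a'), f ≫ ρ a' = ρ a ≫ tensorHom f (𝟙 unit)
  pentagon : ∀ a b c d : Obj,
    tensorHom (α a b c) (𝟙 d) ≫ α a (tensorObj b c) d ≫ tensorHom (𝟙 a) (α b c d) =
      α (tensorObj a b) c d ≫ α a b (tensorObj c d)
  α_lam : ∀ a b : Obj, α unit a b ≫ lam (tensorObj a b) = tensorHom (lam a) (𝟙 b)
  ρ_α : ∀ a b : Obj, ρ (tensorObj a b) ≫ α a b unit = tensorHom (𝟙 a) (ρ b)
  ρ_α_lam : ∀ a b : Obj,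
    tensorHom (ρ a) (𝟙 b) ≫ α a unit b ≫ tensorHom (𝟙 a) (lam b) = 𝟙 (tensorObj a b)
  ρ_lam : ρ unit ≫ lam unit = 𝟙 unit

attribute [instance] SkewMonoidalCat.category

theorem SkewMonoidalCat.comp_tensor_id (M : SkewMonoidalCat.{v, u}) {a a' a'' b : M.Obj}
    (f : a ⟶ a') (g : a' ⟶ a'') :
    M.tensorHom (f ≫ g) (𝟙 b) = M.tensorHom f (𝟙 b) ≫ M.tensorHom g (𝟙 b) := by
  rw [← M.tensorHom_comp, Category.comp_id]

theorem SkewMonoidalCat.id_tensor_comp (M : SkewMonoidalCat.{v, u}) {a a' a'' b : M.Obj}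
    (f : a ⟶ a') (g : a' ⟶ a'') :
    M.tensorHom (𝟙 b) (f ≫ g) = M.tensorHom (𝟙 b) f ≫ M.tensorHom (𝟙 b) g := by
  rw [← M.tensorHom_comp, Category.comp_id]

/-- The functor `- ⊗ b`. -/
@[simps]
def SkewMonoidalCat.tensorRight (M : SkewMonoidalCat.{v, u}) (b : M.Obj) : M.Obj ⥤ M.Obj where
  obj a := M.tensorObj a b
  map f := M.tensorHom f (𝟙 b)
  map_id a := M.tensorHom_id a b
  map_comp f g := M.comp_tensor_id f g

@[ext]
structure LaxSkewMonoidalFunctor (M N : SkewMonoidalCat.{v, u}) where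
  toFunctor : M.Obj ⥤ N.Obj
  f₀ : N.unit ⟶ toFunctor.obj M.unit
  f₂ : ∀ a b : M.Obj,
    N.tensorObj (toFunctor.obj a) (toFunctor.obj b) ⟶ toFunctor.obj (M.tensorObj a b)
  f₂_naturality : ∀ {a a' b b' : M.Obj} (p : a ⟶ a') (q : b ⟶ b'),
    N.tensorHom (toFunctor.map p) (toFunctor.map q) ≫ f₂ a' b' =
      f₂ a b ≫ toFunctor.map (M.tensorHom p q)
  f₂_α : ∀ a b c : M.Obj,
    N.tensorHom (f₂ a b) (𝟙 (toFunctor.obj c)) ≫ f₂ (M.tensorObj a b) c ≫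
        toFunctor.map (M.α a b c) =
      N.α (toFunctor.obj a) (toFunctor.obj b) (toFunctor.obj c) ≫
        N.tensorHom (𝟙 (toFunctor.obj a)) (f₂ b c) ≫ f₂ a (M.tensorObj b c)
  f₂_lam : ∀ a : M.Obj,
    N.tensorHom f₀ (𝟙 (toFunctor.obj a)) ≫ f₂ M.unit a ≫ toFunctor.map (M.lam a) =
      N.lam (toFunctor.obj a)
  f₂_ρ : ∀ a : M.Obj,
    N.ρ (toFunctor.obj a) ≫ N.tensorHom (𝟙 (toFunctor.obj a)) f₀ ≫ f₂ a M.unit =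
      toFunctor.map (M.ρ a)

namespace LaxSkewMonoidalFunctor

@[simps]
def id (M : SkewMonoidalCat.{v, u}) : LaxSkewMonoidalFunctor M M where
  toFunctor := 𝟭 _
  f₀ := 𝟙 _
  f₂ _ _ := 𝟙 _
  f₂_naturality p q := by simp
  f₂_α a b c := by simp [M.tensorHom_id]
  f₂_lam a := by simp [M.tensorHom_id]
  f₂_ρ a := by simp [M.tensorHom_id]

@[simps]
def comp {M N P : SkewMonoidalCat.{v, u}} (F : LaxSkewMonoidalFunctor M N)
    (G : LaxSkewMonoidalFunctor N P) : LaxSkewMonoidalFunctor M P where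
  toFunctor := F.toFunctor ⋙ G.toFunctor
  f₀ := G.f₀ ≫ G.toFunctor.map F.f₀
  f₂ a b := G.f₂ _ _ ≫ G.toFunctor.map (F.f₂ a b)
  f₂_naturality p q := by
    simp only [Functor.comp_obj, Functor.comp_map, ← Functor.map_comp, Category.assoc,
      ← F.f₂_naturality]
    simp only [Functor.map_comp, ← Category.assoc, G.f₂_naturality]
  f₂_α a b c := by
    have h1 := G.f₂_naturality (F.f₂ a b) (𝟙 (F.toFunctor.obj c))
    have h2 := G.f₂_naturality (𝟙 (F.toFunctor.obj a)) (F.f₂ b c)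
    have h3 := G.f₂_α (F.toFunctor.obj a) (F.toFunctor.obj b) (F.toFunctor.obj c)
    have h4 := congrArg G.toFunctor.map (F.f₂_α a b c)
    simp only [Functor.map_comp, CategoryTheory.Functor.map_id] at h1 h2 h4
    simp only [Functor.comp_obj, Functor.comp_map, P.comp_tensor_id, P.id_tensor_comp,
      Category.assoc]
    rw [reassoc_of% h1, h4, reassoc_of% h3, reassoc_of% h2]
  f₂_lam a := by
    have h1 := G.f₂_naturality F.f₀ (𝟙 (F.toFunctor.obj a))
    have h4 := congrArg G.toFunctor.map (F.f₂_lam a)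
    simp only [Functor.map_comp, CategoryTheory.Functor.map_id] at h1 h4
    simp only [Functor.comp_obj, Functor.comp_map, P.comp_tensor_id, Category.assoc]
    rw [reassoc_of% h1, h4, G.f₂_lam]
  f₂_ρ a := by
    have h1 := G.f₂_naturality (𝟙 (F.toFunctor.obj a)) F.f₀
    have h3 := G.f₂_ρ (F.toFunctor.obj a)
    have h4 := congrArg G.toFunctor.map (F.f₂_ρ a)
    simp only [Functor.map_comp, CategoryTheory.Functor.map_id] at h1 h4
    simp only [Functor.comp_obj, Functor.comp_map, P.id_tensor_comp, Category.assoc]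
    rw [reassoc_of% h1, reassoc_of% h3, h4]

end LaxSkewMonoidalFunctor

instance : Category SkewMonoidalCat.{v, u} where
  Hom := LaxSkewMonoidalFunctor
  id := LaxSkewMonoidalFunctor.id
  comp := LaxSkewMonoidalFunctor.comp
  id_comp F := LaxSkewMonoidalFunctor.ext rfl
    (heq_of_eq (by simp [LaxSkewMonoidalFunctor.id, LaxSkewMonoidalFunctor.comp]))
    (heq_of_eq (by funext a b; simp [LaxSkewMonoidalFunctor.id, LaxSkewMonoidalFunctor.comp]))
  comp_id F := LaxSkewMonoidalFunctor.ext rfl (heq_of_eq (by simp [LaxSkewMonoidalFunctor.id, LaxSkewMonoidalFunctor.comp]))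
    (heq_of_eq (by funext a b; simp [LaxSkewMonoidalFunctor.id, LaxSkewMonoidalFunctor.comp]))
  assoc F G H := LaxSkewMonoidalFunctor.ext rfl (heq_of_eq (by simp [LaxSkewMonoidalFunctor.comp]))
    (heq_of_eq (by funext a b; simp [LaxSkewMonoidalFunctor.comp]))

/-- Skew monoidal categories in which each `- ⊗ b` has a right adjoint. -/
def SkewMonoidalCat.isClosed : ObjectProperty SkewMonoidalCat.{v, u} :=
  fun M => ∀ b : M.Obj, (M.tensorRight b).IsLeftAdjoint

/-! A functor `(Cⁿ)ᵒᵖ × C ⥤ Type`, for `n = 0, 1, 2, 3, 4`. -/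

structure NullaryMaps (C : Type u) [Category.{v} C] where
  Hom : C → Type v
  act : ∀ {c c' : C}, (c ⟶ c') → Hom c → Hom c'
  act_id : ∀ {c : C} (f : Hom c), act (𝟙 c) f = f
  act_comp : ∀ {c c' c'' : C} (h : c ⟶ c') (h' : c' ⟶ c'') (f : Hom c),
    act (h ≫ h') f = act h' (act h f)

structure UnaryMaps (C : Type u) [Category.{v} C] where
  Hom : C → C → Type v
  act : ∀ {a a' c c' : C}, (a' ⟶ a) → (c ⟶ c') → Hom a c → Hom a' c'
  act_id : ∀ {a c : C} (f : Hom a c), act (𝟙 a) (𝟙 c) f = f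
  act_comp : ∀ {a a' a'' c c' c'' : C} (p : a' ⟶ a) (p' : a'' ⟶ a') (h : c ⟶ c') (h' : c' ⟶ c'')
    (f : Hom a c), act (p' ≫ p) (h ≫ h') f = act p' h' (act p h f)

structure BinaryMaps (C : Type u) [Category.{v} C] where
  Hom : C → C → C → Type v
  act : ∀ {a₁ a₁' a₂ a₂' c c' : C}, (a₁' ⟶ a₁) → (a₂' ⟶ a₂) → (c ⟶ c') →
    Hom a₁ a₂ c → Hom a₁' a₂' c'
  act_id : ∀ {a₁ a₂ c : C} (f : Hom a₁ a₂ c), act (𝟙 a₁) (𝟙 a₂) (𝟙 c) f = f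
  act_comp : ∀ {a₁ a₁' a₁'' a₂ a₂' a₂'' c c' c'' : C} (p₁ : a₁' ⟶ a₁) (p₁' : a₁'' ⟶ a₁')
    (p₂ : a₂' ⟶ a₂) (p₂' : a₂'' ⟶ a₂') (h : c ⟶ c') (h' : c' ⟶ c'') (f : Hom a₁ a₂ c),
    act (p₁' ≫ p₁) (p₂' ≫ p₂) (h ≫ h') f = act p₁' p₂' h' (act p₁ p₂ h f)

structure TernaryMaps (C : Type u) [Category.{v} C] where
  Hom : C → C → C → C → Type v
  act : ∀ {a₁ a₁' a₂ a₂' a₃ a₃' c c' : C}, (a₁' ⟶ a₁) → (a₂' ⟶ a₂) → (a₃' ⟶ a₃) → (c ⟶ c') →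
    Hom a₁ a₂ a₃ c → Hom a₁' a₂' a₃' c'
  act_id : ∀ {a₁ a₂ a₃ c : C} (f : Hom a₁ a₂ a₃ c), act (𝟙 a₁) (𝟙 a₂) (𝟙 a₃) (𝟙 c) f = f
  act_comp : ∀ {a₁ a₁' a₁'' a₂ a₂' a₂'' a₃ a₃' a₃'' c c' c'' : C}
    (p₁ : a₁' ⟶ a₁) (p₁' : a₁'' ⟶ a₁') (p₂ : a₂' ⟶ a₂) (p₂' : a₂'' ⟶ a₂')
    (p₃ : a₃' ⟶ a₃) (p₃' : a₃'' ⟶ a₃') (h : c ⟶ c') (h' : c' ⟶ c'') (f : Hom a₁ a₂ a₃ c),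
    act (p₁' ≫ p₁) (p₂' ≫ p₂) (p₃' ≫ p₃) (h ≫ h') f =
      act p₁' p₂' p₃' h' (act p₁ p₂ p₃ h f)

structure QuaternaryMaps (C : Type u) [Category.{v} C] where
  Hom : C → C → C → C → C → Type v
  act : ∀ {a₁ a₁' a₂ a₂' a₃ a₃' a₄ a₄' c c' : C}, (a₁' ⟶ a₁) → (a₂' ⟶ a₂) → (a₃' ⟶ a₃) →
    (a₄' ⟶ a₄) → (c ⟶ c') → Hom a₁ a₂ a₃ a₄ c → Hom a₁' a₂' a₃' a₄' c'
  act_id : ∀ {a₁ a₂ a₃ a₄ c : C} (f : Hom a₁ a₂ a₃ a₄ c),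
    act (𝟙 a₁) (𝟙 a₂) (𝟙 a₃) (𝟙 a₄) (𝟙 c) f = f
  act_comp : ∀ {a₁ a₁' a₁'' a₂ a₂' a₂'' a₃ a₃' a₃'' a₄ a₄' a₄'' c c' c'' : C}
    (p₁ : a₁' ⟶ a₁) (p₁' : a₁'' ⟶ a₁') (p₂ : a₂' ⟶ a₂) (p₂' : a₂'' ⟶ a₂')
    (p₃ : a₃' ⟶ a₃) (p₃' : a₃'' ⟶ a₃') (p₄ : a₄' ⟶ a₄) (p₄' : a₄'' ⟶ a₄')
    (h : c ⟶ c') (h' : c' ⟶ c'') (f : Hom a₁ a₂ a₃ a₄ c),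
    act (p₁' ≫ p₁) (p₂' ≫ p₂) (p₃' ≫ p₃) (p₄' ≫ p₄) (h ≫ h') f =
      act p₁' p₂' p₃' p₄' h' (act p₁ p₂ p₃ p₄ h f)

/-- A short skew multicategory. `T₂`, `T₃`, `T₄` are the tight binary, ternary and quaternary maps
(the tight unary maps are the morphisms of the category `Obj`) and `L₀`, `L₁`, `L₂` are the
nullary, loose unary and loose binary maps. In the names of the substitutions, `n`, `u`, `b`, `t`
stand for nullary, loose unary, tight binary and tight ternary: `tb₂ g f` is the substitution of a
tight binary map `f` into the second variable of a tight ternary map `g`. -/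
structure ShortSkewMulticategory where
  Obj : Type u
  [category : Category.{v} Obj]
  T₂ : BinaryMaps.{v} Obj
  T₃ : TernaryMaps.{v} Obj
  T₄ : QuaternaryMaps.{v} Obj
  L₀ : NullaryMaps.{v} Obj
  L₁ : UnaryMaps.{v} Obj
  L₂ : BinaryMaps.{v} Obj
  j₁ : ∀ {a c : Obj}, (a ⟶ c) → L₁.Hom a c
  j₂ : ∀ {a₁ a₂ c : Obj}, T₂.Hom a₁ a₂ c → L₂.Hom a₁ a₂ c
  j₁_nat : ∀ {a a' c c' : Obj} (p : a' ⟶ a) (h : c ⟶ c') (f : a ⟶ c),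
    j₁ (p ≫ f ≫ h) = L₁.act p h (j₁ f)
  j₂_nat : ∀ {a₁ a₁' a₂ a₂' c c' : Obj} (p₁ : a₁' ⟶ a₁) (p₂ : a₂' ⟶ a₂) (h : c ⟶ c')
    (f : T₂.Hom a₁ a₂ c), j₂ (T₂.act p₁ p₂ h f) = L₂.act p₁ p₂ h (j₂ f)
  -- The substitutions.
  bb₁ : ∀ {a₁ a₂ b₁ b₂ c : Obj}, T₂.Hom b₁ b₂ c → T₂.Hom a₁ a₂ b₁ → T₃.Hom a₁ a₂ b₂ c
  bb₂ : ∀ {a₁ a₂ b₁ b₂ c : Obj}, T₂.Hom b₁ b₂ c → T₂.Hom a₁ a₂ b₂ → T₃.Hom b₁ a₁ a₂ c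
  tb₁ : ∀ {a₁ a₂ b₁ b₂ b₃ c : Obj}, T₃.Hom b₁ b₂ b₃ c → T₂.Hom a₁ a₂ b₁ → T₄.Hom a₁ a₂ b₂ b₃ c
  tb₂ : ∀ {a₁ a₂ b₁ b₂ b₃ c : Obj}, T₃.Hom b₁ b₂ b₃ c → T₂.Hom a₁ a₂ b₂ → T₄.Hom b₁ a₁ a₂ b₃ c
  tb₃ : ∀ {a₁ a₂ b₁ b₂ b₃ c : Obj}, T₃.Hom b₁ b₂ b₃ c → T₂.Hom a₁ a₂ b₃ → T₄.Hom b₁ b₂ a₁ a₂ c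
  bt₁ : ∀ {a₁ a₂ a₃ b₁ b₂ c : Obj}, T₂.Hom b₁ b₂ c → T₃.Hom a₁ a₂ a₃ b₁ → T₄.Hom a₁ a₂ a₃ b₂ c
  bt₂ : ∀ {a₁ a₂ a₃ b₁ b₂ c : Obj}, T₂.Hom b₁ b₂ c → T₃.Hom a₁ a₂ a₃ b₂ → T₄.Hom b₁ a₁ a₂ a₃ c
  bn₁ : ∀ {b₁ b₂ c : Obj}, T₂.Hom b₁ b₂ c → L₀.Hom b₁ → L₁.Hom b₂ c
  bn₂ : ∀ {b₁ b₂ c : Obj}, T₂.Hom b₁ b₂ c → L₀.Hom b₂ → (b₁ ⟶ c)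
  tn₁ : ∀ {b₁ b₂ b₃ c : Obj}, T₃.Hom b₁ b₂ b₃ c → L₀.Hom b₁ → L₂.Hom b₂ b₃ c
  tn₂ : ∀ {b₁ b₂ b₃ c : Obj}, T₃.Hom b₁ b₂ b₃ c → L₀.Hom b₂ → T₂.Hom b₁ b₃ c
  tn₃ : ∀ {b₁ b₂ b₃ c : Obj}, T₃.Hom b₁ b₂ b₃ c → L₀.Hom b₃ → T₂.Hom b₁ b₂ c
  un : ∀ {b c : Obj}, L₁.Hom b c → L₀.Hom b → L₀.Hom c
  bu₁ : ∀ {a b₁ b₂ c : Obj}, T₂.Hom b₁ b₂ c → L₁.Hom a b₁ → L₂.Hom a b₂ c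
  bu₂ : ∀ {a b₁ b₂ c : Obj}, T₂.Hom b₁ b₂ c → L₁.Hom a b₂ → T₂.Hom b₁ a c
  ub : ∀ {a₁ a₂ b c : Obj}, L₁.Hom b c → T₂.Hom a₁ a₂ b → L₂.Hom a₁ a₂ c
  -- Naturality of the substitutions.
  bb₁_nat : ∀ {a₁ a₁' a₂ a₂' b₁ b₂ b₂' c c' : Obj} (p₁ : a₁' ⟶ a₁) (p₂ : a₂' ⟶ a₂) (q₂ : b₂' ⟶ b₂)
    (h : c ⟶ c') (g : T₂.Hom b₁ b₂ c) (f : T₂.Hom a₁ a₂ b₁),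
    bb₁ (T₂.act (𝟙 b₁) q₂ h g) (T₂.act p₁ p₂ (𝟙 b₁) f) = T₃.act p₁ p₂ q₂ h (bb₁ g f)
  bb₂_nat : ∀ {a₁ a₁' a₂ a₂' b₁ b₁' b₂ c c' : Obj} (p₁ : a₁' ⟶ a₁) (p₂ : a₂' ⟶ a₂) (q₁ : b₁' ⟶ b₁)
    (h : c ⟶ c') (g : T₂.Hom b₁ b₂ c) (f : T₂.Hom a₁ a₂ b₂),
    bb₂ (T₂.act q₁ (𝟙 b₂) h g) (T₂.act p₁ p₂ (𝟙 b₂) f) = T₃.act q₁ p₁ p₂ h (bb₂ g f)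
  tb₁_nat : ∀ {a₁ a₁' a₂ a₂' b₁ b₂ b₂' b₃ b₃' c c' : Obj} (p₁ : a₁' ⟶ a₁) (p₂ : a₂' ⟶ a₂)
    (q₂ : b₂' ⟶ b₂) (q₃ : b₃' ⟶ b₃) (h : c ⟶ c') (g : T₃.Hom b₁ b₂ b₃ c) (f : T₂.Hom a₁ a₂ b₁),
    tb₁ (T₃.act (𝟙 b₁) q₂ q₃ h g) (T₂.act p₁ p₂ (𝟙 b₁) f) = T₄.act p₁ p₂ q₂ q₃ h (tb₁ g f)
  tb₂_nat : ∀ {a₁ a₁' a₂ a₂' b₁ b₁' b₂ b₃ b₃' c c' : Obj} (p₁ : a₁' ⟶ a₁) (p₂ : a₂' ⟶ a₂)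
    (q₁ : b₁' ⟶ b₁) (q₃ : b₃' ⟶ b₃) (h : c ⟶ c') (g : T₃.Hom b₁ b₂ b₃ c) (f : T₂.Hom a₁ a₂ b₂),
    tb₂ (T₃.act q₁ (𝟙 b₂) q₃ h g) (T₂.act p₁ p₂ (𝟙 b₂) f) = T₄.act q₁ p₁ p₂ q₃ h (tb₂ g f)
  tb₃_nat : ∀ {a₁ a₁' a₂ a₂' b₁ b₁' b₂ b₂' b₃ c c' : Obj} (p₁ : a₁' ⟶ a₁) (p₂ : a₂' ⟶ a₂)
    (q₁ : b₁' ⟶ b₁) (q₂ : b₂' ⟶ b₂) (h : c ⟶ c') (g : T₃.Hom b₁ b₂ b₃ c) (f : T₂.Hom a₁ a₂ b₃),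
    tb₃ (T₃.act q₁ q₂ (𝟙 b₃) h g) (T₂.act p₁ p₂ (𝟙 b₃) f) = T₄.act q₁ q₂ p₁ p₂ h (tb₃ g f)
  bt₁_nat : ∀ {a₁ a₁' a₂ a₂' a₃ a₃' b₁ b₂ b₂' c c' : Obj} (p₁ : a₁' ⟶ a₁) (p₂ : a₂' ⟶ a₂)
    (p₃ : a₃' ⟶ a₃) (q₂ : b₂' ⟶ b₂) (h : c ⟶ c') (g : T₂.Hom b₁ b₂ c) (f : T₃.Hom a₁ a₂ a₃ b₁),
    bt₁ (T₂.act (𝟙 b₁) q₂ h g) (T₃.act p₁ p₂ p₃ (𝟙 b₁) f) = T₄.act p₁ p₂ p₃ q₂ h (bt₁ g f)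
  bt₂_nat : ∀ {a₁ a₁' a₂ a₂' a₃ a₃' b₁ b₁' b₂ c c' : Obj} (p₁ : a₁' ⟶ a₁) (p₂ : a₂' ⟶ a₂)
    (p₃ : a₃' ⟶ a₃) (q₁ : b₁' ⟶ b₁) (h : c ⟶ c') (g : T₂.Hom b₁ b₂ c) (f : T₃.Hom a₁ a₂ a₃ b₂),
    bt₂ (T₂.act q₁ (𝟙 b₂) h g) (T₃.act p₁ p₂ p₃ (𝟙 b₂) f) = T₄.act q₁ p₁ p₂ p₃ h (bt₂ g f)
  bn₁_nat : ∀ {b₁ b₂ b₂' c c' : Obj} (q₂ : b₂' ⟶ b₂) (h : c ⟶ c') (g : T₂.Hom b₁ b₂ c)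
    (f : L₀.Hom b₁), bn₁ (T₂.act (𝟙 b₁) q₂ h g) f = L₁.act q₂ h (bn₁ g f)
  bn₂_nat : ∀ {b₁ b₁' b₂ c c' : Obj} (q₁ : b₁' ⟶ b₁) (h : c ⟶ c') (g : T₂.Hom b₁ b₂ c)
    (f : L₀.Hom b₂), bn₂ (T₂.act q₁ (𝟙 b₂) h g) f = q₁ ≫ bn₂ g f ≫ h
  tn₁_nat : ∀ {b₁ b₂ b₂' b₃ b₃' c c' : Obj} (q₂ : b₂' ⟶ b₂) (q₃ : b₃' ⟶ b₃) (h : c ⟶ c')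
    (g : T₃.Hom b₁ b₂ b₃ c) (f : L₀.Hom b₁),
    tn₁ (T₃.act (𝟙 b₁) q₂ q₃ h g) f = L₂.act q₂ q₃ h (tn₁ g f)
  tn₂_nat : ∀ {b₁ b₁' b₂ b₃ b₃' c c' : Obj} (q₁ : b₁' ⟶ b₁) (q₃ : b₃' ⟶ b₃) (h : c ⟶ c')
    (g : T₃.Hom b₁ b₂ b₃ c) (f : L₀.Hom b₂),
    tn₂ (T₃.act q₁ (𝟙 b₂) q₃ h g) f = T₂.act q₁ q₃ h (tn₂ g f)
  tn₃_nat : ∀ {b₁ b₁' b₂ b₂' b₃ c c' : Obj} (q₁ : b₁' ⟶ b₁) (q₂ : b₂' ⟶ b₂) (h : c ⟶ c')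
    (g : T₃.Hom b₁ b₂ b₃ c) (f : L₀.Hom b₃),
    tn₃ (T₃.act q₁ q₂ (𝟙 b₃) h g) f = T₂.act q₁ q₂ h (tn₃ g f)
  un_nat : ∀ {b c c' : Obj} (h : c ⟶ c') (g : L₁.Hom b c) (f : L₀.Hom b),
    un (L₁.act (𝟙 b) h g) f = L₀.act h (un g f)
  bu₁_nat : ∀ {a a' b₁ b₂ b₂' c c' : Obj} (p : a' ⟶ a) (q₂ : b₂' ⟶ b₂) (h : c ⟶ c')
    (g : T₂.Hom b₁ b₂ c) (f : L₁.Hom a b₁),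
    bu₁ (T₂.act (𝟙 b₁) q₂ h g) (L₁.act p (𝟙 b₁) f) = L₂.act p q₂ h (bu₁ g f)
  bu₂_nat : ∀ {a a' b₁ b₁' b₂ c c' : Obj} (p : a' ⟶ a) (q₁ : b₁' ⟶ b₁) (h : c ⟶ c')
    (g : T₂.Hom b₁ b₂ c) (f : L₁.Hom a b₂),
    bu₂ (T₂.act q₁ (𝟙 b₂) h g) (L₁.act p (𝟙 b₂) f) = T₂.act q₁ p h (bu₂ g f)
  ub_nat : ∀ {a₁ a₁' a₂ a₂' b c c' : Obj} (p₁ : a₁' ⟶ a₁) (p₂ : a₂' ⟶ a₂) (h : c ⟶ c')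
    (g : L₁.Hom b c) (f : T₂.Hom a₁ a₂ b),
    ub (L₁.act (𝟙 b) h g) (T₂.act p₁ p₂ (𝟙 b) f) = L₂.act p₁ p₂ h (ub g f)
  -- Dinaturality of the substitutions.
  bb₁_dinat : ∀ {a₁ a₂ b b' b₂ c : Obj} (k : b ⟶ b') (g : T₂.Hom b' b₂ c) (f : T₂.Hom a₁ a₂ b),
    bb₁ (T₂.act k (𝟙 b₂) (𝟙 c) g) f = bb₁ g (T₂.act (𝟙 a₁) (𝟙 a₂) k f)
  bb₂_dinat : ∀ {a₁ a₂ b b' b₁ c : Obj} (k : b ⟶ b') (g : T₂.Hom b₁ b' c) (f : T₂.Hom a₁ a₂ b),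
    bb₂ (T₂.act (𝟙 b₁) k (𝟙 c) g) f = bb₂ g (T₂.act (𝟙 a₁) (𝟙 a₂) k f)
  tb₁_dinat : ∀ {a₁ a₂ b b' b₂ b₃ c : Obj} (k : b ⟶ b') (g : T₃.Hom b' b₂ b₃ c)
    (f : T₂.Hom a₁ a₂ b),
    tb₁ (T₃.act k (𝟙 b₂) (𝟙 b₃) (𝟙 c) g) f = tb₁ g (T₂.act (𝟙 a₁) (𝟙 a₂) k f)
  tb₂_dinat : ∀ {a₁ a₂ b b' b₁ b₃ c : Obj} (k : b ⟶ b') (g : T₃.Hom b₁ b' b₃ c)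
    (f : T₂.Hom a₁ a₂ b),
    tb₂ (T₃.act (𝟙 b₁) k (𝟙 b₃) (𝟙 c) g) f = tb₂ g (T₂.act (𝟙 a₁) (𝟙 a₂) k f)
  tb₃_dinat : ∀ {a₁ a₂ b b' b₁ b₂ c : Obj} (k : b ⟶ b') (g : T₃.Hom b₁ b₂ b' c)
    (f : T₂.Hom a₁ a₂ b),
    tb₃ (T₃.act (𝟙 b₁) (𝟙 b₂) k (𝟙 c) g) f = tb₃ g (T₂.act (𝟙 a₁) (𝟙 a₂) k f)
  bt₁_dinat : ∀ {a₁ a₂ a₃ b b' b₂ c : Obj} (k : b ⟶ b') (g : T₂.Hom b' b₂ c)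
    (f : T₃.Hom a₁ a₂ a₃ b),
    bt₁ (T₂.act k (𝟙 b₂) (𝟙 c) g) f = bt₁ g (T₃.act (𝟙 a₁) (𝟙 a₂) (𝟙 a₃) k f)
  bt₂_dinat : ∀ {a₁ a₂ a₃ b b' b₁ c : Obj} (k : b ⟶ b') (g : T₂.Hom b₁ b' c)
    (f : T₃.Hom a₁ a₂ a₃ b),
    bt₂ (T₂.act (𝟙 b₁) k (𝟙 c) g) f = bt₂ g (T₃.act (𝟙 a₁) (𝟙 a₂) (𝟙 a₃) k f)
  bn₁_dinat : ∀ {b b' b₂ c : Obj} (k : b ⟶ b') (g : T₂.Hom b' b₂ c) (f : L₀.Hom b),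
    bn₁ (T₂.act k (𝟙 b₂) (𝟙 c) g) f = bn₁ g (L₀.act k f)
  bn₂_dinat : ∀ {b b' b₁ c : Obj} (k : b ⟶ b') (g : T₂.Hom b₁ b' c) (f : L₀.Hom b),
    bn₂ (T₂.act (𝟙 b₁) k (𝟙 c) g) f = bn₂ g (L₀.act k f)
  tn₁_dinat : ∀ {b b' b₂ b₃ c : Obj} (k : b ⟶ b') (g : T₃.Hom b' b₂ b₃ c) (f : L₀.Hom b),
    tn₁ (T₃.act k (𝟙 b₂) (𝟙 b₃) (𝟙 c) g) f = tn₁ g (L₀.act k f)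
  tn₂_dinat : ∀ {b b' b₁ b₃ c : Obj} (k : b ⟶ b') (g : T₃.Hom b₁ b' b₃ c) (f : L₀.Hom b),
    tn₂ (T₃.act (𝟙 b₁) k (𝟙 b₃) (𝟙 c) g) f = tn₂ g (L₀.act k f)
  tn₃_dinat : ∀ {b b' b₁ b₂ c : Obj} (k : b ⟶ b') (g : T₃.Hom b₁ b₂ b' c) (f : L₀.Hom b),
    tn₃ (T₃.act (𝟙 b₁) (𝟙 b₂) k (𝟙 c) g) f = tn₃ g (L₀.act k f)
  un_dinat : ∀ {b b' c : Obj} (k : b ⟶ b') (g : L₁.Hom b' c) (f : L₀.Hom b),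
    un (L₁.act k (𝟙 c) g) f = un g (L₀.act k f)
  bu₁_dinat : ∀ {a b b' b₂ c : Obj} (k : b ⟶ b') (g : T₂.Hom b' b₂ c) (f : L₁.Hom a b),
    bu₁ (T₂.act k (𝟙 b₂) (𝟙 c) g) f = bu₁ g (L₁.act (𝟙 a) k f)
  bu₂_dinat : ∀ {a b b' b₁ c : Obj} (k : b ⟶ b') (g : T₂.Hom b₁ b' c) (f : L₁.Hom a b),
    bu₂ (T₂.act (𝟙 b₁) k (𝟙 c) g) f = bu₂ g (L₁.act (𝟙 a) k f)
  ub_dinat : ∀ {a₁ a₂ b b' c : Obj} (k : b ⟶ b') (g : L₁.Hom b' c) (f : T₂.Hom a₁ a₂ b),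
    ub (L₁.act k (𝟙 c) g) f = ub g (T₂.act (𝟙 a₁) (𝟙 a₂) k f)
  -- Compatibility of the substitutions with the comparisons.
  bu₁_j : ∀ {a b₁ b₂ c : Obj} (g : T₂.Hom b₁ b₂ c) (p : a ⟶ b₁),
    bu₁ g (j₁ p) = j₂ (T₂.act p (𝟙 b₂) (𝟙 c) g)
  bu₂_j : ∀ {a b₁ b₂ c : Obj} (g : T₂.Hom b₁ b₂ c) (p : a ⟶ b₂),
    bu₂ g (j₁ p) = T₂.act (𝟙 b₁) p (𝟙 c) g
  ub_j : ∀ {a₁ a₂ b c : Obj} (p : b ⟶ c) (g : T₂.Hom a₁ a₂ b),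
    ub (j₁ p) g = j₂ (T₂.act (𝟙 a₁) (𝟙 a₂) p g)
  un_j : ∀ {b c : Obj} (p : b ⟶ c) (v : L₀.Hom b), un (j₁ p) v = L₀.act p v
  -- `f ∘ᵢ (g ∘ⱼ h) = (f ∘ᵢ g) ∘ᵢ₊ⱼ₋₁ h` for `f`, `g`, `h` binary.
  assoc_b₁₁ : ∀ {a₁ a₂ b₁ b₂ c₁ c₂ d : Obj} (f : T₂.Hom c₁ c₂ d) (g : T₂.Hom b₁ b₂ c₁)
    (h : T₂.Hom a₁ a₂ b₁), bt₁ f (bb₁ g h) = tb₁ (bb₁ f g) h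
  assoc_b₁₂ : ∀ {a₁ a₂ b₁ b₂ c₁ c₂ d : Obj} (f : T₂.Hom c₁ c₂ d) (g : T₂.Hom b₁ b₂ c₁)
    (h : T₂.Hom a₁ a₂ b₂), bt₁ f (bb₂ g h) = tb₂ (bb₁ f g) h
  assoc_b₂₁ : ∀ {a₁ a₂ b₁ b₂ c₁ c₂ d : Obj} (f : T₂.Hom c₁ c₂ d) (g : T₂.Hom b₁ b₂ c₂)
    (h : T₂.Hom a₁ a₂ b₁), bt₂ f (bb₁ g h) = tb₂ (bb₂ f g) h
  assoc_b₂₂ : ∀ {a₁ a₂ b₁ b₂ c₁ c₂ d : Obj} (f : T₂.Hom c₁ c₂ d) (g : T₂.Hom b₁ b₂ c₂)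
    (h : T₂.Hom a₁ a₂ b₂), bt₂ f (bb₂ g h) = tb₃ (bb₂ f g) h
  -- `f ∘ᵢ (g ∘ⱼ h) = (f ∘ᵢ g) ∘ᵢ₊ⱼ₋₁ h` for `f`, `g` binary and `h` nullary.
  assoc_n₁₁ : ∀ {b₁ b₂ c₁ c₂ d : Obj} (f : T₂.Hom c₁ c₂ d) (g : T₂.Hom b₁ b₂ c₁)
    (h : L₀.Hom b₁), bu₁ f (bn₁ g h) = tn₁ (bb₁ f g) h
  assoc_n₁₂ : ∀ {b₁ b₂ c₁ c₂ d : Obj} (f : T₂.Hom c₁ c₂ d) (g : T₂.Hom b₁ b₂ c₁)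
    (h : L₀.Hom b₂), T₂.act (bn₂ g h) (𝟙 c₂) (𝟙 d) f = tn₂ (bb₁ f g) h
  assoc_n₂₁ : ∀ {b₁ b₂ c₁ c₂ d : Obj} (f : T₂.Hom c₁ c₂ d) (g : T₂.Hom b₁ b₂ c₂)
    (h : L₀.Hom b₁), bu₂ f (bn₁ g h) = tn₂ (bb₂ f g) h
  assoc_n₂₂ : ∀ {b₁ b₂ c₁ c₂ d : Obj} (f : T₂.Hom c₁ c₂ d) (g : T₂.Hom b₁ b₂ c₂)
    (h : L₀.Hom b₂), T₂.act (𝟙 c₁) (bn₂ g h) (𝟙 d) f = tn₃ (bb₂ f g) h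
  -- `(f ∘₁ g) ∘ₙ₊₁ h = (f ∘₂ h) ∘₁ g` for `f` binary and `g`, `h` binary or nullary.
  comm_bb : ∀ {a₁ a₂ b₁ b₂ c₁ c₂ d : Obj} (f : T₂.Hom c₁ c₂ d) (g : T₂.Hom a₁ a₂ c₁)
    (h : T₂.Hom b₁ b₂ c₂), tb₃ (bb₁ f g) h = tb₁ (bb₂ f h) g
  comm_bn : ∀ {a₁ a₂ c₁ c₂ d : Obj} (f : T₂.Hom c₁ c₂ d) (g : T₂.Hom a₁ a₂ c₁)
    (h : L₀.Hom c₂), tn₃ (bb₁ f g) h = T₂.act (𝟙 a₁) (𝟙 a₂) (bn₂ f h) g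
  comm_nb : ∀ {b₁ b₂ c₁ c₂ d : Obj} (f : T₂.Hom c₁ c₂ d) (g : L₀.Hom c₁)
    (h : T₂.Hom b₁ b₂ c₂), ub (bn₁ f g) h = tn₁ (bb₂ f h) g
  comm_nn : ∀ {c₁ c₂ d : Obj} (f : T₂.Hom c₁ c₂ d) (g : L₀.Hom c₁) (h : L₀.Hom c₂),
    un (bn₁ f g) h = L₀.act (bn₂ f h) g

attribute [instance] ShortSkewMulticategory.category

/-- A morphism of short skew multicategories. -/
@[ext]
structure ShortSkewMultifunctor (M N : ShortSkewMulticategory.{v, u}) where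
  toFunctor : M.Obj ⥤ N.Obj
  mapT₂ : ∀ {a₁ a₂ c : M.Obj}, M.T₂.Hom a₁ a₂ c →
    N.T₂.Hom (toFunctor.obj a₁) (toFunctor.obj a₂) (toFunctor.obj c)
  mapT₃ : ∀ {a₁ a₂ a₃ c : M.Obj}, M.T₃.Hom a₁ a₂ a₃ c →
    N.T₃.Hom (toFunctor.obj a₁) (toFunctor.obj a₂) (toFunctor.obj a₃) (toFunctor.obj c)
  mapT₄ : ∀ {a₁ a₂ a₃ a₄ c : M.Obj}, M.T₄.Hom a₁ a₂ a₃ a₄ c →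
    N.T₄.Hom (toFunctor.obj a₁) (toFunctor.obj a₂) (toFunctor.obj a₃) (toFunctor.obj a₄)
      (toFunctor.obj c)
  mapL₀ : ∀ {c : M.Obj}, M.L₀.Hom c → N.L₀.Hom (toFunctor.obj c)
  mapL₁ : ∀ {a c : M.Obj}, M.L₁.Hom a c → N.L₁.Hom (toFunctor.obj a) (toFunctor.obj c)
  mapL₂ : ∀ {a₁ a₂ c : M.Obj}, M.L₂.Hom a₁ a₂ c →
    N.L₂.Hom (toFunctor.obj a₁) (toFunctor.obj a₂) (toFunctor.obj c)
  mapT₂_nat : ∀ {a₁ a₁' a₂ a₂' c c' : M.Obj} (p₁ : a₁' ⟶ a₁) (p₂ : a₂' ⟶ a₂) (h : c ⟶ c')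
    (f : M.T₂.Hom a₁ a₂ c), mapT₂ (M.T₂.act p₁ p₂ h f) =
      N.T₂.act (toFunctor.map p₁) (toFunctor.map p₂) (toFunctor.map h) (mapT₂ f)
  mapT₃_nat : ∀ {a₁ a₁' a₂ a₂' a₃ a₃' c c' : M.Obj} (p₁ : a₁' ⟶ a₁) (p₂ : a₂' ⟶ a₂)
    (p₃ : a₃' ⟶ a₃) (h : c ⟶ c') (f : M.T₃.Hom a₁ a₂ a₃ c),
    mapT₃ (M.T₃.act p₁ p₂ p₃ h f) = N.T₃.act (toFunctor.map p₁) (toFunctor.map p₂)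
      (toFunctor.map p₃) (toFunctor.map h) (mapT₃ f)
  mapT₄_nat : ∀ {a₁ a₁' a₂ a₂' a₃ a₃' a₄ a₄' c c' : M.Obj} (p₁ : a₁' ⟶ a₁) (p₂ : a₂' ⟶ a₂)
    (p₃ : a₃' ⟶ a₃) (p₄ : a₄' ⟶ a₄) (h : c ⟶ c') (f : M.T₄.Hom a₁ a₂ a₃ a₄ c),
    mapT₄ (M.T₄.act p₁ p₂ p₃ p₄ h f) = N.T₄.act (toFunctor.map p₁) (toFunctor.map p₂)
      (toFunctor.map p₃) (toFunctor.map p₄) (toFunctor.map h) (mapT₄ f)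
  mapL₀_nat : ∀ {c c' : M.Obj} (h : c ⟶ c') (f : M.L₀.Hom c),
    mapL₀ (M.L₀.act h f) = N.L₀.act (toFunctor.map h) (mapL₀ f)
  mapL₁_nat : ∀ {a a' c c' : M.Obj} (p : a' ⟶ a) (h : c ⟶ c') (f : M.L₁.Hom a c),
    mapL₁ (M.L₁.act p h f) = N.L₁.act (toFunctor.map p) (toFunctor.map h) (mapL₁ f)
  mapL₂_nat : ∀ {a₁ a₁' a₂ a₂' c c' : M.Obj} (p₁ : a₁' ⟶ a₁) (p₂ : a₂' ⟶ a₂) (h : c ⟶ c')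
    (f : M.L₂.Hom a₁ a₂ c), mapL₂ (M.L₂.act p₁ p₂ h f) =
      N.L₂.act (toFunctor.map p₁) (toFunctor.map p₂) (toFunctor.map h) (mapL₂ f)
  map_j₁ : ∀ {a c : M.Obj} (f : a ⟶ c), mapL₁ (M.j₁ f) = N.j₁ (toFunctor.map f)
  map_j₂ : ∀ {a₁ a₂ c : M.Obj} (f : M.T₂.Hom a₁ a₂ c), mapL₂ (M.j₂ f) = N.j₂ (mapT₂ f)
  map_bb₁ : ∀ {a₁ a₂ b₁ b₂ c : M.Obj} (g : M.T₂.Hom b₁ b₂ c) (f : M.T₂.Hom a₁ a₂ b₁),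
    mapT₃ (M.bb₁ g f) = N.bb₁ (mapT₂ g) (mapT₂ f)
  map_bb₂ : ∀ {a₁ a₂ b₁ b₂ c : M.Obj} (g : M.T₂.Hom b₁ b₂ c) (f : M.T₂.Hom a₁ a₂ b₂),
    mapT₃ (M.bb₂ g f) = N.bb₂ (mapT₂ g) (mapT₂ f)
  map_tb₁ : ∀ {a₁ a₂ b₁ b₂ b₃ c : M.Obj} (g : M.T₃.Hom b₁ b₂ b₃ c) (f : M.T₂.Hom a₁ a₂ b₁),
    mapT₄ (M.tb₁ g f) = N.tb₁ (mapT₃ g) (mapT₂ f)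
  map_tb₂ : ∀ {a₁ a₂ b₁ b₂ b₃ c : M.Obj} (g : M.T₃.Hom b₁ b₂ b₃ c) (f : M.T₂.Hom a₁ a₂ b₂),
    mapT₄ (M.tb₂ g f) = N.tb₂ (mapT₃ g) (mapT₂ f)
  map_tb₃ : ∀ {a₁ a₂ b₁ b₂ b₃ c : M.Obj} (g : M.T₃.Hom b₁ b₂ b₃ c) (f : M.T₂.Hom a₁ a₂ b₃),
    mapT₄ (M.tb₃ g f) = N.tb₃ (mapT₃ g) (mapT₂ f)
  map_bt₁ : ∀ {a₁ a₂ a₃ b₁ b₂ c : M.Obj} (g : M.T₂.Hom b₁ b₂ c) (f : M.T₃.Hom a₁ a₂ a₃ b₁),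
    mapT₄ (M.bt₁ g f) = N.bt₁ (mapT₂ g) (mapT₃ f)
  map_bt₂ : ∀ {a₁ a₂ a₃ b₁ b₂ c : M.Obj} (g : M.T₂.Hom b₁ b₂ c) (f : M.T₃.Hom a₁ a₂ a₃ b₂),
    mapT₄ (M.bt₂ g f) = N.bt₂ (mapT₂ g) (mapT₃ f)
  map_bn₁ : ∀ {b₁ b₂ c : M.Obj} (g : M.T₂.Hom b₁ b₂ c) (f : M.L₀.Hom b₁),
    mapL₁ (M.bn₁ g f) = N.bn₁ (mapT₂ g) (mapL₀ f)
  map_bn₂ : ∀ {b₁ b₂ c : M.Obj} (g : M.T₂.Hom b₁ b₂ c) (f : M.L₀.Hom b₂),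
    toFunctor.map (M.bn₂ g f) = N.bn₂ (mapT₂ g) (mapL₀ f)
  map_tn₁ : ∀ {b₁ b₂ b₃ c : M.Obj} (g : M.T₃.Hom b₁ b₂ b₃ c) (f : M.L₀.Hom b₁),
    mapL₂ (M.tn₁ g f) = N.tn₁ (mapT₃ g) (mapL₀ f)
  map_tn₂ : ∀ {b₁ b₂ b₃ c : M.Obj} (g : M.T₃.Hom b₁ b₂ b₃ c) (f : M.L₀.Hom b₂),
    mapT₂ (M.tn₂ g f) = N.tn₂ (mapT₃ g) (mapL₀ f)
  map_tn₃ : ∀ {b₁ b₂ b₃ c : M.Obj} (g : M.T₃.Hom b₁ b₂ b₃ c) (f : M.L₀.Hom b₃),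
    mapT₂ (M.tn₃ g f) = N.tn₃ (mapT₃ g) (mapL₀ f)
  map_un : ∀ {b c : M.Obj} (g : M.L₁.Hom b c) (f : M.L₀.Hom b),
    mapL₀ (M.un g f) = N.un (mapL₁ g) (mapL₀ f)
  map_bu₁ : ∀ {a b₁ b₂ c : M.Obj} (g : M.T₂.Hom b₁ b₂ c) (f : M.L₁.Hom a b₁),
    mapL₂ (M.bu₁ g f) = N.bu₁ (mapT₂ g) (mapL₁ f)
  map_bu₂ : ∀ {a b₁ b₂ c : M.Obj} (g : M.T₂.Hom b₁ b₂ c) (f : M.L₁.Hom a b₂),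
    mapT₂ (M.bu₂ g f) = N.bu₂ (mapT₂ g) (mapL₁ f)
  map_ub : ∀ {a₁ a₂ b c : M.Obj} (g : M.L₁.Hom b c) (f : M.T₂.Hom a₁ a₂ b),
    mapL₂ (M.ub g f) = N.ub (mapL₁ g) (mapT₂ f)

namespace ShortSkewMultifunctor

def id (M : ShortSkewMulticategory.{v, u}) : ShortSkewMultifunctor M M where
  toFunctor := 𝟭 _
  mapT₂ f := f
  mapT₃ f := f
  mapT₄ f := f
  mapL₀ f := f
  mapL₁ f := f
  mapL₂ f := f
  mapT₂_nat _ _ _ _ := rfl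
  mapT₃_nat _ _ _ _ _ := rfl
  mapT₄_nat _ _ _ _ _ _ := rfl
  mapL₀_nat _ _ := rfl
  mapL₁_nat _ _ _ := rfl
  mapL₂_nat _ _ _ _ := rfl
  map_j₁ _ := rfl
  map_j₂ _ := rfl
  map_bb₁ _ _ := rfl
  map_bb₂ _ _ := rfl
  map_tb₁ _ _ := rfl
  map_tb₂ _ _ := rfl
  map_tb₃ _ _ := rfl
  map_bt₁ _ _ := rfl
  map_bt₂ _ _ := rfl
  map_bn₁ _ _ := rfl
  map_bn₂ _ _ := rfl
  map_tn₁ _ _ := rfl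
  map_tn₂ _ _ := rfl
  map_tn₃ _ _ := rfl
  map_un _ _ := rfl
  map_bu₁ _ _ := rfl
  map_bu₂ _ _ := rfl
  map_ub _ _ := rfl

def comp {M N P : ShortSkewMulticategory.{v, u}} (F : ShortSkewMultifunctor M N)
    (G : ShortSkewMultifunctor N P) : ShortSkewMultifunctor M P where
  toFunctor := F.toFunctor ⋙ G.toFunctor
  mapT₂ f := G.mapT₂ (F.mapT₂ f)
  mapT₃ f := G.mapT₃ (F.mapT₃ f)
  mapT₄ f := G.mapT₄ (F.mapT₄ f)
  mapL₀ f := G.mapL₀ (F.mapL₀ f)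
  mapL₁ f := G.mapL₁ (F.mapL₁ f)
  mapL₂ f := G.mapL₂ (F.mapL₂ f)
  mapT₂_nat _ _ _ _ := by rw [F.mapT₂_nat, G.mapT₂_nat]; rfl
  mapT₃_nat _ _ _ _ _ := by rw [F.mapT₃_nat, G.mapT₃_nat]; rfl
  mapT₄_nat _ _ _ _ _ _ := by rw [F.mapT₄_nat, G.mapT₄_nat]; rfl
  mapL₀_nat _ _ := by rw [F.mapL₀_nat, G.mapL₀_nat]; rfl
  mapL₁_nat _ _ _ := by rw [F.mapL₁_nat, G.mapL₁_nat]; rfl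
  mapL₂_nat _ _ _ _ := by rw [F.mapL₂_nat, G.mapL₂_nat]; rfl
  map_j₁ _ := by rw [F.map_j₁, G.map_j₁]; rfl
  map_j₂ _ := by rw [F.map_j₂, G.map_j₂]
  map_bb₁ _ _ := by rw [F.map_bb₁, G.map_bb₁]
  map_bb₂ _ _ := by rw [F.map_bb₂, G.map_bb₂]
  map_tb₁ _ _ := by rw [F.map_tb₁, G.map_tb₁]
  map_tb₂ _ _ := by rw [F.map_tb₂, G.map_tb₂]
  map_tb₃ _ _ := by rw [F.map_tb₃, G.map_tb₃]
  map_bt₁ _ _ := by rw [F.map_bt₁, G.map_bt₁]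
  map_bt₂ _ _ := by rw [F.map_bt₂, G.map_bt₂]
  map_bn₁ _ _ := by rw [F.map_bn₁, G.map_bn₁]
  map_bn₂ _ _ := by rw [Functor.comp_map, F.map_bn₂, G.map_bn₂]
  map_tn₁ _ _ := by rw [F.map_tn₁, G.map_tn₁]
  map_tn₂ _ _ := by rw [F.map_tn₂, G.map_tn₂]
  map_tn₃ _ _ := by rw [F.map_tn₃, G.map_tn₃]
  map_un _ _ := by rw [F.map_un, G.map_un]
  map_bu₁ _ _ := by rw [F.map_bu₁, G.map_bu₁]
  map_bu₂ _ _ := by rw [F.map_bu₂, G.map_bu₂]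
  map_ub _ _ := by rw [F.map_ub, G.map_ub]

end ShortSkewMultifunctor

instance : Category ShortSkewMulticategory.{v, u} where
  Hom := ShortSkewMultifunctor
  id := ShortSkewMultifunctor.id
  comp := ShortSkewMultifunctor.comp
  id_comp _ := rfl
  comp_id _ := rfl
  assoc _ _ _ := rfl

namespace SkewMulticategory

variable (M : SkewMulticategory.{v, u})

/-- The underlying category: the morphisms are the tight unary maps. -/
instance underlying : Category.{v} M.Obj where
  Hom a b := M.Hom tight [a] b
  id a := M.id a
  comp {a _ _} f g := M.sub [] [] (z := tight) (cs := [a]) rfl rfl rfl g f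
  id_comp _ := M.sub_id [] [] _ _ _ _
  comp_id _ := M.id_sub _ _ _ _
  assoc _ _ _ := M.assoc [] [] [] [] _ _ _ _ _ _ _ _ _ _ _ _ _ _

variable {M}

/-- Substitution of `f` into a tight unary map `h`. -/
def post {x : Tightness} {as : List M.Obj} {b c : M.Obj} (h : b ⟶ c) (f : M.Hom x as b) :
    M.Hom x as c :=
  M.sub [] [] rfl rfl (by simp) h f

/-- Substitution of a tight unary map `p` into the variable of `g` preceded by `l` and
followed by `r`. -/
def pre {x : Tightness} (l r : List M.Obj) {bs bs' : List M.Obj} {a b c : M.Obj}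
    (hb : bs = l ++ b :: r) (hb' : bs' = l ++ a :: r) (g : M.Hom x bs c) (p : a ⟶ b) :
    M.Hom x bs' c :=
  M.sub l r (Tightness.sub_tight x l) hb (by simp [hb']) g p

theorem post_id {x : Tightness} {as : List M.Obj} {b : M.Obj} (f : M.Hom x as b) :
    post (𝟙 b) f = f := M.id_sub _ _ _ _

theorem pre_id {x : Tightness} (l r : List M.Obj) {bs : List M.Obj} {b c : M.Obj}
    (hb : bs = l ++ b :: r) (g : M.Hom x bs c) : pre l r hb hb g (𝟙 b) = g := M.sub_id _ _ _ _ _ _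

theorem post_comp {x : Tightness} {as : List M.Obj} {b c d : M.Obj} (h : b ⟶ c) (h' : c ⟶ d)
    (f : M.Hom x as b) : post (h ≫ h') f = post h' (post h f) :=
  (M.assoc [] [] [] [] _ _ _ _ _ _ _ _ _ _ _ _ _ _).symm

theorem sub_eq {l r l' r' : List M.Obj} (hl : l = l') (hr : r = r') {x y z : Tightness}
    {as bs cs : List M.Obj} {b c : M.Obj} (hz : z = x.sub l y) (hb : bs = l ++ b :: r)
    (hc : cs = l ++ as ++ r) (hz' : z = x.sub l' y) (hb' : bs = l' ++ b :: r')
    (hc' : cs = l' ++ as ++ r') (g : M.Hom x bs c) (f : M.Hom y as b) :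
    M.sub l r hz hb hc g f = M.sub l' r' hz' hb' hc' g f := by
  subst hl hr; rfl

theorem pre_comp {x : Tightness} (l r : List M.Obj) {bs bs' bs'' : List M.Obj} {a a' b c : M.Obj}
    (hb : bs = l ++ b :: r) (hb' : bs' = l ++ a :: r) (hb'' : bs'' = l ++ a' :: r)
    (g : M.Hom x bs c) (p : a ⟶ b) (q : a' ⟶ a) :
    pre l r hb hb'' g (q ≫ p) = pre l r hb' hb'' (pre l r hb hb' g p) q :=
  (M.assoc l r [] [] _ _ _ _ _ _ (Tightness.sub_tight x l) (by simp [hb'])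
    (by simpa using Tightness.sub_tight x l) (by simp [hb']) (by simp [hb'']) _ _ _).trans
    (sub_eq (by simp) (by simp) _ _ _ _ _ _ _ _)

theorem pre_post {x : Tightness} (l r : List M.Obj) {bs bs' : List M.Obj} {a b c d : M.Obj}
    (hb : bs = l ++ b :: r) (hb' : bs' = l ++ a :: r) (h : c ⟶ d) (g : M.Hom x bs c) (p : a ⟶ b) :
    pre l r hb hb' (post h g) p = post h (pre l r hb hb' g p) :=
  ((M.assoc [] [] l r _ _ _ _ _ _ _ _ (Tightness.sub_tight x l) (by simp [hb]) (by simp [hb']) _ _ _).trans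
    (sub_eq (by simp) (by simp) _ _ _ _ _ _ _ _)).symm

theorem pre_pre {x : Tightness} (l m r : List M.Obj) {bs bs₁ bs₂ bs' : List M.Obj}
    {a a' b b' c : M.Obj}
    {l₁ l₂ r₁ r₂ : List M.Obj} (hl₁ : l₁ = l ++ a :: m) (hl₂ : l₂ = l ++ b :: m)
    (hr₁ : r₁ = m ++ a' :: r) (hr₂ : r₂ = m ++ b' :: r)
    (h₁ : bs = l ++ b :: r₂) (h₂ : bs₁ = l ++ a :: r₂)
    (h₃ : bs₁ = l₁ ++ b' :: r) (h₄ : bs' = l₁ ++ a' :: r)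
    (h₅ : bs = l₂ ++ b' :: r) (h₆ : bs₂ = l₂ ++ a' :: r)
    (h₇ : bs₂ = l ++ b :: r₁) (h₈ : bs' = l ++ a :: r₁) (g : M.Hom x bs c) (p : a ⟶ b)
    (q : a' ⟶ b') :
    pre l r₁ h₇ h₈ (pre l₂ r h₅ h₆ g q) p = pre l₁ r h₃ h₄ (pre l r₂ h₁ h₂ g p) q := by
  subst hl₁ hl₂ hr₁ hr₂
  refine Eq.symm (Eq.trans ?_ ((M.comm l m r (gs := [a]) (as := [a']) (hs := bs₁) (hs' := bs₂)
    (Tightness.sub_tight x l) h₁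
    (by simp [h₂]) (Tightness.sub_tight x _) (by simp [h₃]) (by simp [h₄]) (Tightness.sub_tight x _) h₅ (by simp [h₆])
    (Tightness.sub_tight x _) (by simp [h₇]) (by simp [h₈]) g p q).trans ?_)) <;>
  exact sub_eq (by simp) (by simp) _ _ _ _ _ _ _ _

/-! Substitution commutes with the action of tight unary maps. -/

section

variable {x y z : Tightness} {l r as bs cs : List M.Obj} {b c : M.Obj}

theorem sub_post_congr {d : M.Obj} {h : c ⟶ d} {hz : z = x.sub l y} {hb : bs = l ++ b :: r}
    {hc : cs = l ++ as ++ r} {g : M.Hom x bs c} {f : M.Hom y as b} {s : M.Hom z cs c}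
    (hs : M.sub l r hz hb hc g f = s) :
    M.sub l r hz hb hc (post h g) f = post h s := by
  rw [← hs]
  exact ((M.assoc [] [] l r (x := tight) (hs := bs) hz hb hc rfl rfl (by simp) rfl (by simp) hz (by simp [hb])
    (by simp [hc]) h g f).trans (sub_eq (by simp) (by simp) _ _ _ _ _ _ _ _)).symm

theorem sub_pre_mid_congr {L R l' r' as' cs' : List M.Obj} {a a' : M.Obj} {p : a' ⟶ a}
    (hL : L = l ++ l') (hR : R = r' ++ r) {hz : z = x.sub l y} {hb : bs = l ++ b :: r}
    {hc' : cs' = l ++ as' ++ r} {ha : as = l' ++ a :: r'} {ha' : as' = l' ++ a' :: r'}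
    {h₁ : cs = L ++ a :: R} {h₂ : cs' = L ++ a' :: R} {g : M.Hom x bs c} {f : M.Hom y as b}
    {s : M.Hom z cs c} (hs : ∀ hc, M.sub l r hz hb hc g f = s) :
    M.sub l r hz hb hc' g (pre l' r' ha ha' f p) = pre L R h₁ h₂ s p := by
  have hc : cs = l ++ as ++ r := by rw [h₁, ha, hL, hR]; simp
  rw [← hs hc]
  subst hL hR
  exact M.assoc l r l' r' (as := [a']) (Tightness.sub_tight y l') ha _ hz hb _ hz hc (Tightness.sub_tight z _) h₁ _ _ _ _

theorem sub_pre_left_congr {l₀ m r₀ R l' bs' cs' : List M.Obj} {a a' : M.Obj} {p : a' ⟶ a}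
    (hl : l = l₀ ++ a :: m) (hl' : l' = l₀ ++ a' :: m) (hr : r₀ = m ++ b :: r)
    (hR : R = m ++ as ++ r) {hz' : z = x.sub l' y} {hb : bs = l₀ ++ a :: r₀}
    {hb' : bs' = l₀ ++ a' :: r₀} {hb'' : bs' = l' ++ b :: r} {hc' : cs' = l' ++ as ++ r}
    {h₁ : cs = l₀ ++ a :: R} {h₂ : cs' = l₀ ++ a' :: R} {g : M.Hom x bs c} {f : M.Hom y as b}
    {s : M.Hom z cs c} (hs : ∀ hz hb hc, M.sub l r hz hb hc g f = s) :
    M.sub l' r hz' hb'' hc' (pre l₀ r₀ hb hb' g p) f = pre l₀ R h₁ h₂ s p := by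
  have hz : z = x.sub l y := hz'.trans (Tightness.sub_congr _ _ (by simp [hl, hl']))
  rw [← hs hz (by rw [hb, hr, hl]; simp) (by rw [h₁, hR, hl]; simp)]
  subst hl hl' hr hR
  refine Eq.trans ?_ ((M.comm l₀ m r (gs := [a']) (hs := bs') (hs' := cs)
    (Tightness.sub_tight x _) hb (by simp [hb'])
    (hz'.trans (Tightness.sub_congr _ _ (by simp))) (by simp [hb'']) (by simp [hc']) hz
    (by simp [hb]) (by simp [h₁]) (Tightness.sub_tight _ _) h₁ (by simp [h₂]) g p f).trans ?_) <;>
  exact sub_eq (by simp) (by simp) _ _ _ _ _ _ _ _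

theorem sub_pre_right_congr {m l₀ r₀ L r' bs' cs' : List M.Obj} {a a' : M.Obj} {p : a' ⟶ a}
    (hl : l₀ = l ++ b :: m) (hr : r = m ++ a :: r₀) (hr' : r' = m ++ a' :: r₀)
    (hL : L = l ++ as ++ m) {hz : z = x.sub l y} {hb : bs = l₀ ++ a :: r₀}
    {hb' : bs' = l₀ ++ a' :: r₀} {hb'' : bs' = l ++ b :: r'} {hc' : cs' = l ++ as ++ r'}
    {h₁ : cs = L ++ a :: r₀} {h₂ : cs' = L ++ a' :: r₀} {g : M.Hom x bs c} {f : M.Hom y as b}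
    {s : M.Hom z cs c} (hs : ∀ hb hc, M.sub l r hz hb hc g f = s) :
    M.sub l r' hz hb'' hc' (pre l₀ r₀ hb hb' g p) f = pre L r₀ h₁ h₂ s p := by
  rw [← hs (by rw [hb, hr, hl]; simp) (by rw [h₁, hr, hL]; simp)]
  subst hl hr hr' hL
  refine Eq.symm (Eq.trans ?_ ((M.comm l m r₀ (as := [a']) (hs := cs) (hs' := bs')
    hz (by simp [hb]) (by simp [h₁])
    (Tightness.sub_tight _ _) (by simp [h₁]) (by simp [h₂]) (Tightness.sub_tight _ _)
    hb (by simp [hb']) hz (by simp [hb']) (by simp [h₂]) g f p).trans ?_)) <;>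
  exact sub_eq (by simp) (by simp) _ _ _ _ _ _ _ _

theorem sub_dinat {l' r' bs' : List M.Obj} {b' : M.Obj} {k : b ⟶ b'} (hl : l' = l) (hr : r' = r)
    {hz : z = x.sub l y}
    {hb : bs = l' ++ b' :: r'} {hb' : bs' = l' ++ b :: r'} {hb'' : bs' = l ++ b :: r}
    {hb₁ : bs = l ++ b' :: r} {hc : cs = l ++ as ++ r}
    {g : M.Hom x bs c} {f : M.Hom y as b} :
    M.sub l r hz hb'' hc (pre l' r' hb hb' g k) f = M.sub l r hz hb₁ hc g (post k f) := by
  subst hl hr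
  exact ((M.assoc l' r' [] [] _ _ _ hz hb _ (Tightness.sub_tight _ _) (by simp [hb''])
    (hz.trans (Tightness.sub_congr _ _ (by simp))) (by simp [hb'']) (by simp [hc]) _ _ _).trans
    (sub_eq (by simp) (by simp) _ _ _ _ _ _ _ _)).symm

end

theorem j_post {as : List M.Obj} {b c : M.Obj} (h : b ⟶ c) (f : M.Hom tight as b) :
    M.j (post h f) = post h (M.j f) :=
  M.loosen_sub [] [] (x := tight) (x' := tight) (y := tight) (y' := loose) (z := tight)
    (z' := loose) rfl rfl rfl _ trivial trivial trivial h f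

theorem j_pre (l r : List M.Obj) {bs bs' : List M.Obj} {a b c : M.Obj}
    (hb : bs = l ++ b :: r) (hb' : bs' = l ++ a :: r) (g : M.Hom tight bs c) (p : a ⟶ b) :
    M.j (pre l r hb hb' g p) = pre l r hb hb' (M.j g) p :=
  M.loosen_sub l r (x := tight) (x' := loose) (y := tight) (y' := tight) (z := tight)
    (z' := loose) (Tightness.sub_tight _ _) (Tightness.sub_tight _ _) hb _ trivial trivial trivial g p

end SkewMulticategory

namespace SkewMulticategory

variable (M : SkewMulticategory.{v, u})

section

variable {M} {x : Tightness} {a₁ a₁' a₂ a₂' a₃ a₃' a₄ a₄' c : M.Obj}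

theorem pre₁₂ (t : List M.Obj) (f : M.Hom x (a₁ :: a₂ :: t) c) (p : a₁' ⟶ a₁) (q : a₂' ⟶ a₂) :
    pre [] (a₂' :: t) rfl rfl (pre [a₁] t rfl rfl f q) p =
      pre [a₁'] t rfl rfl (pre [] (a₂ :: t) rfl rfl f p) q :=
  pre_pre [] [] t rfl rfl rfl rfl _ _ _ _ _ _ _ _ _ _ _

theorem pre₁₃ (t : List M.Obj) (f : M.Hom x (a₁ :: a₂ :: a₃ :: t) c) (p : a₁' ⟶ a₁)
    (q : a₃' ⟶ a₃) : pre [] (a₂ :: a₃' :: t) rfl rfl (pre [a₁, a₂] t rfl rfl f q) p =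
      pre [a₁', a₂] t rfl rfl (pre [] (a₂ :: a₃ :: t) rfl rfl f p) q :=
  pre_pre [] [a₂] t rfl rfl rfl rfl _ _ _ _ _ _ _ _ _ _ _

theorem pre₁₄ (f : M.Hom x [a₁, a₂, a₃, a₄] c) (p : a₁' ⟶ a₁) (q : a₄' ⟶ a₄) :
    pre [] [a₂, a₃, a₄'] rfl rfl (pre [a₁, a₂, a₃] [] rfl rfl f q) p =
      pre [a₁', a₂, a₃] [] rfl rfl (pre [] [a₂, a₃, a₄] rfl rfl f p) q :=
  pre_pre [] [a₂, a₃] [] rfl rfl rfl rfl _ _ _ _ _ _ _ _ _ _ _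

theorem pre₂₃ (t : List M.Obj) (f : M.Hom x (a₁ :: a₂ :: a₃ :: t) c) (p : a₂' ⟶ a₂)
    (q : a₃' ⟶ a₃) : pre [a₁] (a₃' :: t) rfl rfl (pre [a₁, a₂] t rfl rfl f q) p =
      pre [a₁, a₂'] t rfl rfl (pre [a₁] (a₃ :: t) rfl rfl f p) q :=
  pre_pre [a₁] [] t rfl rfl rfl rfl _ _ _ _ _ _ _ _ _ _ _

theorem pre₂₄ (f : M.Hom x [a₁, a₂, a₃, a₄] c) (p : a₂' ⟶ a₂) (q : a₄' ⟶ a₄) :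
    pre [a₁] [a₃, a₄'] rfl rfl (pre [a₁, a₂, a₃] [] rfl rfl f q) p =
      pre [a₁, a₂', a₃] [] rfl rfl (pre [a₁] [a₃, a₄] rfl rfl f p) q :=
  pre_pre [a₁] [a₃] [] rfl rfl rfl rfl _ _ _ _ _ _ _ _ _ _ _

theorem pre₃₄ (f : M.Hom x [a₁, a₂, a₃, a₄] c) (p : a₃' ⟶ a₃) (q : a₄' ⟶ a₄) :
    pre [a₁, a₂] [a₄'] rfl rfl (pre [a₁, a₂, a₃] [] rfl rfl f q) p =
      pre [a₁, a₂, a₃'] [] rfl rfl (pre [a₁, a₂] [a₄] rfl rfl f p) q :=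
  pre_pre [a₁, a₂] [] [] rfl rfl rfl rfl _ _ _ _ _ _ _ _ _ _ _

end

/-- The short skew multicategory obtained by forgetting. -/
def toShort : ShortSkewMulticategory.{v, u} where
  Obj := M.Obj
  T₂ :=
    { Hom a₁ a₂ c := M.Hom tight [a₁, a₂] c
      act {_ a₁' a₂ _ _ _} p₁ p₂ h f := post h (pre [a₁'] [] rfl rfl (pre [] [a₂] rfl rfl f p₁) p₂)
      act_id _ := by simp only [post_id, pre_id]
      act_comp _ _ _ _ _ _ _ := by
        simp only [post_comp, pre_comp (hb' := rfl), pre_post, pre₁₂] }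
  T₃ :=
    { Hom a₁ a₂ a₃ c := M.Hom tight [a₁, a₂, a₃] c
      act {_ a₁' a₂ a₂' a₃ _ _ _} p₁ p₂ p₃ h f :=
        post h (pre [a₁', a₂'] [] rfl rfl (pre [a₁'] [a₃] rfl rfl (pre [] [a₂, a₃] rfl rfl f p₁) p₂)
          p₃)
      act_id _ := by simp only [post_id, pre_id]
      act_comp _ _ _ _ _ _ _ _ _ := by
        simp only [post_comp, pre_comp (hb' := rfl), pre_post, pre₁₂, pre₁₃, pre₂₃] }
  T₄ :=
    { Hom a₁ a₂ a₃ a₄ c := M.Hom tight [a₁, a₂, a₃, a₄] c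
      act {_ a₁' a₂ a₂' a₃ a₃' a₄ _ _ _} p₁ p₂ p₃ p₄ h f :=
        post h (pre [a₁', a₂', a₃'] [] rfl rfl (pre [a₁', a₂'] [a₄] rfl rfl
          (pre [a₁'] [a₃, a₄] rfl rfl (pre [] [a₂, a₃, a₄] rfl rfl f p₁) p₂) p₃) p₄)
      act_id _ := by simp only [post_id, pre_id]
      act_comp _ _ _ _ _ _ _ _ _ _ _ := by
        simp only [post_comp, pre_comp (hb' := rfl), pre_post, pre₁₂, pre₁₃, pre₁₄, pre₂₃, pre₂₄,
          pre₃₄] }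
  L₀ :=
    { Hom c := M.Hom loose [] c
      act h f := post h f
      act_id _ := post_id _
      act_comp _ _ _ := post_comp _ _ _ }
  L₁ :=
    { Hom a c := M.Hom loose [a] c
      act p h f := post h (pre [] [] rfl rfl f p)
      act_id _ := by simp only [post_id, pre_id]
      act_comp p p' h h' f := by
        rw [post_comp, pre_comp (hb' := rfl)]
        simp only [pre_post] }
  L₂ :=
    { Hom a₁ a₂ c := M.Hom loose [a₁, a₂] c
      act {_ a₁' a₂ _ _ _} p₁ p₂ h f := post h (pre [a₁'] [] rfl rfl (pre [] [a₂] rfl rfl f p₁) p₂)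
      act_id _ := by simp only [post_id, pre_id]
      act_comp _ _ _ _ _ _ _ := by
        simp only [post_comp, pre_comp (hb' := rfl), pre_post, pre₁₂] }
  j₁ f := M.j f
  j₂ f := M.j f
  j₁_nat p h f := by
    simp only [← j_pre, ← j_post]
    exact congrArg M.j (Category.assoc p f h).symm
  j₂_nat p₁ p₂ h f := by
    simp only [j_post, j_pre]
  bb₁ {_ _ _ b₂ _} g f := M.sub [] [b₂] rfl rfl rfl g f
  bb₂ {_ _ b₁ _ _} g f := M.sub [b₁] [] rfl rfl rfl g f
  tb₁ {_ _ _ b₂ b₃ _} g f := M.sub [] [b₂, b₃] rfl rfl rfl g f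
  tb₂ {_ _ b₁ _ b₃ _} g f := M.sub [b₁] [b₃] rfl rfl rfl g f
  tb₃ {_ _ b₁ b₂ _ _} g f := M.sub [b₁, b₂] [] rfl rfl rfl g f
  bt₁ {_ _ _ _ b₂ _} g f := M.sub [] [b₂] rfl rfl rfl g f
  bt₂ {_ _ _ b₁ _ _} g f := M.sub [b₁] [] rfl rfl rfl g f
  bn₁ {_ b₂ _} g f := M.sub [] [b₂] rfl rfl rfl g f
  bn₂ {b₁ _ _} g f := M.sub (z := tight) (cs := [b₁]) [b₁] [] rfl rfl rfl g f
  tn₁ {_ b₂ b₃ _} g f := M.sub [] [b₂, b₃] rfl rfl rfl g f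
  tn₂ {b₁ _ b₃ _} g f := M.sub [b₁] [b₃] rfl rfl rfl g f
  tn₃ {b₁ b₂ _ _} g f := M.sub [b₁, b₂] [] rfl rfl rfl g f
  un g f := M.sub [] [] rfl rfl rfl g f
  bu₁ {_ _ b₂ _} g f := M.sub [] [b₂] rfl rfl rfl g f
  bu₂ {_ b₁ _ _} g f := M.sub [b₁] [] rfl rfl rfl g f
  ub g f := M.sub [] [] rfl rfl rfl g f
  bb₁_nat p₁ p₂ q₂ h g f := by
    simp only [post_id, pre_id]
    refine sub_post_congr (sub_pre_right_congr (by rfl) (by rfl) (by rfl) (by rfl) fun _ _ => ?_)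
    exact sub_pre_mid_congr (by rfl) (by rfl) fun _ => sub_pre_mid_congr (by rfl) (by rfl) fun _ => rfl
  bb₂_nat p₁ p₂ q₁ h g f := by
    simp only [post_id, pre_id]
    refine sub_post_congr (sub_pre_mid_congr (by rfl) (by rfl) fun _ => sub_pre_mid_congr (by rfl) (by rfl) fun _ => ?_)
    exact sub_pre_left_congr (by rfl) (by rfl) (by rfl) (by rfl) fun _ _ _ => rfl
  tb₁_nat := by
    intros
    simp only [post_id, pre_id]
    refine sub_post_congr ?_
    repeat first
      | exact rfl
      | refine sub_pre_right_congr (by rfl) (by rfl) (by rfl) (by rfl) fun _ _ => ?_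
      | refine sub_pre_mid_congr (by rfl) (by rfl) fun _ => ?_
      | refine sub_pre_left_congr (by rfl) (by rfl) (by rfl) (by rfl) fun _ _ _ => ?_
  tb₂_nat := by
    intros
    simp only [post_id, pre_id]
    refine sub_post_congr ?_
    repeat first
      | exact rfl
      | refine sub_pre_right_congr (by rfl) (by rfl) (by rfl) (by rfl) fun _ _ => ?_
      | refine sub_pre_mid_congr (by rfl) (by rfl) fun _ => ?_
      | refine sub_pre_left_congr (by rfl) (by rfl) (by rfl) (by rfl) fun _ _ _ => ?_
  tb₃_nat := by
    intros
    simp only [post_id, pre_id]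
    refine sub_post_congr ?_
    repeat first
      | exact rfl
      | refine sub_pre_right_congr (by rfl) (by rfl) (by rfl) (by rfl) fun _ _ => ?_
      | refine sub_pre_mid_congr (by rfl) (by rfl) fun _ => ?_
      | refine sub_pre_left_congr (by rfl) (by rfl) (by rfl) (by rfl) fun _ _ _ => ?_
  bt₁_nat := by
    intros
    simp only [post_id, pre_id]
    refine sub_post_congr ?_
    repeat first
      | exact rfl
      | refine sub_pre_right_congr (by rfl) (by rfl) (by rfl) (by rfl) fun _ _ => ?_
      | refine sub_pre_mid_congr (by rfl) (by rfl) fun _ => ?_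
      | refine sub_pre_left_congr (by rfl) (by rfl) (by rfl) (by rfl) fun _ _ _ => ?_
  bt₂_nat := by
    intros
    simp only [post_id, pre_id]
    refine sub_post_congr ?_
    repeat first
      | exact rfl
      | refine sub_pre_right_congr (by rfl) (by rfl) (by rfl) (by rfl) fun _ _ => ?_
      | refine sub_pre_mid_congr (by rfl) (by rfl) fun _ => ?_
      | refine sub_pre_left_congr (by rfl) (by rfl) (by rfl) (by rfl) fun _ _ _ => ?_
  bn₁_nat := by
    intros
    simp only [post_id, pre_id]
    refine sub_post_congr ?_
    repeat first
      | exact rfl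
      | refine sub_pre_right_congr (by rfl) (by rfl) (by rfl) (by rfl) fun _ _ => ?_
      | refine sub_pre_mid_congr (by rfl) (by rfl) fun _ => ?_
      | refine sub_pre_left_congr (by rfl) (by rfl) (by rfl) (by rfl) fun _ _ _ => ?_
  bn₂_nat {_ b₁' _ _ _} q₁ h g f := by
    simp only [pre_id]
    rw [← Category.assoc]
    refine sub_post_congr (z := tight) (cs := [b₁']) (h := h) (s := pre [] [] rfl rfl
      (M.sub (z := tight) (cs := [_]) [_] [] rfl rfl rfl g f) q₁) ?_
    exact sub_pre_left_congr (by rfl) (by rfl) (by rfl) (by rfl) fun _ _ _ => rfl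
  tn₁_nat := by
    intros
    simp only [post_id, pre_id]
    refine sub_post_congr ?_
    repeat first
      | exact rfl
      | refine sub_pre_right_congr (by rfl) (by rfl) (by rfl) (by rfl) fun _ _ => ?_
      | refine sub_pre_mid_congr (by rfl) (by rfl) fun _ => ?_
      | refine sub_pre_left_congr (by rfl) (by rfl) (by rfl) (by rfl) fun _ _ _ => ?_
  tn₂_nat := by
    intros
    simp only [post_id, pre_id]
    refine sub_post_congr ?_
    repeat first
      | exact rfl
      | refine sub_pre_right_congr (by rfl) (by rfl) (by rfl) (by rfl) fun _ _ => ?_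
      | refine sub_pre_mid_congr (by rfl) (by rfl) fun _ => ?_
      | refine sub_pre_left_congr (by rfl) (by rfl) (by rfl) (by rfl) fun _ _ _ => ?_
  tn₃_nat := by
    intros
    simp only [post_id, pre_id]
    refine sub_post_congr ?_
    repeat first
      | exact rfl
      | refine sub_pre_right_congr (by rfl) (by rfl) (by rfl) (by rfl) fun _ _ => ?_
      | refine sub_pre_mid_congr (by rfl) (by rfl) fun _ => ?_
      | refine sub_pre_left_congr (by rfl) (by rfl) (by rfl) (by rfl) fun _ _ _ => ?_
  un_nat := by
    intros
    simp only [post_id, pre_id]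
    refine sub_post_congr ?_
    repeat first
      | exact rfl
      | refine sub_pre_right_congr (by rfl) (by rfl) (by rfl) (by rfl) fun _ _ => ?_
      | refine sub_pre_mid_congr (by rfl) (by rfl) fun _ => ?_
      | refine sub_pre_left_congr (by rfl) (by rfl) (by rfl) (by rfl) fun _ _ _ => ?_
  bu₁_nat := by
    intros
    simp only [post_id, pre_id]
    refine sub_post_congr ?_
    repeat first
      | exact rfl
      | refine sub_pre_right_congr (by rfl) (by rfl) (by rfl) (by rfl) fun _ _ => ?_
      | refine sub_pre_mid_congr (by rfl) (by rfl) fun _ => ?_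
      | refine sub_pre_left_congr (by rfl) (by rfl) (by rfl) (by rfl) fun _ _ _ => ?_
  bu₂_nat := by
    intros
    simp only [post_id, pre_id]
    refine sub_post_congr ?_
    repeat first
      | exact rfl
      | refine sub_pre_right_congr (by rfl) (by rfl) (by rfl) (by rfl) fun _ _ => ?_
      | refine sub_pre_mid_congr (by rfl) (by rfl) fun _ => ?_
      | refine sub_pre_left_congr (by rfl) (by rfl) (by rfl) (by rfl) fun _ _ _ => ?_
  ub_nat := by
    intros
    simp only [post_id, pre_id]
    refine sub_post_congr ?_
    repeat first
      | exact rfl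
      | refine sub_pre_right_congr (by rfl) (by rfl) (by rfl) (by rfl) fun _ _ => ?_
      | refine sub_pre_mid_congr (by rfl) (by rfl) fun _ => ?_
      | refine sub_pre_left_congr (by rfl) (by rfl) (by rfl) (by rfl) fun _ _ _ => ?_
  bb₁_dinat k g f := by
    simp only [post_id, pre_id]; exact sub_dinat rfl rfl
  bb₂_dinat k g f := by
    simp only [post_id, pre_id]; exact sub_dinat rfl rfl
  tb₁_dinat := by
    intros; simp only [post_id, pre_id]; exact sub_dinat rfl rfl
  tb₂_dinat := by
    intros; simp only [post_id, pre_id]; exact sub_dinat rfl rfl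
  tb₃_dinat := by
    intros; simp only [post_id, pre_id]; exact sub_dinat rfl rfl
  bt₁_dinat := by
    intros; simp only [post_id, pre_id]; exact sub_dinat rfl rfl
  bt₂_dinat := by
    intros; simp only [post_id, pre_id]; exact sub_dinat rfl rfl
  bn₁_dinat := by
    intros; simp only [post_id, pre_id]; exact sub_dinat rfl rfl
  bn₂_dinat := by
    intros; simp only [post_id, pre_id]; exact sub_dinat rfl rfl
  tn₁_dinat := by
    intros; simp only [post_id, pre_id]; exact sub_dinat rfl rfl
  tn₂_dinat := by
    intros; simp only [post_id, pre_id]; exact sub_dinat rfl rfl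
  tn₃_dinat := by
    intros; simp only [post_id, pre_id]; exact sub_dinat rfl rfl
  un_dinat := by
    intros; simp only [post_id, pre_id]; exact sub_dinat rfl rfl
  bu₁_dinat := by
    intros; simp only [post_id, pre_id]; exact sub_dinat rfl rfl
  bu₂_dinat := by
    intros; simp only [post_id, pre_id]; exact sub_dinat rfl rfl
  ub_dinat := by
    intros; simp only [post_id, pre_id]; exact sub_dinat rfl rfl
  bu₁_j {_ _ b₂ _} g p := by
    simp only [post_id, pre_id]
    exact (M.loosen_sub [] [b₂] (x := tight) (x' := tight) (y := tight) (y' := loose) (z := tight)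
      (z' := loose) rfl rfl rfl rfl trivial trivial trivial g p).symm
  bu₂_j {_ b₁ _ _} g p := by
    simp only [post_id, pre_id]
    exact (M.loosen_sub [b₁] [] (x := tight) (x' := tight) (y := tight) (y' := loose) (z := tight)
      (z' := tight) rfl rfl rfl rfl trivial trivial trivial g p).symm
  ub_j p g := by
    simp only [pre_id]
    exact (M.loosen_sub [] [] (x := tight) (x' := loose) (y := tight) (y' := tight) (z := tight)
      (z' := loose) rfl rfl rfl rfl trivial trivial trivial p g).symm
  un_j p v :=
    (M.loosen_sub [] [] (x := tight) (x' := loose) (y := loose) (y' := loose) (z := loose)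
      (z' := loose) rfl rfl rfl rfl trivial trivial trivial p v).symm
  assoc_b₁₁ {_ _ _ b₂ _ c₂ _} f g h := M.assoc [] [c₂] [] [b₂] _ _ _ _ _ _ _ _ _ _ _ f g h
  assoc_b₁₂ {_ _ b₁ _ _ c₂ _} f g h := M.assoc [] [c₂] [b₁] [] _ _ _ _ _ _ _ _ _ _ _ f g h
  assoc_b₂₁ {_ _ _ b₂ c₁ _ _} f g h := M.assoc [c₁] [] [] [b₂] _ _ _ _ _ _ _ _ _ _ _ f g h
  assoc_b₂₂ {_ _ b₁ _ c₁ _ _} f g h := M.assoc [c₁] [] [b₁] [] _ _ _ _ _ _ _ _ _ _ _ f g h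
  assoc_n₁₁ {_ b₂ _ c₂ _} f g h := M.assoc [] [c₂] [] [b₂] _ _ _ _ _ _ _ _ _ _ _ f g h
  assoc_n₁₂ {b₁ _ _ c₂ _} f g h := by
    simp only [post_id, pre_id]
    exact M.assoc [] [c₂] [b₁] [] _ _ _ _ _ _ _ _ _ _ _ f g h
  assoc_n₂₁ {_ b₂ c₁ _ _} f g h := M.assoc [c₁] [] [] [b₂] _ _ _ _ _ _ _ _ _ _ _ f g h
  assoc_n₂₂ {b₁ _ c₁ _ _} f g h := by
    simp only [post_id, pre_id]
    exact M.assoc [c₁] [] [b₁] [] _ _ _ _ _ _ _ _ _ _ _ f g h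
  comm_bb f g h := M.comm [] [] [] _ _ _ _ _ _ _ _ _ _ _ _ f g h
  comm_bn f g h := by
    simp only [pre_id]
    exact M.comm [] [] [] _ _ _ _ _ _ _ _ _ _ _ _ f g h
  comm_nb f g h := M.comm [] [] [] _ _ _ _ _ _ _ _ _ _ _ _ f g h
  comm_nn f g h := M.comm [] [] [] _ _ _ _ _ _ _ _ _ _ _ _ f g h

end SkewMulticategory

namespace SkewMultifunctor

variable {M N : SkewMulticategory.{v, u}} (F : SkewMultifunctor M N)

theorem map_post {x : Tightness} {as : List M.Obj} {as' : List N.Obj} {b c : M.Obj}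
    (h' : as' = as.map F.obj) (h : b ⟶ c) (f : M.Hom x as b) :
    F.map h' (SkewMulticategory.post h f) =
      SkewMulticategory.post (M := N) (b := F.obj b) (F.map rfl h) (F.map h' f) :=
  F.map_sub [] [] _ _ _ _ _ _ _ _ _ _ _

theorem map_pre {x : Tightness} (l r : List M.Obj) {bs bs' : List M.Obj} {cs cs' : List N.Obj}
    {a b c : M.Obj} (hb : bs = l ++ b :: r) (hb' : bs' = l ++ a :: r) (hc : cs = bs.map F.obj)
    (hc' : cs' = bs'.map F.obj) (g : M.Hom x bs c) (p : a ⟶ b) :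
    F.map hc' (SkewMulticategory.pre l r hb hb' g p) =
      SkewMulticategory.pre (M := N) (l.map F.obj) (r.map F.obj) (a := F.obj a) (b := F.obj b)
        (by simp [hc, hb]) (by simp [hc', hb']) (F.map hc g) (F.map rfl p) :=
  F.map_sub l r _ _ _ _ _ _ _ _ _ _ _

/-- The morphism of short skew multicategories obtained by forgetting. -/
def toShort : ShortSkewMultifunctor M.toShort N.toShort where
  toFunctor :=
    { obj := F.obj
      map := fun {a b} (f : M.Hom tight [a] b) => F.map (as' := [F.obj a]) rfl f
      map_id := fun a => F.map_id a rfl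
      map_comp := fun f g => F.map_sub [] [] _ _ _ _ _ _ _ _ _ g f }
  mapT₂ f := F.map rfl f
  mapT₃ f := F.map rfl f
  mapT₄ f := F.map rfl f
  mapL₀ f := F.map rfl f
  mapL₁ f := F.map rfl f
  mapL₂ f := F.map rfl f
  mapT₂_nat _ _ _ _ := by
    refine (F.map_post _ _ _).trans (congrArg _ ?_)
    repeat first
      | exact rfl
      | refine (F.map_pre _ _ _ _ rfl rfl _ _).trans (congrArg (SkewMulticategory.pre _ _ _ _ · _) ?_)
  mapT₃_nat _ _ _ _ _ := by
    refine (F.map_post _ _ _).trans (congrArg _ ?_)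
    repeat first
      | exact rfl
      | refine (F.map_pre _ _ _ _ rfl rfl _ _).trans (congrArg (SkewMulticategory.pre _ _ _ _ · _) ?_)
  mapT₄_nat _ _ _ _ _ _ := by
    refine (F.map_post _ _ _).trans (congrArg _ ?_)
    repeat first
      | exact rfl
      | refine (F.map_pre _ _ _ _ rfl rfl _ _).trans (congrArg (SkewMulticategory.pre _ _ _ _ · _) ?_)
  mapL₀_nat _ _ := F.map_post _ _ _
  mapL₁_nat _ _ _ := by
    refine (F.map_post _ _ _).trans (congrArg _ ?_)
    exact F.map_pre _ _ _ _ rfl rfl _ _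
  mapL₂_nat _ _ _ _ := by
    refine (F.map_post _ _ _).trans (congrArg _ ?_)
    repeat first
      | exact rfl
      | refine (F.map_pre _ _ _ _ rfl rfl _ _).trans (congrArg (SkewMulticategory.pre _ _ _ _ · _) ?_)
  map_j₁ _ := F.map_j _ _
  map_j₂ _ := F.map_j _ _
  map_bb₁ _ _ := F.map_sub _ _ _ _ _ _ _ _ _ _ _ _ _
  map_bb₂ _ _ := F.map_sub _ _ _ _ _ _ _ _ _ _ _ _ _
  map_tb₁ _ _ := F.map_sub _ _ _ _ _ _ _ _ _ _ _ _ _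
  map_tb₂ _ _ := F.map_sub _ _ _ _ _ _ _ _ _ _ _ _ _
  map_tb₃ _ _ := F.map_sub _ _ _ _ _ _ _ _ _ _ _ _ _
  map_bt₁ _ _ := F.map_sub _ _ _ _ _ _ _ _ _ _ _ _ _
  map_bt₂ _ _ := F.map_sub _ _ _ _ _ _ _ _ _ _ _ _ _
  map_bn₁ _ _ := F.map_sub _ _ _ _ _ _ _ _ _ _ _ _ _
  map_bn₂ _ _ := F.map_sub _ _ _ _ _ _ _ _ _ _ _ _ _
  map_tn₁ _ _ := F.map_sub _ _ _ _ _ _ _ _ _ _ _ _ _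
  map_tn₂ _ _ := F.map_sub _ _ _ _ _ _ _ _ _ _ _ _ _
  map_tn₃ _ _ := F.map_sub _ _ _ _ _ _ _ _ _ _ _ _ _
  map_un _ _ := F.map_sub _ _ _ _ _ _ _ _ _ _ _ _ _
  map_bu₁ _ _ := F.map_sub _ _ _ _ _ _ _ _ _ _ _ _ _
  map_bu₂ _ _ := F.map_sub _ _ _ _ _ _ _ _ _ _ _ _ _
  map_ub _ _ := F.map_sub _ _ _ _ _ _ _ _ _ _ _ _ _

end SkewMultifunctor

/-- The forgetful functor from skew multicategories to short skew multicategories. -/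
def forgetShort : SkewMulticategory.{v, u} ⥤ ShortSkewMulticategory.{v, u} where
  obj M := M.toShort
  map F := F.toShort
  map_id _ := rfl
  map_comp _ _ := rfl

/-! Left representable short skew multicategories. -/

namespace ShortSkewMulticategory

/-- Left universal tight binary classifiers. -/
structure IsLeftUniversalBinary (M : ShortSkewMulticategory.{v, u}) {a b m : M.Obj}
    (θ : M.T₂.Hom a b m) : Prop where
  unary : ∀ c, Function.Bijective fun f : m ⟶ c => M.T₂.act (𝟙 a) (𝟙 b) f θ
  binary : ∀ x c, Function.Bijective fun f : M.T₂.Hom m x c => M.bb₁ f θ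
  ternary : ∀ x y c, Function.Bijective fun f : M.T₃.Hom m x y c => M.tb₁ f θ

/-- Left universal nullary map classifiers. -/
structure IsLeftUniversalNullary (M : ShortSkewMulticategory.{v, u}) {m : M.Obj}
    (w : M.L₀.Hom m) : Prop where
  unary : ∀ c, Function.Bijective fun f : m ⟶ c => M.L₀.act f w
  binary : ∀ x c, Function.Bijective fun f : M.T₂.Hom m x c => M.bn₁ f w
  ternary : ∀ x y c, Function.Bijective fun f : M.T₃.Hom m x y c => M.tn₁ f w

def isLeftRepresentable : ObjectProperty ShortSkewMulticategory.{v, u} := fun M =>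
  (∀ a b : M.Obj, ∃ (m : M.Obj) (θ : M.T₂.Hom a b m), M.IsLeftUniversalBinary θ) ∧
    ∃ (m : M.Obj) (w : M.L₀.Hom m), M.IsLeftUniversalNullary w

def isClosed : ObjectProperty ShortSkewMulticategory.{v, u} := fun M =>
  ∀ b c : M.Obj, ∃ (h : M.Obj) (e : M.T₂.Hom h b c),
    (∀ a, Function.Bijective fun f : a ⟶ h => M.T₂.act f (𝟙 b) (𝟙 c) e) ∧
    (∀ a₁ a₂, Function.Bijective fun f : M.T₂.Hom a₁ a₂ h => M.bb₁ e f) ∧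
    (∀ a₁ a₂ a₃, Function.Bijective fun f : M.T₃.Hom a₁ a₂ a₃ h => M.bt₁ e f) ∧
    (Function.Bijective fun f : M.L₀.Hom h => M.bn₁ e f) ∧
    ∀ a, Function.Bijective fun f : M.L₁.Hom a h => M.bu₁ e f

section

variable (M : ShortSkewMulticategory.{v, u})

theorem act_split₁ {a a' b b' d d' : M.Obj} (f : a ⟶ a') (g : b ⟶ b') (h : d ⟶ d')
    (k : M.T₂.Hom a' b' d) :
    M.T₂.act f g h k = M.T₂.act f (𝟙 _) (𝟙 _) (M.T₂.act (𝟙 _) g h k) := by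
  rw [← M.T₂.act_comp]; simp

theorem act_split₂ {a a' b b' d d' : M.Obj} (f : a ⟶ a') (g : b ⟶ b') (h : d ⟶ d')
    (k : M.T₂.Hom a' b' d) :
    M.T₂.act f g h k = M.T₂.act (𝟙 _) g (𝟙 _) (M.T₂.act f (𝟙 _) h k) := by
  rw [← M.T₂.act_comp]; simp

theorem bb₁_act {a₁ a₂ b b' x x' d d' : M.Obj} (k : b ⟶ b') (q : x ⟶ x') (h : d ⟶ d')
    (g : M.T₂.Hom b' x' d) (f : M.T₂.Hom a₁ a₂ b) :
    M.bb₁ (M.T₂.act k q h g) f =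
      M.bb₁ (M.T₂.act (𝟙 _) q h g) (M.T₂.act (𝟙 _) (𝟙 _) k f) := by
  rw [M.act_split₁, M.bb₁_dinat]

theorem bb₂_act {a₁ a₂ b b' x x' d d' : M.Obj} (k : b ⟶ b') (q : x ⟶ x') (h : d ⟶ d')
    (g : M.T₂.Hom x' b' d) (f : M.T₂.Hom a₁ a₂ b) :
    M.bb₂ (M.T₂.act q k h g) f =
      M.bb₂ (M.T₂.act q (𝟙 _) h g) (M.T₂.act (𝟙 _) (𝟙 _) k f) := by
  rw [M.act_split₂, M.bb₂_dinat]

theorem bn₂_act {b b' x x' d d' : M.Obj} (k : b ⟶ b') (q : x ⟶ x') (h : d ⟶ d')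
    (g : M.T₂.Hom x' b' d) (f : M.L₀.Hom b) :
    M.bn₂ (M.T₂.act q k h g) f = q ≫ M.bn₂ g (M.L₀.act k f) ≫ h := by
  rw [M.act_split₂, M.bn₂_dinat, M.bn₂_nat]

theorem bn₂_post {b x d d' : M.Obj} (h : d ⟶ d') (g : M.T₂.Hom x b d) (f : M.L₀.Hom b) :
    M.bn₂ (M.T₂.act (𝟙 _) (𝟙 _) h g) f = M.bn₂ g f ≫ h := by
  rw [M.bn₂_nat, Category.id_comp]

theorem bt₁_act {a₁ a₂ a₃ b b' x x' d d' : M.Obj} (k : b ⟶ b') (q : x ⟶ x') (h : d ⟶ d')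
    (g : M.T₂.Hom b' x' d) (f : M.T₃.Hom a₁ a₂ a₃ b) :
    M.bt₁ (M.T₂.act k q h g) f =
      M.bt₁ (M.T₂.act (𝟙 _) q h g) (M.T₃.act (𝟙 _) (𝟙 _) (𝟙 _) k f) := by
  rw [M.act_split₁, M.bt₁_dinat]

theorem bt₂_act {a₁ a₂ a₃ b b' x x' d d' : M.Obj} (k : b ⟶ b') (q : x ⟶ x') (h : d ⟶ d')
    (g : M.T₂.Hom x' b' d) (f : M.T₃.Hom a₁ a₂ a₃ b) :
    M.bt₂ (M.T₂.act q k h g) f =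
      M.bt₂ (M.T₂.act q (𝟙 _) h g) (M.T₃.act (𝟙 _) (𝟙 _) (𝟙 _) k f) := by
  rw [M.act_split₂, M.bt₂_dinat]

end

/-- A choice of left universal classifiers. -/
structure Classifiers (M : ShortSkewMulticategory.{v, u}) where
  tensor : M.Obj → M.Obj → M.Obj
  θ : ∀ a b, M.T₂.Hom a b (tensor a b)
  θ_univ : ∀ a b, M.IsLeftUniversalBinary (θ a b)
  unit : M.Obj
  w : M.L₀.Hom unit
  w_univ : M.IsLeftUniversalNullary w

theorem isLeftRepresentable.nonempty_classifiers {M : ShortSkewMulticategory.{v, u}}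
    (h : isLeftRepresentable M) : Nonempty M.Classifiers := by
  obtain ⟨h1, m, w, hw⟩ := h
  choose t θ hθ using h1
  exact ⟨⟨t, θ, hθ, m, w, hw⟩⟩

namespace Classifiers

variable {M : ShortSkewMulticategory.{v, u}} (c : M.Classifiers)

theorem ext₁ {a b d : M.Obj} {f g : c.tensor a b ⟶ d}
    (h : M.T₂.act (𝟙 a) (𝟙 b) f (c.θ a b) = M.T₂.act (𝟙 a) (𝟙 b) g (c.θ a b)) : f = g :=
  ((c.θ_univ a b).unary d).1 h

theorem ext_unit {d : M.Obj} {f g : c.unit ⟶ d}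
    (h : M.L₀.act f c.w = M.L₀.act g c.w) : f = g :=
  (c.w_univ.unary d).1 h

theorem ext_bn {a d : M.Obj} {f g : c.tensor c.unit a ⟶ d}
    (h : M.bn₁ (M.T₂.act (𝟙 _) (𝟙 _) f (c.θ c.unit a)) c.w =
      M.bn₁ (M.T₂.act (𝟙 _) (𝟙 _) g (c.θ c.unit a)) c.w) : f = g :=
  c.ext₁ ((c.w_univ.binary _ _).1 h)

theorem act_bb₁ {a b x d d' : M.Obj} (h : d ⟶ d') (f : M.T₂.Hom (c.tensor a b) x d) :
    M.T₃.act (𝟙 _) (𝟙 _) (𝟙 _) h (M.bb₁ f (c.θ a b)) =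
      M.bb₁ (M.T₂.act (𝟙 _) (𝟙 _) h f) (c.θ a b) := by
  rw [← M.bb₁_nat, M.T₂.act_id]

theorem ext_bb {a b x d : M.Obj} {f g : c.tensor (c.tensor a b) x ⟶ d}
    (h : M.bb₁ (M.T₂.act (𝟙 _) (𝟙 _) f (c.θ _ x)) (c.θ a b) =
      M.bb₁ (M.T₂.act (𝟙 _) (𝟙 _) g (c.θ _ x)) (c.θ a b)) : f = g :=
  c.ext₁ (((c.θ_univ a b).binary _ _).1 h)

theorem ext_bbb {a b x y d : M.Obj} {f g : c.tensor (c.tensor (c.tensor a b) x) y ⟶ d}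
    (h : M.tb₁ (M.bb₁ (M.T₂.act (𝟙 _) (𝟙 _) f (c.θ _ y)) (c.θ _ x)) (c.θ a b) =
      M.tb₁ (M.bb₁ (M.T₂.act (𝟙 _) (𝟙 _) g (c.θ _ y)) (c.θ _ x)) (c.θ a b)) : f = g :=
  c.ext_bb (((c.θ_univ a b).ternary _ _ _).1 h)

theorem ext_tn {a x d : M.Obj} {f g : c.tensor (c.tensor c.unit a) x ⟶ d}
    (h : M.tn₁ (M.bb₁ (M.T₂.act (𝟙 _) (𝟙 _) f (c.θ _ x)) (c.θ _ a)) c.w =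
      M.tn₁ (M.bb₁ (M.T₂.act (𝟙 _) (𝟙 _) g (c.θ _ x)) (c.θ _ a)) c.w) : f = g :=
  c.ext_bb ((c.w_univ.ternary _ _ _).1 h)

/-- The structural maps of the skew monoidal category associated to a choice of classifiers,
characterised by their universal properties. -/
structure Structure where
  tensorHom : ∀ {a a' b b' : M.Obj}, (a ⟶ a') → (b ⟶ b') → (c.tensor a b ⟶ c.tensor a' b')
  tensorHom_θ : ∀ {a a' b b' : M.Obj} (f : a ⟶ a') (g : b ⟶ b'),
    M.T₂.act (𝟙 a) (𝟙 b) (tensorHom f g) (c.θ a b) = M.T₂.act f g (𝟙 _) (c.θ a' b')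
  α : ∀ a b d : M.Obj, c.tensor (c.tensor a b) d ⟶ c.tensor a (c.tensor b d)
  α_θ : ∀ a b d : M.Obj,
    M.T₃.act (𝟙 a) (𝟙 b) (𝟙 d) (α a b d) (M.bb₁ (c.θ (c.tensor a b) d) (c.θ a b)) =
      M.bb₂ (c.θ a (c.tensor b d)) (c.θ b d)
  lam : ∀ a : M.Obj, c.tensor c.unit a ⟶ a
  lam_θ : ∀ a : M.Obj,
    M.bn₁ (M.T₂.act (𝟙 c.unit) (𝟙 a) (lam a) (c.θ c.unit a)) c.w = M.j₁ (𝟙 a)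

namespace Structure

variable {c} (s : c.Structure)

theorem act_tensorHom {a a' b b' d : M.Obj} (f : a ⟶ a') (g : b ⟶ b')
    (h : c.tensor a' b' ⟶ d) :
    M.T₂.act (𝟙 a) (𝟙 b) (s.tensorHom f g ≫ h) (c.θ a b) = M.T₂.act f g h (c.θ a' b') := by
  have := M.T₂.act_comp (𝟙 a) (𝟙 a) (𝟙 b) (𝟙 b) (s.tensorHom f g) h (c.θ a b)
  simp only [Category.comp_id] at this
  rw [this, s.tensorHom_θ, ← M.T₂.act_comp]
  simp

theorem act_α (a b d : M.Obj) {e : M.Obj} (h : c.tensor a (c.tensor b d) ⟶ e) :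
    M.bb₁ (M.T₂.act (𝟙 _) (𝟙 _) (s.α a b d ≫ h) (c.θ _ d)) (c.θ a b) =
      M.bb₂ (M.T₂.act (𝟙 _) (𝟙 _) h (c.θ a (c.tensor b d))) (c.θ b d) := by
  have := M.T₃.act_comp (𝟙 a) (𝟙 a) (𝟙 b) (𝟙 b) (𝟙 d) (𝟙 d) (s.α a b d) h
    (M.bb₁ (c.θ (c.tensor a b) d) (c.θ a b))
  simp only [Category.comp_id] at this
  rw [← c.act_bb₁, this, s.α_θ, ← M.bb₂_nat, M.T₂.act_id]

theorem act_α₀ (a b d : M.Obj) :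
    M.bb₁ (M.T₂.act (𝟙 _) (𝟙 _) (s.α a b d) (c.θ _ d)) (c.θ a b) =
      M.bb₂ (c.θ a (c.tensor b d)) (c.θ b d) := by
  rw [← c.act_bb₁, s.α_θ]

/-- The structural maps are unique. -/
theorem unique (s s' : c.Structure) : s = s' := by
  have h1 : @s.tensorHom = @s'.tensorHom := by
    funext a a' b b' f g
    exact c.ext₁ ((s.tensorHom_θ f g).trans (s'.tensorHom_θ f g).symm)
  have h2 : s.α = s'.α := by
    funext a b d
    exact c.ext_bb ((s.act_α₀ a b d).trans (s'.act_α₀ a b d).symm)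
  have h3 : s.lam = s'.lam := by
    funext a
    exact c.ext_bn ((s.lam_θ a).trans (s'.lam_θ a).symm)
  cases s; cases s'; cases h1; cases h2; cases h3; rfl

theorem lam_naturality {a a' : M.Obj} (f : a ⟶ a') :
    s.tensorHom (𝟙 c.unit) f ≫ s.lam a' = s.lam a ≫ f := c.ext_bn (by
  have h1 := M.T₂.act_comp (𝟙 _) (𝟙 _) f (𝟙 _) (𝟙 _) (𝟙 _)
    (M.T₂.act (𝟙 _) (𝟙 _) (s.lam a') (c.θ c.unit a'))
  have h2 := M.T₂.act_comp (𝟙 c.unit) (𝟙 _) (𝟙 a) (𝟙 _) (s.lam a) f (c.θ c.unit a)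
  have h3 := M.j₁_nat f (𝟙 _) (𝟙 _)
  have h4 := M.j₁_nat (𝟙 _) f (𝟙 _)
  simp only [Category.comp_id, Category.id_comp] at h2 h3 h4
  rw [s.act_tensorHom, M.act_split₂, M.bn₁_nat, s.lam_θ, ← h3, h2, M.bn₁_nat, s.lam_θ, ← h4])

theorem pentagon (a b d e : M.Obj) :
    s.tensorHom (s.α a b d) (𝟙 e) ≫ s.α a (c.tensor b d) e ≫
        s.tensorHom (𝟙 a) (s.α b d e) =
      s.α (c.tensor a b) d e ≫ s.α a b (c.tensor d e) := c.ext_bbb (by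
  rw [s.act_tensorHom, ← M.assoc_b₁₁, M.bt₁_act, s.α_θ, M.assoc_b₁₂, s.act_α, ← M.assoc_b₂₁,
    s.tensorHom_θ, M.bt₂_act, s.α_θ, s.act_α, ← M.comm_bb, s.act_α₀, M.T₂.act_id, M.assoc_b₂₂])

/-- The skew monoidal category associated to a choice of classifiers. -/
def toSkewMonoidal : SkewMonoidalCat.{v, u} where
  Obj := M.Obj
  tensorObj := c.tensor
  tensorHom := s.tensorHom
  unit := c.unit
  α := s.α
  lam := s.lam
  ρ a := M.bn₂ (c.θ a c.unit) c.w
  tensorHom_id a b := c.ext₁ (s.tensorHom_θ _ _)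
  tensorHom_comp f f' g g' := c.ext₁ (by
    rw [s.act_tensorHom, s.tensorHom_θ]
    have := M.T₂.act_comp f' f g' g (𝟙 _) (𝟙 _) (c.θ _ _)
    have h2 := M.T₂.act_comp (𝟙 _) f (𝟙 _) g (s.tensorHom f' g') (𝟙 _) (c.θ _ _)
    simp only [Category.comp_id] at this h2
    rw [this, h2, s.tensorHom_θ])
  α_naturality {a a' b b' d d'} f g h := c.ext_bb (by
    have h1 := M.T₃.act_comp (𝟙 _) f (𝟙 _) g (𝟙 _) h (s.α a' b' d') (𝟙 _)
      (M.bb₁ (c.θ _ d') (c.θ a' b'))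
    simp only [Category.comp_id] at h1
    rw [s.act_tensorHom, s.act_α, M.bb₁_act, s.tensorHom_θ, M.bb₁_nat, h1, s.α_θ, s.tensorHom_θ,
      M.bb₂_act, s.tensorHom_θ, M.bb₂_nat])
  lam_naturality f := s.lam_naturality f
  ρ_naturality f := by
    have h1 := M.bn₂_nat f (𝟙 _) (c.θ _ c.unit) c.w
    rw [Category.comp_id] at h1
    rw [← M.bn₂_post, s.tensorHom_θ, h1]
  pentagon a b d e := s.pentagon a b d e
  α_lam a b := c.ext_tn (by
    rw [s.act_α, ← M.comm_nb, s.lam_θ, M.ub_j, M.T₂.act_id, s.tensorHom_θ, M.bb₁_act,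
      ← M.assoc_n₁₁, s.lam_θ, M.bu₁_j, M.T₂.act_id, M.T₂.act_id])
  ρ_α a b := c.ext₁ (by
    rw [← M.bn₂_post, ← M.comm_bn, s.act_α₀, ← M.assoc_n₂₂, s.tensorHom_θ])
  ρ_α_lam a b := c.ext₁ (by
    rw [s.act_tensorHom, M.act_split₁, M.assoc_n₁₂, s.act_α, s.tensorHom_θ, M.bb₂_act,
      ← M.assoc_n₂₁, s.lam_θ, M.bu₂_j, M.T₂.act_id])
  ρ_lam := c.ext_unit (by
    rw [← M.bn₂_post, ← M.comm_nn, s.lam_θ, M.un_j])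

end Structure

end Classifiers

end ShortSkewMulticategory

namespace ShortSkewMulticategory.Classifiers

variable {M N P : ShortSkewMulticategory.{v, u}}

/-- The structural maps determined by the universal properties. -/
noncomputable def canonicalStructure (c : M.Classifiers) : c.Structure where
  tensorHom {a a' b b'} f g :=
    Classical.choose (((c.θ_univ a b).unary _).2 (M.T₂.act f g (𝟙 _) (c.θ a' b')))
  tensorHom_θ {a a' b b'} f g :=
    Classical.choose_spec (((c.θ_univ a b).unary _).2 (M.T₂.act f g (𝟙 _) (c.θ a' b')))
  α a b d :=
    Classical.choose (((c.θ_univ (c.tensor a b) d).unary _).2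
      (Classical.choose (((c.θ_univ a b).binary _ _).2
        (M.bb₂ (c.θ a (c.tensor b d)) (c.θ b d)))))
  α_θ a b d := by
    rw [c.act_bb₁]
    have h1 := Classical.choose_spec (((c.θ_univ a b).binary _ _).2
      (M.bb₂ (c.θ a (c.tensor b d)) (c.θ b d)))
    have h2 := Classical.choose_spec (((c.θ_univ (c.tensor a b) d).unary _).2
      (Classical.choose (((c.θ_univ a b).binary _ _).2
        (M.bb₂ (c.θ a (c.tensor b d)) (c.θ b d)))))
    exact (congrArg (M.bb₁ · (c.θ a b)) h2).trans h1
  lam a :=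
    Classical.choose (((c.θ_univ c.unit a).unary _).2
      (Classical.choose ((c.w_univ.binary _ _).2 (M.j₁ (𝟙 a)))))
  lam_θ a := by
    have h1 := Classical.choose_spec ((c.w_univ.binary _ _).2 (M.j₁ (𝟙 a)))
    have h2 := Classical.choose_spec (((c.θ_univ c.unit a).unary _).2
      (Classical.choose ((c.w_univ.binary _ _).2 (M.j₁ (𝟙 a)))))
    exact (congrArg (M.bn₁ · c.w) h2).trans h1

/-- The structural maps of the lax monoidal functor associated to a morphism `F`, characterised by
their universal properties. -/
structure MapStructure (c : M.Classifiers) (c' : N.Classifiers) (F : ShortSkewMultifunctor M N) where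
  f₀ : c'.unit ⟶ F.toFunctor.obj c.unit
  f₀_w : N.L₀.act f₀ c'.w = F.mapL₀ c.w
  f₂ : ∀ a b : M.Obj,
    c'.tensor (F.toFunctor.obj a) (F.toFunctor.obj b) ⟶ F.toFunctor.obj (c.tensor a b)
  f₂_θ : ∀ a b : M.Obj, N.T₂.act (𝟙 _) (𝟙 _) (f₂ a b) (c'.θ _ _) = F.mapT₂ (c.θ a b)

/-- The structural maps determined by the universal properties. -/
noncomputable def mapStructure (c : M.Classifiers) (c' : N.Classifiers)
    (F : ShortSkewMultifunctor M N) : MapStructure c c' F where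
  f₀ := Classical.choose ((c'.w_univ.unary _).2 (F.mapL₀ c.w))
  f₀_w := Classical.choose_spec ((c'.w_univ.unary _).2 (F.mapL₀ c.w))
  f₂ a b := Classical.choose (((c'.θ_univ _ _).unary _).2 (F.mapT₂ (c.θ a b)))
  f₂_θ a b := Classical.choose_spec (((c'.θ_univ _ _).unary _).2 (F.mapT₂ (c.θ a b)))

namespace MapStructure

variable {c : M.Classifiers} {c' : N.Classifiers} {F : ShortSkewMultifunctor M N}

theorem act_f₂ (t : MapStructure c c' F) (a b : M.Obj) {d : N.Obj}
    (h : F.toFunctor.obj (c.tensor a b) ⟶ d) :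
    N.T₂.act (𝟙 _) (𝟙 _) (t.f₂ a b ≫ h) (c'.θ _ _) =
      N.T₂.act (𝟙 _) (𝟙 _) h (F.mapT₂ (c.θ a b)) := by
  have := N.T₂.act_comp (𝟙 _) (𝟙 _) (𝟙 _) (𝟙 _) (t.f₂ a b) h (c'.θ _ _)
  simp only [Category.comp_id] at this
  rw [this, t.f₂_θ]

theorem map_act (F : ShortSkewMultifunctor M N) {a b d d' : M.Obj} (h : d ⟶ d')
    (f : M.T₂.Hom a b d) :
    N.T₂.act (𝟙 _) (𝟙 _) (F.toFunctor.map h) (F.mapT₂ f) =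
      F.mapT₂ (M.T₂.act (𝟙 _) (𝟙 _) h f) := by
  rw [F.mapT₂_nat, F.toFunctor.map_id, F.toFunctor.map_id]

section

variable (t : MapStructure c c' F) (s : c.Structure) (s' : c'.Structure)

theorem f₂_naturality {a a' b b' : M.Obj} (p : a ⟶ a') (q : b ⟶ b') :
    s'.tensorHom (F.toFunctor.map p) (F.toFunctor.map q) ≫ t.f₂ a' b' =
      t.f₂ a b ≫ F.toFunctor.map (s.tensorHom p q) := c'.ext₁ (by
  have h1 := N.T₂.act_comp (𝟙 _) (F.toFunctor.map p) (𝟙 _) (F.toFunctor.map q) (t.f₂ a' b')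
    (𝟙 _) (c'.θ _ _)
  have h2 := F.mapT₂_nat p q (𝟙 _) (c.θ a' b')
  simp only [Category.comp_id, CategoryTheory.Functor.map_id] at h1 h2
  rw [s'.act_tensorHom, t.act_f₂, map_act, s.tensorHom_θ, h1, h2, t.f₂_θ])

theorem f₂_α (a b d : M.Obj) :
    s'.tensorHom (t.f₂ a b) (𝟙 (F.toFunctor.obj d)) ≫ t.f₂ (c.tensor a b) d ≫
        F.toFunctor.map (s.α a b d) =
      s'.α (F.toFunctor.obj a) (F.toFunctor.obj b) (F.toFunctor.obj d) ≫
        s'.tensorHom (𝟙 (F.toFunctor.obj a)) (t.f₂ b d) ≫ t.f₂ a (c.tensor b d) :=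
  c'.ext_bb (by
  rw [s'.act_tensorHom, s'.act_α, s'.act_tensorHom, N.bb₁_act, N.bb₂_act, t.f₂_θ, t.f₂_θ, t.f₂_θ,
    t.act_f₂, map_act, ← F.map_bb₁, ← F.map_bb₂, s.act_α₀])

theorem f₂_lam (a : M.Obj) :
    s'.tensorHom t.f₀ (𝟙 (F.toFunctor.obj a)) ≫ t.f₂ c.unit a ≫ F.toFunctor.map (s.lam a) =
      s'.lam (F.toFunctor.obj a) := c'.ext_bn (by
  rw [s'.act_tensorHom, s'.lam_θ, N.act_split₁, N.bn₁_dinat, t.f₀_w, t.act_f₂, map_act,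
    ← F.map_bn₁, s.lam_θ, F.map_j₁, F.toFunctor.map_id])

theorem f₂_ρ (a : M.Obj) :
    N.bn₂ (c'.θ (F.toFunctor.obj a) c'.unit) c'.w ≫
        s'.tensorHom (𝟙 (F.toFunctor.obj a)) t.f₀ ≫ t.f₂ a c.unit =
      F.toFunctor.map (M.bn₂ (c.θ a c.unit) c.w) := by
  rw [← N.bn₂_post, s'.act_tensorHom, N.act_split₂, N.bn₂_dinat, t.f₀_w, t.f₂_θ, F.map_bn₂]

/-- The lax skew monoidal functor associated to a morphism. -/
def toLax : LaxSkewMonoidalFunctor s.toSkewMonoidal s'.toSkewMonoidal where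
  toFunctor := F.toFunctor
  f₀ := t.f₀
  f₂ := t.f₂
  f₂_naturality p q := t.f₂_naturality s s' p q
  f₂_α a b d := t.f₂_α s s' a b d
  f₂_lam a := t.f₂_lam s s' a
  f₂_ρ a := t.f₂_ρ s' a

end

/-- The structural maps are unique. -/
theorem unique (t t' : MapStructure c c' F) : t = t' := by
  have h0 : t.f₀ = t'.f₀ := c'.ext_unit (t.f₀_w.trans t'.f₀_w.symm)
  have h2 : t.f₂ = t'.f₂ := by
    funext a b; exact c'.ext₁ ((t.f₂_θ a b).trans (t'.f₂_θ a b).symm)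
  cases t; cases t'; cases h0; cases h2; rfl

def id (c : M.Classifiers) : MapStructure c c (ShortSkewMultifunctor.id M) where
  f₀ := 𝟙 _
  f₀_w := M.L₀.act_id _
  f₂ _ _ := 𝟙 _
  f₂_θ _ _ := M.T₂.act_id _

def comp {c'' : P.Classifiers} {G : ShortSkewMultifunctor N P} (t : MapStructure c c' F)
    (t' : MapStructure c' c'' G) : MapStructure c c'' (F.comp G) where
  f₀ := t'.f₀ ≫ G.toFunctor.map t.f₀
  f₀_w := by
    exact (P.L₀.act_comp _ _ _).trans ((congrArg _ t'.f₀_w).trans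
      ((G.mapL₀_nat _ _).symm.trans (congrArg G.mapL₀ t.f₀_w)))
  f₂ a b := t'.f₂ _ _ ≫ G.toFunctor.map (t.f₂ a b)
  f₂_θ a b := by
    exact (t'.act_f₂ _ _ _).trans ((map_act G _ _).trans (congrArg G.mapT₂ (t.f₂_θ a b)))

end MapStructure

end ShortSkewMulticategory.Classifiers

open ShortSkewMulticategory in
/-- The functor `K` from left representable short skew multicategories to skew monoidal
categories, for a given choice of classifiers. -/
noncomputable def shortToSkewMonoidal
    (c : ∀ M : ShortSkewMulticategory.isLeftRepresentable.{v, u}.FullSubcategory,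
      M.obj.Classifiers) :
    ShortSkewMulticategory.isLeftRepresentable.{v, u}.FullSubcategory ⥤
      SkewMonoidalCat.{v, u} where
  obj M := (c M).canonicalStructure.toSkewMonoidal
  map {M N} F := ((c M).mapStructure (c N) F.hom).toLax (c M).canonicalStructure (c N).canonicalStructure
  map_id M := congrArg (Classifiers.MapStructure.toLax · (c M).canonicalStructure (c M).canonicalStructure)
    (((c M).mapStructure (c M) _).unique (.id (c M)))
  map_comp {M N P} F G :=
    congrArg (Classifiers.MapStructure.toLax · (c M).canonicalStructure (c P).canonicalStructure)
      (((c M).mapStructure (c P) _).unique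
        (((c M).mapStructure (c N) F.hom).comp ((c N).mapStructure (c P) G.hom)))

/-! Left representable skew multicategories. -/

namespace SkewMulticategory

variable (M : SkewMulticategory.{v, u})

/-- `θ` classifies the `x`-multimaps with domain `as`. -/
def IsClassifier {x : Tightness} {as : List M.Obj} {m : M.Obj} (θ : M.Hom x as m) : Prop :=
  ∀ c, Function.Bijective fun f : M.Hom tight [m] c =>
    M.sub (z := x) (cs := as) [] [] rfl rfl (by simp) f θ

def IsLeftUniversal {x : Tightness} {as : List M.Obj} {m : M.Obj} (θ : M.Hom x as m) : Prop :=
  ∀ r c, Function.Bijective fun f : M.Hom tight (m :: r) c =>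
    M.sub (z := x) (cs := as ++ r) [] r rfl rfl rfl f θ

def isLeftRepresentable : ObjectProperty SkewMulticategory.{v, u} := fun M =>
  (∀ (x : Tightness) (as : List M.Obj), (x = tight → as ≠ []) →
      ∃ (m : M.Obj) (θ : M.Hom x as m), M.IsClassifier θ) ∧
    ∀ (x : Tightness) (as : List M.Obj) (m : M.Obj) (θ : M.Hom x as m),
      M.IsClassifier θ → M.IsLeftUniversal θ

def isClosed : ObjectProperty SkewMulticategory.{v, u} := fun M =>
  ∀ b c : M.Obj, ∃ (h : M.Obj) (e : M.Hom tight [h, b] c),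
    ∀ (x : Tightness) (as : List M.Obj), (x = tight → as ≠ []) →
      Function.Bijective fun f : M.Hom x as h =>
        M.sub (z := x) (cs := as ++ [b]) [] [b] rfl rfl rfl e f

/-- A choice of a tight binary map classifier for each pair of objects and of a nullary map
classifier. -/
structure Classifiers where
  tensor : M.Obj → M.Obj → M.Obj
  θ : ∀ a b, M.Hom tight [a, b] (tensor a b)
  isClassifier_θ : ∀ a b, M.IsClassifier (θ a b)
  unit : M.Obj
  w : M.Hom loose [] unit
  isClassifier_w : M.IsClassifier w

variable {M}

theorem IsLeftUniversal.toShort_binary {a b m : M.Obj} {θ : M.Hom tight [a, b] m}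
    (h : M.IsLeftUniversal θ) : M.toShort.IsLeftUniversalBinary (a := a) (b := b) (m := m) θ where
  unary c := by
    have : (fun f : M.Hom tight [m] c => M.toShort.T₂.act (𝟙 a) (𝟙 b) f θ) =
        fun f : M.Hom tight [m] c => M.sub (z := tight) (cs := [a, b]) [] [] rfl rfl rfl f θ := by
      funext f
      exact congrArg (post (b := m) (c := c) f) ((pre_id _ _ _ _).trans (pre_id _ _ _ _))
    exact this ▸ h [] c
  binary x c := h [x] c
  ternary x y c := h [x, y] c

theorem IsLeftUniversal.toShort_nullary {m : M.Obj} {w : M.Hom loose [] m}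
    (h : M.IsLeftUniversal w) : M.toShort.IsLeftUniversalNullary (m := m) w where
  unary c := h [] c
  binary x c := h [x] c
  ternary x y c := h [x, y] c

theorem isLeftRepresentable.toShort (h : isLeftRepresentable M) :
    ShortSkewMulticategory.isLeftRepresentable M.toShort := by
  refine ⟨fun a b => ?_, ?_⟩
  · obtain ⟨m, θ, hθ⟩ := h.1 tight [a, b] (by simp)
    exact ⟨m, θ, (h.2 _ _ _ _ hθ).toShort_binary⟩
  · obtain ⟨m, w, hw⟩ := h.1 loose [] (by simp)
    exact ⟨m, w, (h.2 _ _ _ _ hw).toShort_nullary⟩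

theorem isClosed.toShort (h : isClosed M) : ShortSkewMulticategory.isClosed M.toShort := by
  intro b c
  obtain ⟨k, e, he⟩ := h b c
  refine ⟨k, e, fun a => ?_, fun a₁ a₂ => he tight [a₁, a₂] (by simp),
    fun a₁ a₂ a₃ => he tight [a₁, a₂, a₃] (by simp), he loose [] (by simp),
    fun a => he loose [a] (by simp)⟩
  have : (fun f : M.Hom tight [a] k =>
      M.toShort.T₂.act (a₁ := k) (a₂ := b) (c := c) (a₁' := a) f (𝟙 b) (𝟙 c) e) =
      fun f : M.Hom tight [a] k =>
        M.sub (z := tight) (cs := [a, b]) [] [b] rfl rfl rfl e f := by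
    funext f
    exact (post_id _).trans (pre_id _ _ _ _)
  exact this ▸ he tight [a] (by simp)

theorem isLeftRepresentable.nonempty_classifiers (h : isLeftRepresentable M) :
    Nonempty M.Classifiers := by
  choose t θ hθ using fun a b => h.1 tight [a, b] (by simp)
  obtain ⟨m, w, hw⟩ := h.1 loose [] (by simp)
  exact ⟨⟨t, θ, hθ, m, w, hw⟩⟩

namespace Classifiers

theorem exists_tensorHom (d : M.Classifiers) {a a' b b' : M.Obj} (f : M.Hom tight [a] a')
    (g : M.Hom tight [b] b') :
    ∃ t : M.Hom tight [d.tensor a b] (d.tensor a' b'),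
      M.sub (z := tight) (cs := [a, b]) [] [] rfl rfl rfl t (d.θ a b) =
        M.sub (z := tight) [a] [] rfl rfl rfl
          (M.sub (z := tight) (cs := [a, b']) [] [b'] rfl rfl rfl (d.θ a' b') f) g :=
  (d.isClassifier_θ a b _).2 _

theorem exists_α (d : M.Classifiers) (h : isLeftRepresentable M) (a b e : M.Obj) :
    ∃ t : M.Hom tight [d.tensor (d.tensor a b) e] (d.tensor a (d.tensor b e)),
      M.sub (z := tight) (cs := [a, b, e]) [] [] rfl rfl rfl t
          (M.sub (z := tight) [] [e] rfl rfl rfl (d.θ (d.tensor a b) e) (d.θ a b)) =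
        M.sub (z := tight) [a] [] rfl rfl rfl (d.θ a (d.tensor b e)) (d.θ b e) := by
  obtain ⟨k, hk⟩ := (h.2 _ _ _ _ (d.isClassifier_θ a b) [e] _).2
    (M.sub (z := tight) [a] [] rfl rfl rfl (d.θ a (d.tensor b e)) (d.θ b e))
  obtain ⟨t, ht⟩ := (d.isClassifier_θ (d.tensor a b) e _).2 k
  refine ⟨t, Eq.trans ?_ hk⟩
  rw [← ht]
  exact M.assoc [] [] [] [e] _ _ _ _ _ _ _ _ _ _ _ _ _ _

theorem exists_lam (d : M.Classifiers) (h : isLeftRepresentable M) (a : M.Obj) :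
    ∃ t : M.Hom tight [d.tensor d.unit a] a,
      M.sub (z := loose) (cs := [a]) [] [] rfl rfl rfl t
          (M.sub (z := loose) [] [a] rfl rfl rfl (d.θ d.unit a) d.w) = M.j (M.id a) := by
  obtain ⟨k, hk⟩ := (h.2 _ _ _ _ d.isClassifier_w [a] _).2 (M.j (M.id a))
  obtain ⟨t, ht⟩ := (d.isClassifier_θ d.unit a _).2 k
  refine ⟨t, Eq.trans ?_ hk⟩
  rw [← ht]
  exact M.assoc [] [] [] [a] _ _ _ _ _ _ _ _ _ _ _ _ _ _

/-- The induced classifiers of the underlying short skew multicategory. -/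
def toShort (d : M.Classifiers) (h : isLeftRepresentable M) : M.toShort.Classifiers where
  tensor := d.tensor
  θ := d.θ
  θ_univ a b := (h.2 _ _ _ _ (d.isClassifier_θ a b)).toShort_binary
  unit := d.unit
  w := d.w
  w_univ := (h.2 _ _ _ _ d.isClassifier_w).toShort_nullary

/-- The structural maps determined by the universal properties of the classifiers. -/
noncomputable def canonicalStructure (d : M.Classifiers) (h : isLeftRepresentable M) :
    (d.toShort h).Structure where
  tensorHom f g := (d.exists_tensorHom f g).choose
  tensorHom_θ {a a' b b'} f g := by
    refine Eq.trans ?_ ((d.exists_tensorHom f g).choose_spec.trans (post_id _).symm)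
    exact congrArg (post (M := M) _) ((pre_id _ _ _ _).trans (pre_id _ _ _ _))
  α a b e := (d.exists_α h a b e).choose
  α_θ a b e := by
    refine Eq.trans ?_ (d.exists_α h a b e).choose_spec
    exact congrArg (post (M := M) _)
      ((pre_id _ _ _ _).trans ((pre_id _ _ _ _).trans (pre_id _ _ _ _)))
  lam a := (d.exists_lam h a).choose
  lam_θ a := by
    refine Eq.trans ?_ (d.exists_lam h a).choose_spec
    refine Eq.trans ?_ (M.assoc [] [] [] [a] (w := loose) (w' := tight) (o := loose)
      (gs := [d.unit, a]) (cs := [a]) (bs := [d.tensor d.unit a]) (os := [a]) (hs := [d.unit, a])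
      rfl rfl rfl rfl rfl rfl rfl rfl rfl rfl rfl (d.exists_lam h a).choose (d.θ d.unit a) d.w).symm
    exact congrArg (M.sub [] [a] rfl rfl rfl · d.w) (congrArg (post (M := M) _)
      ((pre_id _ _ _ _).trans (pre_id _ _ _ _)))

end Classifiers

end SkewMulticategory

namespace SkewMulticategory.Classifiers

variable {M N : SkewMulticategory.{v, u}}

/-- The structural maps determined by the universal properties of the classifiers. -/
noncomputable def mapStructure (d : M.Classifiers) (h : isLeftRepresentable M) (d' : N.Classifiers)
    (h' : isLeftRepresentable N) (F : SkewMultifunctor M N) :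
    ShortSkewMulticategory.Classifiers.MapStructure (d.toShort h) (d'.toShort h') F.toShort where
  f₀ := ((d'.isClassifier_w (F.obj d.unit)).2 (F.map rfl d.w)).choose
  f₀_w := ((d'.isClassifier_w (F.obj d.unit)).2 (F.map rfl d.w)).choose_spec
  f₂ a b := ((d'.isClassifier_θ (F.obj a) (F.obj b) (F.obj (d.tensor a b))).2
    (F.map rfl (d.θ a b))).choose
  f₂_θ a b := by
    refine Eq.trans ?_ ((d'.isClassifier_θ (F.obj a) (F.obj b) (F.obj (d.tensor a b))).2
      (F.map rfl (d.θ a b))).choose_spec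
    exact congrArg (post (M := N) _) ((pre_id _ _ _ _).trans (pre_id _ _ _ _))

/-- The classifiers of `M` given by those of the underlying short skew multicategory. -/
def ofShort (c : M.toShort.Classifiers) : M.Classifiers where
  tensor := c.tensor
  θ := c.θ
  isClassifier_θ a b e := by
    have : (fun f : M.Hom tight [c.tensor a b] e =>
        M.toShort.T₂.act (𝟙 a) (𝟙 b) f (c.θ a b)) =
        fun f : M.Hom tight [c.tensor a b] e =>
          M.sub (z := tight) (cs := [a, b]) [] [] rfl rfl rfl f (c.θ a b) := by
      funext f
      exact congrArg (post (M := M) f) ((pre_id _ _ _ _).trans (pre_id _ _ _ _))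
    exact this ▸ (c.θ_univ a b).unary e
  unit := c.unit
  w := c.w
  isClassifier_w e := c.w_univ.unary e

end SkewMulticategory.Classifiers

namespace SkewMulticategory

/-- The functor `T` from left representable skew multicategories to skew monoidal categories, for a
given choice of classifiers. -/
noncomputable def toSkewMonoidal
    (d : ∀ M : isLeftRepresentable.{v, u}.FullSubcategory, M.obj.Classifiers) :
    isLeftRepresentable.{v, u}.FullSubcategory ⥤ SkewMonoidalCat.{v, u} where
  obj M := ((d M).canonicalStructure M.property).toSkewMonoidal
  map {M N} F := ((d M).mapStructure M.property (d N) N.property F.hom).toLax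
    ((d M).canonicalStructure M.property) ((d N).canonicalStructure N.property)
  map_id M := congrArg (ShortSkewMulticategory.Classifiers.MapStructure.toLax ·
      ((d M).canonicalStructure M.property) ((d M).canonicalStructure M.property))
    (((d M).mapStructure M.property (d M) M.property (𝟙 M : M ⟶ M).hom).unique
      (.id ((d M).toShort M.property)))
  map_comp {M N P} F G := congrArg (ShortSkewMulticategory.Classifiers.MapStructure.toLax ·
      ((d M).canonicalStructure M.property) ((d P).canonicalStructure P.property))
    (((d M).mapStructure M.property (d P) P.property (F ≫ G).hom).unique
      (((d M).mapStructure M.property (d N) N.property F.hom).comp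
        ((d N).mapStructure N.property (d P) P.property G.hom)))

/-- The forgetful functor between left representables. -/
def forgetLR : isLeftRepresentable.{v, u}.FullSubcategory ⥤
    ShortSkewMulticategory.isLeftRepresentable.{v, u}.FullSubcategory :=
  ObjectProperty.lift _ (isLeftRepresentable.ι ⋙ forgetShort) fun M => M.property.toShort

/-- The forgetful functor between closed left representables. -/
def forgetClosed : (isLeftRepresentable.{v, u} ⊓ isClosed).FullSubcategory ⥤
    (ShortSkewMulticategory.isLeftRepresentable.{v, u} ⊓
      ShortSkewMulticategory.isClosed).FullSubcategory :=
  ObjectProperty.lift _ ((isLeftRepresentable ⊓ isClosed).ι ⋙ forgetShort)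
    fun M => ⟨M.property.1.toShort, M.property.2.toShort⟩

end SkewMulticategory

/-- The restriction to closed objects of a functor preserving closedness. -/
def restrictClosed {C D : Type*} [Category C] [Category D] {P Q : ObjectProperty C}
    {R : ObjectProperty D} (F : P.FullSubcategory ⥤ D)
    (hF : ∀ X (hP : P X), Q X → R (F.obj ⟨X, hP⟩)) : (P ⊓ Q).FullSubcategory ⥤ R.FullSubcategory :=
  R.lift (ObjectProperty.ιOfLE inf_le_left ⋙ F) fun X => hF X.obj X.property.1 X.property.2

/-! The theorem rests on a factorization property, a construction of skew multicategories, and an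
extension argument.

Factorization. In a left representable short skew multicategory every tight multimap of arity 2, 3
or 4 factors uniquely through some `θ`, and every loose one through `u`. Hence a morphism out of it
is determined by a functor and the images `Θ` of the maps `θ` and `W` of `u`. Conversely, a functor
with such images extends to a morphism as soon as `Θ` and `W` are compatible with `f ⊗ g`, `α`, `λ`
and `ρ` (`MorphismData.toMorphism`). If the target is also left representable, `Θ` and `W` amount to
`f₂` and `f₀`, and the compatibilities are the axioms of a lax monoidal functor. So `K` is full and
faithful (`toLax_toMorphism`, `toMorphism_toLax`).

Construction. For essential surjectivity, a skew monoidal category `C` is made into a whole skew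
multicategory `C.toMulti`. Its tight multimaps are the maps `(a₁a₂)⋯aₙ ⟶ b`, its loose ones the maps
`((i a₁)a₂)⋯aₙ ⟶ b`. A multimap `f` induces a transformation `hat f` from `((-a₁)a₂)⋯aₙ` to `- ⊗ b`,
compatible with tensoring on the left. Substitution is sent to whiskering and composition
(`Multi.hat_sub`), so associativity and commutation follow from the 2-categorical laws of
endofunctors and transformations. Each axiom of `C` has one task: the pentagon and `α_lam` make `- ⊗
a` an admissible endofunctor, `ρ_α` makes `hat` of a loose map compatible, `ρ_α_lam` makes loosening
invisible to `hat`, and `ρ_lam` recovers a loose map from its `hat`. Classifiers of `C.toMulti` are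
the isomorphisms, and `K` sends its underlying short skew multicategory back to `C` up to
isomorphism (`shortToSkewMonoidalIso`).

Extension. Left universality factors multimaps of all arities, so a morphism between underlying
short skew multicategories extends by recursion on the arity (`extend`). That the extension
preserves substitution follows by moving classifiers around with the associativity and commutation
axioms (`Extension.compat`). Thus the forgetful functor is full and faithful. It is essentially
surjective because `K` is full and faithful and `K U (toMulti C) ≅ C`.

Closedness passes along these constructions through the bijections `C(ab, d) ≅ C(a, [b, d])`. Two
choices of classifiers are compared by the uniqueness of all structural maps, which gives the
triangle. -/

namespace SkewMonoidalCat

/-! ### Endofunctors compatible with tensoring on the left, and their strict composition -/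

/-- Endofunctors of `C` with an oplax compatibility with tensoring on the left. -/
@[ext]
structure ModEnd (C : SkewMonoidalCat.{v, u}) where
  obj : C.Obj → C.Obj
  map : ∀ {x y : C.Obj}, (x ⟶ y) → (obj x ⟶ obj y)
  map_id : ∀ x, map (𝟙 x) = 𝟙 (obj x)
  map_comp : ∀ {x y z : C.Obj} (f : x ⟶ y) (g : y ⟶ z), map (f ≫ g) = map f ≫ map g
  str : ∀ y x : C.Obj, obj (C.tensorObj y x) ⟶ C.tensorObj y (obj x)
  str_naturality : ∀ {y y' x x' : C.Obj} (p : y ⟶ y') (q : x ⟶ x'),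
    map (C.tensorHom p q) ≫ str y' x' = str y x ≫ C.tensorHom p (map q)
  str_α : ∀ y x z : C.Obj, str (C.tensorObj y x) z ≫ C.α y x (obj z) =
    map (C.α y x z) ≫ str y (C.tensorObj x z) ≫ C.tensorHom (𝟙 y) (str x z)
  str_lam : ∀ x : C.Obj, str C.unit x ≫ C.lam (obj x) = map (C.lam x)

attribute [simp] ModEnd.map_id

namespace ModEnd

variable {C : SkewMonoidalCat.{v, u}}

theorem map_comp_assoc (F : ModEnd C) {x y z : C.Obj} (f : x ⟶ y) (g : y ⟶ z) {w : C.Obj}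
    (h : F.obj z ⟶ w) : F.map (f ≫ g) ≫ h = F.map f ≫ F.map g ≫ h := by
  rw [F.map_comp, Category.assoc]

/-- The identity endofunctor. -/
abbrev one (C : SkewMonoidalCat.{v, u}) : ModEnd C where
  obj x := x
  map f := f
  map_id _ := rfl
  map_comp _ _ := rfl
  str _ _ := 𝟙 _
  str_naturality _ _ := by simp
  str_α _ _ _ := by simp [C.tensorHom_id]
  str_lam _ := by simp

/-- Composition, in diagrammatic order. -/
abbrev comp (F G : ModEnd C) : ModEnd C where
  obj x := G.obj (F.obj x)
  map f := G.map (F.map f)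
  map_id _ := by simp
  map_comp _ _ := by simp [map_comp]
  str y x := G.map (F.str y x) ≫ G.str y (F.obj x)
  str_naturality p q := by
    simp only [Category.assoc]
    rw [← G.str_naturality, ← map_comp_assoc, ← map_comp_assoc, F.str_naturality]
  str_α y x z := by
    have h := G.str_naturality (𝟙 y) (F.str x z)
    simp only [Category.assoc, C.id_tensor_comp]
    rw [← reassoc_of% h, G.str_α, ← map_comp_assoc, F.str_α]
    simp only [map_comp, Category.assoc]
  str_lam x := by
    simp only [Category.assoc]
    rw [G.str_lam, ← map_comp, F.str_lam]

/-- The endofunctor `- ⊗ a`. -/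
abbrev rightTensor (C : SkewMonoidalCat.{v, u}) (a : C.Obj) : ModEnd C where
  obj x := C.tensorObj x a
  map f := C.tensorHom f (𝟙 a)
  map_id _ := C.tensorHom_id _ _
  map_comp _ _ := C.comp_tensor_id _ _
  str y x := C.α y x a
  str_naturality _ _ := C.α_naturality _ _ _
  str_α y x z := (C.pentagon y x z a).symm
  str_lam x := C.α_lam x a

/-- On objects and maps the unit and associativity laws of composition hold by definition; only the
strengths need an argument. Having equalities instead of coherence isomorphisms is what allows lists
of objects to be concatenated freely, at the price of the `eqToHom`s in `whisk` and `subFirst`. -/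
theorem one_comp (F : ModEnd C) : (one C).comp F = F :=
  ModEnd.ext rfl HEq.rfl (heq_of_eq (by funext y x; simp))

theorem comp_one (F : ModEnd C) : F.comp (one C) = F :=
  ModEnd.ext rfl HEq.rfl (heq_of_eq (by funext y x; simp))

theorem comp_assoc (F G H : ModEnd C) : (F.comp G).comp H = F.comp (G.comp H) :=
  ModEnd.ext rfl HEq.rfl (heq_of_eq (by funext y x; simp [map_comp]))

/-! ### Transformations, whiskering and interchange -/

/-- A natural transformation compatible with tensoring on the left. -/
@[ext]
structure Hom (F G : ModEnd C) where
  app : ∀ x, F.obj x ⟶ G.obj x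
  naturality : ∀ {x y : C.Obj} (f : x ⟶ y), F.map f ≫ app y = app x ≫ G.map f
  app_str : ∀ y x, app (C.tensorObj y x) ≫ G.str y x = F.str y x ≫ C.tensorHom (𝟙 y) (app x)

theorem Hom.naturality_assoc {F G : ModEnd C} (t : Hom F G) {x y z : C.Obj} (f : x ⟶ y)
    (h : G.obj y ⟶ z) : F.map f ≫ t.app y ≫ h = t.app x ≫ G.map f ≫ h := by
  rw [← Category.assoc, t.naturality, Category.assoc]

theorem Hom.app_str_assoc {F G : ModEnd C} (t : Hom F G) (y x : C.Obj) {z : C.Obj}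
    (h : C.tensorObj y (G.obj x) ⟶ z) :
    t.app (C.tensorObj y x) ≫ G.str y x ≫ h = F.str y x ≫ C.tensorHom (𝟙 y) (t.app x) ≫ h := by
  rw [← Category.assoc, t.app_str, Category.assoc]

instance : Category (ModEnd C) where
  Hom := Hom
  id F := ⟨fun _ => 𝟙 _, by simp, by simp [C.tensorHom_id]⟩
  comp s t := ⟨fun x => s.app x ≫ t.app x, fun f => by
    rw [s.naturality_assoc, t.naturality, Category.assoc], fun y x => by
    rw [Category.assoc, t.app_str, s.app_str_assoc, C.id_tensor_comp]⟩
  id_comp _ := Hom.ext (by funext x; exact Category.id_comp _)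
  comp_id _ := Hom.ext (by funext x; exact Category.comp_id _)
  assoc _ _ _ := Hom.ext (by funext x; exact Category.assoc _ _ _)

@[ext]
theorem hom_ext {F G : ModEnd C} {s t : F ⟶ G} (h : ∀ x, s.app x = t.app x) : s = t :=
  Hom.ext (funext h)

@[simp]
theorem id_app (F : ModEnd C) (x : C.Obj) : Hom.app (𝟙 F) x = 𝟙 _ := rfl

@[simp]
theorem comp_app {F G H : ModEnd C} (s : F ⟶ G) (t : G ⟶ H) (x : C.Obj) :
    (s ≫ t).app x = s.app x ≫ t.app x := rfl

theorem eqToHom_app {F G : ModEnd C} (h : F = G) (x : C.Obj) :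
    Hom.app (eqToHom h) x = eqToHom (by rw [h]) := by
  subst h; rfl

/-- Whiskering by `L` on the left and `P` on the right. -/
abbrev whisker (L P : ModEnd C) {A B : ModEnd C} (t : A ⟶ B) :
    (L.comp A).comp P ⟶ (L.comp B).comp P where
  app x := P.map (t.app (L.obj x))
  naturality f := by
    rw [← P.map_comp, ← P.map_comp, t.naturality]
  app_str y x := by
    have h := P.str_naturality (𝟙 y) (t.app (L.obj x))
    have h1 := t.naturality (L.str y x)
    have h2 := t.app_str y (L.obj x)
    simp only [Category.assoc, map_comp] at *
    rw [← h, ← map_comp_assoc, ← map_comp_assoc, ← map_comp_assoc,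
      ← map_comp_assoc, ← h1, Category.assoc, h2, Category.assoc]

/-- Whiskering between endofunctors which are only equal to the expected ones. -/
def whisk (L P : ModEnd C) {A B X Y : ModEnd C} (hX : X = (L.comp A).comp P)
    (hY : Y = (L.comp B).comp P) (t : A ⟶ B) : X ⟶ Y :=
  eqToHom hX ≫ whisker L P t ≫ eqToHom hY.symm

section whisk

variable {L P A B D X Y Z L' P' A' B' L'' P'' : ModEnd C}

theorem whisk_eqToHom (hX : X = (L.comp A).comp P) (hY : X = (L.comp B).comp P) (h : A = B) :
    whisk L P hX hY (eqToHom h) = 𝟙 X := by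
  subst h hX
  ext x
  simp [whisk]

theorem whisk_comp (hX : X = (L.comp A).comp P) (hY : Y = (L.comp B).comp P)
    (hZ : Z = (L.comp D).comp P) (s : A ⟶ B) (t : B ⟶ D) :
    whisk L P hX hZ (s ≫ t) = whisk L P hX hY s ≫ whisk L P hY hZ t := by
  subst hX hY hZ
  ext x
  simp [whisk, map_comp]

/-- Both sides apply `t` in the middle of the same composite, bracketed differently. This collapses
an inner and an outer context into one, as associativity of substitution requires. -/
theorem whisk_whisk (hX : X = (L.comp A).comp P) (hY : Y = (L.comp B).comp P)
    (hA : A = (L'.comp A').comp P') (hB : B = (L'.comp B').comp P')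
    (hX' : X = (L''.comp A').comp P'') (hY' : Y = (L''.comp B').comp P'')
    (hL : L'' = L.comp L') (hP : P'' = P'.comp P) (t : A' ⟶ B') :
    whisk L P hX hY (whisk L' P' hA hB t) = whisk L'' P'' hX' hY' t := by
  subst hL hP hA hB hX hY
  ext x
  simp [whisk, eqToHom_app]

/-- The interchange law: `s` and `t` act on different factors of `L, A, D, B, P`, and the square is
the naturality of `t` at `D.map` of a component of `s`. The many equations let each composite be
presented in the bracketing in which it arises. -/
theorem whisk_exchange {W m₁ m₂ : ModEnd C} (s : A ⟶ A') (t : B ⟶ B')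
    (hX : X = (L.comp A).comp m₁) (hY : Y = (L.comp A').comp m₁)
    (hm : m₁ = (D.comp B).comp P) (hm' : m₂ = (D.comp B').comp P)
    (hL : L' = (L.comp A').comp D) (hL' : L'' = (L.comp A).comp D)
    (hY' : Y = (L'.comp B).comp P) (hZ : Z = (L'.comp B').comp P)
    (hX' : X = (L''.comp B).comp P) (hW : W = (L''.comp B').comp P)
    (hW' : W = (L.comp A).comp m₂) (hZ' : Z = (L.comp A').comp m₂) :
    whisk L m₁ hX hY s ≫ whisk L' P hY' hZ t = whisk L'' P hX' hW t ≫ whisk L m₂ hW' hZ' s := by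
  subst hm hm' hL hL' hX hY hW hZ
  ext x
  have := t.naturality (D.map (s.app (L.obj x)))
  simp [whisk, eqToHom_app, ← map_comp, this]

end whisk

/-! ### Iterated tensors and the transformations induced by maps out of them -/

/-- The endofunctor tensoring on the right with the objects of a list, from left to right. -/
def ofList (C : SkewMonoidalCat.{v, u}) : List C.Obj → ModEnd C
  | [] => one C
  | a :: as => (rightTensor C a).comp (ofList C as)

theorem ofList_append (l r : List C.Obj) : ofList C (l ++ r) = (ofList C l).comp (ofList C r) := by
  induction l with
  | nil => exact (one_comp _).symm
  | cons a l ih => rw [List.cons_append, ofList, ofList, ih, comp_assoc]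

/-- The transformation determined by a map `A a ⟶ b`. -/
abbrev hatTight (A : ModEnd C) {a b : C.Obj} (f : A.obj a ⟶ b) :
    (rightTensor C a).comp A ⟶ rightTensor C b where
  app x := A.str x a ≫ C.tensorHom (𝟙 x) f
  naturality {x y} p := by
    have := A.str_naturality p (𝟙 a)
    simp only [map_id] at this
    simp only [Category.assoc, reassoc_of% this, ← C.tensorHom_comp, Category.id_comp,
      Category.comp_id]
  app_str y x := by
    have := C.α_naturality (𝟙 y) (𝟙 x) f
    simp only [C.tensorHom_id] at this
    simp [C.id_tensor_comp, this, reassoc_of% A.str_α]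

/-- The transformation determined by a map `A i ⟶ b`. -/
abbrev hatLoose (A : ModEnd C) {b : C.Obj} (f : A.obj C.unit ⟶ b) :
    A ⟶ rightTensor C b where
  app x := A.map (C.ρ x) ≫ (hatTight A f).app x
  naturality {x y} p := by
    have h := (hatTight A f).naturality p
    rw [Category.assoc, ← h, ← map_comp_assoc, ← map_comp_assoc, C.ρ_naturality]
  app_str y x := by
    have h := (hatTight A f).app_str y x
    have h2 := A.str_naturality (𝟙 y) (C.ρ x)
    -- The axiom `ρ_α` turns the unit inserted after `y ⊗ x` into a unit inserted after `x` alone;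
    -- naturality of the strength then moves it inside `y ⊗ -`.
    rw [Category.assoc, h, Category.assoc, ← map_comp_assoc, C.ρ_α, reassoc_of% h2]
    simp only [C.id_tensor_comp]

/-- Substitution of `f` at the first position. -/
def subFirst {X A B : ModEnd C} (h : X = A.comp B) {s b c : C.Obj} (g : B.obj b ⟶ c)
    (f : A.obj s ⟶ b) : X.obj s ⟶ c :=
  Hom.app (eqToHom h) s ≫ B.map f ≫ g

section

variable {X X' Y A A' B B' D : ModEnd C} {a s b c d : C.Obj}

theorem subFirst_subFirst (hX : X = A.comp Y) (hY : Y = B.comp D) (hX' : X' = A.comp B)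
    (hX'' : X = X'.comp D) (h : D.obj c ⟶ d) (g : B.obj b ⟶ c) (f : A.obj s ⟶ b) :
    subFirst hX (subFirst hY h g) f = subFirst hX'' h (subFirst hX' g f) := by
  subst hX' hY hX
  simp [subFirst, map_comp, eqToHom_app]

theorem subFirst_app_comp (hX : X = A.comp B) (hX' : X' = A'.comp B) (t : A' ⟶ A)
    (g : B.obj b ⟶ c) (f : A.obj s ⟶ b) (h₁ : X' = ((one C).comp A').comp B)
    (h₂ : X = ((one C).comp A).comp B) :
    subFirst hX' g (t.app s ≫ f) = (whisk (one C) B h₁ h₂ t).app s ≫ subFirst hX g f := by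
  subst hX hX'
  simp [subFirst, map_comp, eqToHom_app, whisk]

/-- Naturality of `t` at `g`: a transformation applied to later variables commutes with a
substitution into the first one. -/
theorem subFirst_comp_app (hX : X = A.comp B) (hX' : X' = A.comp B') (t : B' ⟶ B)
    (h : B.obj b ⟶ d) (g : A.obj s ⟶ b) (h₁ : X' = (A.comp B').comp (one C))
    (h₂ : X = (A.comp B).comp (one C)) :
    subFirst hX' (t.app b ≫ h) g = (whisk A (one C) h₁ h₂ t).app s ≫ subFirst hX h g := by
  subst hX hX'
  simp [subFirst, map_comp, eqToHom_app, whisk, t.naturality_assoc]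

/-- Holds because `t` respects the strengths. With its loose analogue below, it gives `hat_sub` for
substitutions performed by precomposition, that is, all except those into the first variable of a
tight map. -/
theorem hatTight_app_comp (t : A' ⟶ A) (g : A.obj a ⟶ c)
    (h₁ : (rightTensor C a).comp A' = ((rightTensor C a).comp A').comp (one C))
    (h₂ : (rightTensor C a).comp A = ((rightTensor C a).comp A).comp (one C)) :
    hatTight A' (t.app a ≫ g) = whisk (rightTensor C a) (one C) h₁ h₂ t ≫ hatTight A g := by
  ext x
  simp [whisk, eqToHom_app, C.id_tensor_comp, t.app_str_assoc]

theorem hatLoose_app_comp (t : A' ⟶ A) (g : A.obj C.unit ⟶ c) :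
    hatLoose A' (t.app C.unit ≫ g) = t ≫ hatLoose A g := by
  ext x
  simp only [comp_app, C.id_tensor_comp, Category.assoc, ← t.naturality_assoc, t.app_str_assoc]

/-- The strength of `A.comp B` is that of `A` under `B` followed by that of `B`, and naturality of
the latter carries `B.map f` across. This is `hat_sub` for substitution into the first variable of a
tight map. -/
theorem hatTight_subFirst (hX : X = A.comp B) (g : B.obj b ⟶ c) (f : A.obj a ⟶ b)
    (h₁ : (rightTensor C a).comp X = ((one C).comp ((rightTensor C a).comp A)).comp B)
    (h₂ : (rightTensor C b).comp B = ((one C).comp (rightTensor C b)).comp B) :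
    hatTight X (subFirst hX g f) = whisk (one C) B h₁ h₂ (hatTight A f) ≫ hatTight B g := by
  subst hX
  ext x
  have := B.str_naturality (𝟙 x) f
  simp [whisk, eqToHom_app, C.id_tensor_comp, subFirst, map_comp, reassoc_of% this]

theorem hatLoose_subFirst (hX : X = A.comp B) (g : B.obj b ⟶ c) (f : A.obj C.unit ⟶ b)
    (h₁ : X = ((one C).comp A).comp B)
    (h₂ : (rightTensor C b).comp B = ((one C).comp (rightTensor C b)).comp B) :
    hatLoose X (subFirst hX g f) = whisk (one C) B h₁ h₂ (hatLoose A f) ≫ hatTight B g := by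
  subst hX
  ext x
  have := B.str_naturality (𝟙 x) f
  simp [whisk, eqToHom_app, C.id_tensor_comp, subFirst, map_comp, reassoc_of% this]

theorem map_lam_subFirst (hX : X = A.comp B) (g : B.obj b ⟶ c) (f : A.obj a ⟶ b)
    (h : (rightTensor C a).comp X = ((rightTensor C a).comp A).comp B) :
    X.map (C.lam a) ≫ subFirst hX g f =
      subFirst (s := C.unit) h g (A.map (C.lam a) ≫ f) := by
  subst hX
  simp [subFirst, map_comp, eqToHom_app]

/-- For a loose `f`, evaluating its transformation at the unit and applying `λ` gives back `f`:
`str_lam` cancels the strength against `λ`, and `ρ_lam` removes the inserted unit. Consequently,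
substituting a loose map into a tight `g` agrees with substituting it into the loosening of `g`. -/
theorem subFirst_eq_hatLoose (hX : X = A.comp B) (g : B.obj b ⟶ c) (f : A.obj C.unit ⟶ b)
    (h₁ : X = ((one C).comp A).comp B)
    (h₂ : (rightTensor C b).comp B = ((one C).comp (rightTensor C b)).comp B) :
    subFirst hX g f =
      (whisk (one C) B h₁ h₂ (hatLoose A f)).app C.unit ≫ B.map (C.lam b) ≫ g := by
  subst hX
  have h1 := C.lam_naturality f
  have h2 := A.str_lam C.unit
  simp only [whisk, eqToHom_app, subFirst, comp_app, eqToHom_refl, Category.id_comp,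
    Category.comp_id, ← map_comp_assoc, Category.assoc, h1, reassoc_of% h2, C.ρ_lam, map_id, id_app]

theorem map_lam_app_comp (t : A' ⟶ A) (g : A.obj a ⟶ c)
    (h₁ : (rightTensor C a).comp A' = ((rightTensor C a).comp A').comp (one C))
    (h₂ : (rightTensor C a).comp A = ((rightTensor C a).comp A).comp (one C)) :
    A'.map (C.lam a) ≫ t.app a ≫ g =
      (whisk (rightTensor C a) (one C) h₁ h₂ t).app C.unit ≫ A.map (C.lam a) ≫ g := by
  simp [whisk, eqToHom_app, t.naturality_assoc]

/-- The unit inserted by `hatLoose` is removed by `λ` through the axiom `ρ_α_lam`. Hence a tight map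
and its loosening induce the same transformation. -/
theorem hatLoose_map_lam (f : A.obj a ⟶ b) :
    hatLoose ((rightTensor C a).comp A) (A.map (C.lam a) ≫ f) = hatTight A f := by
  ext x
  have h := A.str_naturality (𝟙 x) (C.lam a)
  simp only [C.id_tensor_comp, Category.assoc, ← reassoc_of% h, ← map_comp_assoc, C.ρ_α_lam, map_id,
    Category.id_comp]

end

end ModEnd

end SkewMonoidalCat

/-! ### The skew multicategory of a skew monoidal category -/

namespace SkewMonoidalCat

open ModEnd

/-- The multimaps of the skew multicategory associated to `C`. -/
def Multi (C : SkewMonoidalCat.{v, u}) : Tightness → List C.Obj → C.Obj → Type v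
  | tight, [], _ => PEmpty
  | tight, a :: as, b => (ofList C as).obj a ⟶ b
  | loose, as, b => (ofList C as).obj C.unit ⟶ b

namespace Multi

variable {C : SkewMonoidalCat.{v, u}}

def ofTight {a : C.Obj} {as : List C.Obj} {b : C.Obj} (f : (ofList C as).obj a ⟶ b) :
    C.Multi tight (a :: as) b := f

def ofLoose {as : List C.Obj} {b : C.Obj} (f : (ofList C as).obj C.unit ⟶ b) :
    C.Multi loose as b := f

@[elab_as_elim]
theorem cases_on {motive : ∀ x as b, C.Multi x as b → Prop} {x : Tightness} {as : List C.Obj}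
    {b : C.Obj} (f : C.Multi x as b)
    (ofTight : ∀ (a : C.Obj) (as : List C.Obj) (b : C.Obj) (f : (ofList C as).obj a ⟶ b),
      motive tight (a :: as) b (ofTight f))
    (ofLoose : ∀ (as : List C.Obj) (b : C.Obj) (f : (ofList C as).obj C.unit ⟶ b),
      motive loose as b (ofLoose f)) : motive x as b f :=
  match x, as, f with
  | tight, [], f => f.elim
  | tight, _ :: _, f => ofTight _ _ _ f
  | loose, _, f => ofLoose _ _ f

/-- The module transformation determined by a multimap. -/
def hat : ∀ {x : Tightness} {as : List C.Obj} {b : C.Obj}, C.Multi x as b →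
    (ofList C as ⟶ rightTensor C b)
  | tight, _ :: as, _, f => hatTight (ofList C as) f
  | loose, as, _, f => hatLoose (ofList C as) f

def toLoose : ∀ {as : List C.Obj} {b : C.Obj}, C.Multi tight as b → C.Multi loose as b
  | a :: as, _, f => (ofList C as).map (C.lam a) ≫ f

theorem ofList_sub {l r as cs : List C.Obj} (h : cs = l ++ as ++ r) :
    ofList C cs = ((ofList C l).comp (ofList C as)).comp (ofList C r) := by
  rw [h, ofList_append, ofList_append]

theorem ofList_cons_sub {l r bs : List C.Obj} {b : C.Obj} (h : bs = l ++ b :: r) :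
    ofList C bs = ((ofList C l).comp (rightTensor C b)).comp (ofList C r) := by
  rw [h, ofList_append, comp_assoc]; rfl

/-- Whiskering of `hat f`. -/
def hatAt (l r : List C.Obj) {y : Tightness} {as bs cs : List C.Obj} {b : C.Obj}
    (hb : bs = l ++ b :: r) (hc : cs = l ++ as ++ r) (f : C.Multi y as b) :
    ofList C cs ⟶ ofList C bs :=
  whisk (ofList C l) (ofList C r) (ofList_sub hc) (ofList_cons_sub hb) (hat f)

/-- Substitution. -/
def sub : ∀ (l r : List C.Obj) {x y z : Tightness} {as bs cs : List C.Obj} {b c : C.Obj}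
    (_ : z = x.sub l y) (_ : bs = l ++ b :: r) (_ : cs = l ++ as ++ r),
    C.Multi x bs c → C.Multi y as b → C.Multi z cs c
  | [], r, tight, tight, _, _ :: as, _, _, _, _, rfl, rfl, rfl, g, f =>
    ofTight (subFirst (ofList_append as r) g f)
  | [], r, tight, loose, _, as, _, _, _, _, rfl, rfl, rfl, g, f =>
    ofLoose (subFirst (ofList_append as r) g f)
  | d :: l, r, tight, _, _, _, _, _, _, _, rfl, rfl, rfl, g, f =>
    ofTight ((hatAt l r rfl rfl f).app d ≫ g)
  | l, r, loose, _, _, _, _, _, _, _, rfl, hb, hc, g, f =>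
    ofLoose ((hatAt l r hb hc f).app C.unit ≫ g)

section

variable {l r as bs cs : List C.Obj} {a b c d : C.Obj} {y : Tightness}

/-- This and the next three lemmas are the clauses of `sub` for lists which are only propositionally
equal to the expected concatenations, so that later proofs may supply any proof of the equations. -/
theorem sub_tight_tight (hz : tight = tight.sub ([] : List C.Obj) tight)
    (hb : b :: r = [] ++ b :: r) (hc : a :: cs = [] ++ (a :: as) ++ r)
    (h : ofList C cs = (ofList C as).comp (ofList C r))
    (g : (ofList C r).obj b ⟶ c) (f : (ofList C as).obj a ⟶ b) :
    sub [] r hz hb hc (ofTight g) (ofTight f) = ofTight (subFirst h g f) := by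
  obtain rfl : cs = as ++ r := by simpa using hc
  rfl

theorem sub_tight_loose (hz : loose = tight.sub ([] : List C.Obj) loose)
    (hb : b :: r = [] ++ b :: r) (hc : cs = [] ++ as ++ r)
    (h : ofList C cs = (ofList C as).comp (ofList C r))
    (g : (ofList C r).obj b ⟶ c) (f : (ofList C as).obj C.unit ⟶ b) :
    sub [] r hz hb hc (ofTight g) (ofLoose f) = ofLoose (subFirst h g f) := by
  obtain rfl : cs = as ++ r := by simpa using hc
  rfl

theorem sub_tight_cons (hz : tight = tight.sub (d :: l) y)
    (hb : d :: bs = (d :: l) ++ b :: r) (hc : d :: cs = (d :: l) ++ as ++ r)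
    (hb' : bs = l ++ b :: r) (hc' : cs = l ++ as ++ r)
    (g : (ofList C bs).obj d ⟶ c) (f : C.Multi y as b) :
    sub (d :: l) r hz hb hc (ofTight g) f = ofTight ((hatAt l r hb' hc' f).app d ≫ g) := by
  subst hb' hc'
  rfl

theorem sub_loose (hz : loose = loose.sub l y) (hb : bs = l ++ b :: r) (hc : cs = l ++ as ++ r)
    (g : (ofList C bs).obj C.unit ⟶ c) (f : C.Multi y as b) :
    sub l r hz hb hc (ofLoose g) f = ofLoose ((hatAt l r hb hc f).app C.unit ≫ g) := by
  subst hb hc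
  cases l <;> rfl

end

/-- The central property of the construction: substitution becomes composition of transformations in
a context. The three computations behind it are the behaviour of `hatLoose` and `hatTight` under
precomposition and under `subFirst`. -/
theorem hat_sub (l r : List C.Obj) {x y z : Tightness} {as bs cs : List C.Obj} {b c : C.Obj}
    (hz : z = x.sub l y) (hb : bs = l ++ b :: r) (hc : cs = l ++ as ++ r)
    (g : C.Multi x bs c) (f : C.Multi y as b) :
    hat (sub l r hz hb hc g f) = hatAt l r hb hc f ≫ hat g := by
  cases g using cases_on with
  | ofLoose bs c g =>
    have e : z = loose := hz
    subst e
    rw [sub_loose]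
    exact hatLoose_app_comp _ _
  | ofTight e bs c g =>
    cases l with
    | nil =>
      obtain ⟨rfl, rfl⟩ := List.cons.inj hb
      cases f using cases_on with
      | ofTight a as b f =>
        have e : z = tight := hz
        subst e hc
        exact hatTight_subFirst (ofList_append as _) g f _ _
      | ofLoose as b f =>
        have e : z = loose := hz
        subst e hc
        exact hatLoose_subFirst (ofList_append as _) g f _ _
    | cons d l =>
      have e : z = tight := hz
      obtain ⟨rfl, rfl⟩ := List.cons.inj hb
      subst e hc
      refine (hatTight_app_comp (hatAt l r rfl rfl f) g (comp_one _).symm (comp_one _).symm).trans ?_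
      refine congrArg (· ≫ _) ?_
      exact whisk_whisk _ _ _ _ _ _ rfl (comp_one _).symm _

/-- The formula `hat_sub` whiskered by `l` and `r`, after which the nested contexts merge by
`whisk_whisk`. -/
theorem hatAt_sub {l r l' r' : List C.Obj} {y z w : Tightness}
    {as gs cs hs os bs : List C.Obj} {b c : C.Obj}
    (hw : w = y.sub l' z) (hgs : gs = l' ++ b :: r') (hcs : cs = l' ++ as ++ r')
    (hbs : bs = l ++ c :: r) (hos : os = l ++ cs ++ r)
    (hhs : hs = l ++ gs ++ r) (hhs' : hs = (l ++ l') ++ b :: (r' ++ r))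
    (hos' : os = (l ++ l') ++ as ++ (r' ++ r)) (g : C.Multi y gs c) (f : C.Multi z as b) :
    hatAt l r hbs hos (sub l' r' hw hgs hcs g f) =
      hatAt (l ++ l') (r' ++ r) hhs' hos' f ≫ hatAt l r hbs hhs g := by
  rw [hatAt, hat_sub, whisk_comp _ (ofList_sub hhs)]
  refine congrArg (· ≫ _) ?_
  exact whisk_whisk _ _ _ _ _ _ (ofList_append _ _) (ofList_append _ _) _

theorem hatAt_comm {l m r : List C.Obj} {y z : Tightness}
    {as gs bs hs hs' os : List C.Obj} {b c : C.Obj}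
    (hbs : bs = l ++ b :: (m ++ c :: r)) (hhs : hs = l ++ gs ++ (m ++ c :: r))
    (hhs' : hs = (l ++ gs ++ m) ++ c :: r)
    (hos : os = (l ++ gs ++ m) ++ as ++ r)
    (hbs' : bs = (l ++ b :: m) ++ c :: r)
    (hks : hs' = (l ++ b :: m) ++ as ++ r)
    (hks' : hs' = l ++ b :: (m ++ as ++ r))
    (hos' : os = l ++ gs ++ (m ++ as ++ r)) (g : C.Multi y gs b) (f : C.Multi z as c) :
    hatAt (l ++ gs ++ m) r hhs' hos f ≫ hatAt l (m ++ c :: r) hbs hhs g =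
      hatAt l (m ++ as ++ r) hks' hos' g ≫ hatAt (l ++ b :: m) r hbs' hks f :=
  (whisk_exchange (D := ofList C m) (hat g) (hat f) (ofList_sub hos') (ofList_cons_sub hks')
    (ofList_sub rfl) (ofList_cons_sub rfl) (ofList_cons_sub rfl) (ofList_sub rfl) _ _ _ _ _ _).symm

/-- Associativity when `g` enters the first variable of a tight map while `f` acts on `g` by
precomposition: `f` then also acts on the composite by precomposition, in a context enlarged by `r`.
-/
theorem subFirst_hatAt {l r r' : List C.Obj} {z : Tightness}
    {as gs cs hs os : List C.Obj} {s b c d : C.Obj}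
    (hgs : gs = l ++ b :: r') (hcs : cs = l ++ as ++ r')
    (hos : ofList C os = (ofList C cs).comp (ofList C r))
    (hhs : ofList C hs = (ofList C gs).comp (ofList C r)) (hhs' : hs = l ++ b :: (r' ++ r))
    (hos' : os = l ++ as ++ (r' ++ r)) (h : (ofList C r).obj c ⟶ d)
    (g : (ofList C gs).obj s ⟶ c) (f : C.Multi z as b) :
    subFirst hos h ((hatAt l r' hgs hcs f).app s ≫ g) =
      (hatAt l (r' ++ r) hhs' hos' f).app s ≫ subFirst hhs h g := by
  refine (subFirst_app_comp hhs _ _ _ _ (by rw [one_comp, hos]) (by rw [one_comp, hhs])).trans ?_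
  refine congrArg (fun t => Hom.app t s ≫ _) ?_
  exact whisk_whisk _ _ _ _ _ _ (one_comp _).symm (ofList_append _ _) _

def id (b : C.Obj) : C.Multi tight [b] b := ofTight (as := []) (𝟙 b)

theorem id_sub {x : Tightness} {as : List C.Obj} {b : C.Obj} (hz : x = tight.sub ([] : List C.Obj) x)
    (hb : [b] = [] ++ b :: []) (hc : as = [] ++ as ++ []) (f : C.Multi x as b) :
    sub [] [] hz hb hc (id b) f = f := by
  cases f using cases_on with
  | ofTight a as b f =>
    refine (sub_tight_tight _ _ _ (comp_one (ofList C as)).symm _ _).trans (congrArg ofTight ?_)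
    exact (congrArg (· ≫ _) (ModEnd.eqToHom_app _ _)).trans
      ((Category.id_comp _).trans (Category.comp_id _))
  | ofLoose as b f =>
    refine (sub_tight_loose _ _ _ (comp_one (ofList C as)).symm _ _).trans (congrArg ofLoose ?_)
    exact (congrArg (· ≫ _) (ModEnd.eqToHom_app _ _)).trans
      ((Category.id_comp _).trans (Category.comp_id _))

theorem hat_id (b : C.Obj) : hat (id b) =
    eqToHom (comp_one (rightTensor C b)) := by
  ext x
  rw [ModEnd.eqToHom_app]
  exact (Category.id_comp _).trans (C.tensorHom_id _ _)

theorem hatAt_id (l r : List C.Obj) {bs : List C.Obj} {b : C.Obj}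
    (hb : bs = l ++ b :: r) (hc : bs = l ++ [b] ++ r) :
    hatAt l r hb hc (id b) = 𝟙 _ := by
  rw [hatAt, hat_id]
  exact whisk_eqToHom _ _ _

theorem sub_id (l r : List C.Obj) {x : Tightness} {bs : List C.Obj} {b c : C.Obj}
    (hz : x = x.sub l tight) (hb : bs = l ++ b :: r) (hc : bs = l ++ [b] ++ r)
    (g : C.Multi x bs c) : sub l r hz hb hc g (id b) = g := by
  cases g using cases_on with
  | ofLoose bs c g =>
    rw [sub_loose, hatAt_id]
    exact congrArg ofLoose (Category.id_comp _)
  | ofTight e bs c g =>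
    cases l with
    | nil =>
      obtain ⟨rfl, rfl⟩ := List.cons.inj hb
      refine (sub_tight_tight _ _ _ (one_comp (ofList C bs)).symm _ _).trans (congrArg ofTight ?_)
      exact (congrArg (· ≫ _) (ModEnd.eqToHom_app _ _)).trans ((Category.id_comp _).trans
        ((congrArg (· ≫ _) (ModEnd.map_id _ _)).trans (Category.id_comp _)))
    | cons d l =>
      obtain ⟨rfl, h⟩ := List.cons.inj hb
      rw [sub_tight_cons _ _ _ h (List.cons.inj hc).2, hatAt_id]
      exact congrArg ofTight (Category.id_comp _)

/-- If `h` is loose, or if `g` enters a tight `h` after its first variable, then both sides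
precompose `h` with transformations, and `hatAt_sub` suffices. Otherwise `g` enters the first
variable of a tight `h`; then either `f` acts on `g` by precomposition (`subFirst_hatAt`), or it
enters the first variable of a tight `g` and functoriality decides (`subFirst_subFirst`). -/
theorem assoc (l r l' r' : List C.Obj) {x y z w w' o : Tightness}
    {as bs gs cs hs os : List C.Obj} {b c d : C.Obj}
    (hw : w = y.sub l' z) (hgs : gs = l' ++ b :: r') (hcs : cs = l' ++ as ++ r')
    (ho : o = x.sub l w) (hbs : bs = l ++ c :: r) (hos : os = l ++ cs ++ r)
    (hw' : w' = x.sub l y) (hhs : hs = l ++ gs ++ r)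
    (ho' : o = w'.sub (l ++ l') z) (hhs' : hs = (l ++ l') ++ b :: (r' ++ r))
    (hos' : os = (l ++ l') ++ as ++ (r' ++ r))
    (h : C.Multi x bs d) (g : C.Multi y gs c) (f : C.Multi z as b) :
    sub l r ho hbs hos h (sub l' r' hw hgs hcs g f) =
      sub (l ++ l') (r' ++ r) ho' hhs' hos' (sub l r hw' hbs hhs h g) f := by
  cases h using cases_on with
  | ofLoose bs d h =>
    have e₁ : w' = loose := hw'
    have e₂ : o = loose := ho
    subst e₁ e₂
    rw [sub_loose, sub_loose, sub_loose, hatAt_sub _ _ _ _ _ hhs hhs' hos', comp_app, Category.assoc]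
  | ofTight e bs d h =>
    cases l with
    | cons e' l =>
      have e₁ : w' = tight := hw'
      have e₂ : o = tight := ho
      obtain ⟨rfl, hbs'⟩ := List.cons.inj hbs
      subst e₁ e₂ hos
      cases hhs
      rw [sub_tight_cons _ _ _ hbs' rfl, sub_tight_cons _ _ _ hbs' rfl]
      refine Eq.trans ?_ (sub_tight_cons _ hhs' hos' (List.cons.inj hhs').2
        (List.cons.inj hos').2 _ _).symm
      rw [hatAt_sub _ _ _ _ _ rfl (List.cons.inj hhs').2 (List.cons.inj hos').2, comp_app,
        Category.assoc]
      rfl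
    | nil =>
      obtain ⟨rfl, rfl⟩ := List.cons.inj hbs
      have e₁ : w' = y := hw'
      have e₂ : o = w := ho
      subst e₁ e₂
      cases g using cases_on with
      | ofLoose gs c g =>
        have e₁ : o = loose := hw
        subst e₁ hos hhs
        rw [sub_loose, sub_tight_loose _ _ _ (ofList_append _ _),
          sub_tight_loose _ _ _ (ofList_append _ _)]
        refine Eq.trans ?_ (sub_loose _ _ _ _ _).symm
        exact congrArg ofLoose (subFirst_hatAt _ _ _ _ hhs' hos' _ _ _)
      | ofTight a gs c g =>
        cases l' with
        | nil =>
          obtain ⟨rfl, rfl⟩ := List.cons.inj hgs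
          have e₁ : o = z := hw
          subst e₁ hcs hos hhs
          cases f using cases_on with
          | ofTight a as b f =>
            rw [sub_tight_tight _ _ _ (ofList_append _ _)]
            refine (sub_tight_tight _ _ _ (ofList_append _ _) _ _).trans ?_
            refine Eq.trans ?_ (congrArg (fun k => sub _ _ _ _ _ k _) (sub_tight_tight _ _ _ (ofList_append _ _) _ _).symm)
            refine Eq.trans ?_ (sub_tight_tight _ _ _ (by simp [ofList_append]) _ _).symm
            exact congrArg ofTight (subFirst_subFirst _ _ _ _ _ _ _).symm
          | ofLoose as b f =>
            rw [sub_tight_loose _ _ _ (ofList_append _ _), sub_tight_loose _ _ _ (ofList_append _ _)]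
            refine Eq.trans ?_ (congrArg (fun k => sub _ _ _ _ _ k _) (sub_tight_tight _ _ _ (ofList_append _ _) _ _).symm)
            refine Eq.trans ?_ (sub_tight_loose _ _ _ (by simp [ofList_append]) _ _).symm
            exact congrArg ofLoose (subFirst_subFirst _ _ _ _ _ _ _).symm
        | cons a' l' =>
          have e₁ : o = tight := hw
          obtain ⟨rfl, hgs'⟩ := List.cons.inj hgs
          subst e₁ hcs hos hhs
          rw [sub_tight_cons _ _ _ hgs' rfl]
          refine (sub_tight_tight _ _ _ (ofList_append _ _) _ _).trans ?_
          refine Eq.trans ?_ (congrArg (fun k => sub _ _ _ _ _ k _) (sub_tight_tight _ _ _ (ofList_append _ _) _ _).symm)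
          refine Eq.trans ?_ (sub_tight_cons _ _ _ (List.cons.inj hhs').2 (List.cons.inj hos').2 _ _).symm
          exact congrArg ofTight (subFirst_hatAt _ _ _ _ _ _ _ _ _)

/-- When both substitutions are precompositions the claim is interchange, in the form `hatAt_comm`.
The remaining case has `g` in the first variable of a tight `h`; there `f` still acts by a
transformation, and naturality moves it past `g`. -/
theorem comm (l m r : List C.Obj) {x y z w w' o : Tightness}
    {as gs bs hs hs' os : List C.Obj} {b c d : C.Obj}
    (hw : w = x.sub l y) (hbs : bs = l ++ b :: (m ++ c :: r)) (hhs : hs = l ++ gs ++ (m ++ c :: r))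
    (ho : o = w.sub (l ++ gs ++ m) z) (hhs' : hs = (l ++ gs ++ m) ++ c :: r)
    (hos : os = (l ++ gs ++ m) ++ as ++ r)
    (hw' : w' = x.sub (l ++ b :: m) z) (hbs' : bs = (l ++ b :: m) ++ c :: r)
    (hks : hs' = (l ++ b :: m) ++ as ++ r)
    (ho' : o = w'.sub l y) (hks' : hs' = l ++ b :: (m ++ as ++ r))
    (hos' : os = l ++ gs ++ (m ++ as ++ r))
    (h : C.Multi x bs d) (g : C.Multi y gs b) (f : C.Multi z as c) :
    sub (l ++ gs ++ m) r ho hhs' hos (sub l (m ++ c :: r) hw hbs hhs h g) f =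
      sub l (m ++ as ++ r) ho' hks' hos' (sub (l ++ b :: m) r hw' hbs' hks h f) g := by
  cases h using cases_on with
  | ofLoose bs d h =>
    have e₁ : w = loose := hw
    have e₂ : w' = loose := hw'
    subst e₁ e₂
    have e₃ : o = loose := ho
    subst e₃
    rw [sub_loose, sub_loose, sub_loose, sub_loose, ← Category.assoc, ← comp_app,
      hatAt_comm _ _ _ _ hbs' hks hks' hos', comp_app, Category.assoc]
  | ofTight e bs d h =>
    cases l with
    | cons e' l =>
      have e₁ : w = tight := hw
      have e₂ : w' = tight := hw'
      subst e₁ e₂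
      have e₃ : o = tight := ho
      obtain ⟨rfl, hb₁⟩ := List.cons.inj hbs
      subst e₃ hos' hhs hks'
      rw [sub_tight_cons _ _ _ hb₁ rfl]
      refine (sub_tight_cons _ _ _ (List.cons.inj hhs').2 (List.cons.inj hos).2 _ _).trans ?_
      refine Eq.trans ?_ (congrArg (fun k => sub _ _ _ _ _ k _)
        (sub_tight_cons _ _ _ (List.cons.inj hbs').2 (List.cons.inj hks).2 _ _).symm)
      refine Eq.trans ?_ (sub_tight_cons _ _ _ rfl rfl _ _).symm
      refine congrArg ofTight ?_
      refine (Category.assoc _ _ _).symm.trans (Eq.trans ?_ (Category.assoc _ _ _))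
      exact congrArg (fun t => Hom.app t e ≫ h) (hatAt_comm hb₁ _ _ _ _ _ _ _ g f)
    | nil =>
      have e₁ : w = y := hw
      have e₂ : w' = tight := hw'
      subst e₁ e₂
      have e₃ : o = w := ho'
      obtain ⟨rfl, rfl⟩ := List.cons.inj hbs
      subst e₃ hhs hks' hos'
      have hk : ofList C (m ++ as ++ r) = ((ofList C m).comp (ofList C as)).comp (ofList C r) :=
        ofList_sub rfl
      -- Stated for an arbitrary starting object `s`, since `s` is the unit when `g` is loose and
      -- the first variable of `g` when `g` is tight.
      have key : ∀ {s : C.Obj} {gs os hs : List C.Obj} (hos : os = gs ++ m ++ as ++ r)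
          (hhs : hs = gs ++ m ++ c :: r) (hX : ofList C hs = (ofList C gs).comp (ofList C (m ++ c :: r)))
          (hY : ofList C os = (ofList C gs).comp (ofList C (m ++ as ++ r)))
          (g : (ofList C gs).obj s ⟶ e),
          (hatAt (gs ++ m) r hhs hos f).app s ≫ subFirst hX h g =
            subFirst hY ((hatAt m r rfl rfl f).app e ≫ h) g := by
        intro s gs os hs hos hhs hX hY g
        refine Eq.symm ((subFirst_comp_app hX hY _ _ _ (by rw [comp_one, hY])
          (by rw [comp_one, hX])).trans ?_)
        refine congrArg (fun t => Hom.app t s ≫ _) ?_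
        exact whisk_whisk _ _ _ _ _ _ (ofList_append _ _) (comp_one _).symm _
      have e₄ : sub ([] ++ e :: m) r hw' hbs' hks (ofTight h) f =
        ofTight ((hatAt m r rfl rfl f).app e ≫ h) := sub_tight_cons _ _ _ rfl rfl _ _
      rw [e₄]
      cases g using cases_on with
      | ofLoose gs b g =>
        rw [sub_tight_loose _ _ _ (ofList_append _ _)]
        refine (sub_loose _ _ _ _ _).trans ?_
        refine Eq.trans ?_ (sub_tight_loose _ _ _ (ofList_append _ _) _ _).symm
        exact congrArg ofLoose (key _ _ _ _ _)
      | ofTight a gs b g =>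
        refine (congrArg (fun k => sub _ _ _ _ _ k _)
          (sub_tight_tight _ _ _ (ofList_append _ _) _ _)).trans ?_
        refine (sub_tight_cons _ _ _ (List.cons.inj hhs').2 (List.cons.inj hos).2 _ _).trans ?_
        refine Eq.trans ?_ (sub_tight_tight _ _ _ (ofList_append _ _) _ _).symm
        exact congrArg ofTight (key _ _ _ _ _)

theorem hat_toLoose {as : List C.Obj} {b : C.Obj} (f : C.Multi tight as b) :
    hat (toLoose f) = hat f :=
  match as, f with
  | _ :: _, f => hatLoose_map_lam f

theorem hat_loosen {as : List C.Obj} {b : C.Obj} {y y' : Tightness} (hy : y.le y')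
    (f : C.Multi y as b) :
    hat (Tightness.loosen (S := fun x => C.Multi x as b) toLoose hy f) = hat f := by
  cases y <;> cases y'
  · rfl
  · exact hat_toLoose f
  · exact hy.elim
  · rfl

theorem hatAt_loosen {l r : List C.Obj} {as bs cs : List C.Obj} {b : C.Obj}
    (hb : bs = l ++ b :: r) (hc : cs = l ++ as ++ r) {y y' : Tightness} (hy : y.le y')
    (f : C.Multi y as b) :
    hatAt l r hb hc (Tightness.loosen (S := fun x => C.Multi x as b) toLoose hy f) =
      hatAt l r hb hc f := by
  rw [hatAt, hat_loosen]; rfl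

/-- Loosening `f` does not change `hat f`, which settles every substitution by precomposition into a
map whose type is unchanged. Loosening a tight `g` prefixes a `λ`: past a transformation it moves by
naturality (`map_lam_app_comp`), and in the first variable `subFirst_eq_hatLoose` compares the two
forms of substitution, after loosening `f` if it is tight. -/
theorem loosen_sub (l r : List C.Obj) {x x' y y' z z' : Tightness} {as bs cs : List C.Obj}
    {b c : C.Obj} (hz : z = x.sub l y) (hz' : z' = x'.sub l y') (hbs : bs = l ++ b :: r)
    (hcs : cs = l ++ as ++ r) (hx : x.le x') (hy : y.le y') (hzz : z.le z')
    (g : C.Multi x bs c) (f : C.Multi y as b) :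
    Tightness.loosen (S := fun x => C.Multi x cs c) toLoose hzz (sub l r hz hbs hcs g f) =
      sub l r hz' hbs hcs (Tightness.loosen (S := fun x => C.Multi x bs c) toLoose hx g)
        (Tightness.loosen (S := fun x => C.Multi x as b) toLoose hy f) := by
  cases g using cases_on with
  | ofLoose bs c g =>
    have e₁ : z = loose := hz
    subst e₁
    cases x' with
    | tight => exact hx.elim
    | loose =>
      have e₁ : z' = loose := hz'
      subst e₁
      refine (sub_loose _ _ _ _ _).trans (Eq.trans ?_ (sub_loose _ _ _ _ _).symm)
      rw [hatAt_loosen]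
      rfl
  | ofTight e bs c g =>
    cases l with
    | cons e' l =>
      have e₁ : z = tight := hz
      obtain ⟨rfl, hb'⟩ := List.cons.inj hbs
      subst e₁ hcs
      rw [sub_tight_cons _ _ _ hb' rfl]
      cases x' with
      | tight =>
        have e₁ : z' = tight := hz'
        subst e₁
        refine Eq.trans ?_ (sub_tight_cons _ _ _ hb' rfl _ _).symm
        rw [hatAt_loosen]
        rfl
      | loose =>
        have e₁ : z' = loose := hz'
        subst e₁
        refine Eq.trans ?_ (sub_loose _ _ _ _ _).symm
        rw [hatAt_loosen]
        refine (map_lam_app_comp (hatAt l r hb' rfl f) g (comp_one _).symm (comp_one _).symm).trans ?_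
        refine congrArg (fun t => Hom.app t C.unit ≫ _) ?_
        exact whisk_whisk _ _ _ _ _ _ rfl (comp_one _).symm _
    | nil =>
      obtain ⟨rfl, rfl⟩ := List.cons.inj hbs
      have e₁ : z = y := hz
      subst e₁ hcs
      cases x' with
      | tight =>
        have e₁ : z' = y' := hz'
        subst e₁
        cases f using cases_on with
        | ofLoose as b f =>
          cases z' with
          | tight => exact hy.elim
          | loose => rfl
        | ofTight a as b f =>
          cases z' with
          | tight => rfl
          | loose =>
            rw [sub_tight_tight _ _ _ (ofList_append _ _)]
            refine Eq.trans ?_ (sub_tight_loose _ _ _ (ofList_append _ _) _ _).symm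
            exact map_lam_subFirst _ _ _ _
      | loose =>
        have e₁ : z' = loose := hz'
        subst e₁
        refine Eq.trans ?_ (sub_loose _ _ _ _ _).symm
        rw [hatAt_loosen]
        cases f using cases_on with
        | ofLoose as b f =>
          rw [sub_tight_loose _ _ _ (ofList_append _ _)]
          exact subFirst_eq_hatLoose _ _ _ _ _
        | ofTight a as b f =>
          rw [sub_tight_tight _ _ _ (ofList_append _ _)]
          refine (map_lam_subFirst _ _ _ (ofList_append (a :: as) _)).trans ?_
          refine (subFirst_eq_hatLoose _ _ _ (by rw [one_comp]; exact ofList_append (a :: as) _)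
            (by rw [one_comp])).trans ?_
          refine congrArg (fun t => (whisk _ _ _ _ t).app C.unit ≫ _) ?_
          exact hatLoose_map_lam f

end Multi

/-- The skew multicategory associated to a skew monoidal category. -/
def toMulti (C : SkewMonoidalCat.{v, u}) : SkewMulticategory.{v, u} where
  Obj := C.Obj
  Hom := C.Multi
  isEmpty_nil _ := inferInstanceAs (IsEmpty PEmpty)
  j := Multi.toLoose
  id := Multi.id
  sub := Multi.sub
  id_sub := Multi.id_sub
  sub_id := Multi.sub_id
  assoc := Multi.assoc
  comm := Multi.comm
  loosen_sub := Multi.loosen_sub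

end SkewMonoidalCat

/-! ### Left representability and closedness of the associated skew multicategory -/

namespace SkewMonoidalCat

open ModEnd Multi

variable {C : SkewMonoidalCat.{v, u}}

theorem ModEnd.isIso_app {A B : ModEnd C} (h : A = B) (s : C.Obj) :
    IsIso (Hom.app (eqToHom h) s) := by
  subst h; exact inferInstanceAs (IsIso (𝟙 _))

theorem ModEnd.isIso_map (A : ModEnd C) {a b : C.Obj} (f : a ⟶ b) [IsIso f] : IsIso (A.map f) :=
  ⟨A.map (inv f), by simp [← A.map_comp], by simp [← A.map_comp]⟩

theorem ModEnd.subFirst_bijective {X A B : ModEnd C} (h : X = A.comp B) {s b : C.Obj}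
    (f : A.obj s ⟶ b) [IsIso f] (c : C.Obj) :
    Function.Bijective fun g : B.obj b ⟶ c => subFirst h g f := by
  have h1 := isIso_app h s
  have h2 := B.isIso_map f
  constructor
  · intro g g' e
    simp only [subFirst] at e
    exact (cancel_epi (B.map f)).1 ((cancel_epi _).1 e)
  · intro k
    exact ⟨inv (B.map f) ≫ inv (Hom.app (eqToHom h) s) ≫ k, by simp [subFirst]⟩

/-- The Yoneda argument: surjectivity at `A.obj s` gives a map `k` with `f ≫ k = 𝟙`, and injectivity
at `b` gives the other equation. -/
theorem ModEnd.isIso_of_subFirst_bijective {X A : ModEnd C} (h : X = A.comp (one C)) {s b : C.Obj}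
    (f : A.obj s ⟶ b)
    (H : ∀ c, Function.Bijective fun g : b ⟶ c => subFirst (B := one C) h g f) : IsIso f := by
  have h1 := isIso_app h s
  obtain ⟨k, hk⟩ := (H (A.obj s)).2 (Hom.app (eqToHom h) s)
  have e : f ≫ k = 𝟙 _ := by
    refine (cancel_epi (Hom.app (eqToHom h) s)).1 ?_
    exact hk.trans (Category.comp_id _).symm
  refine ⟨k, e, (H b).1 ?_⟩
  simp only [subFirst]
  rw [reassoc_of% e, Category.comp_id]

theorem bijective_congr {α β : Type*} {f g : α → β} (h : ∀ x, f x = g x)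
    (hf : Function.Bijective f) : Function.Bijective g := by
  rwa [← show f = g from funext h]

/-- The classifiers are the isomorphisms. -/
theorem Multi.isLeftUniversal {x : Tightness} {as : List C.Obj} {m : C.Obj} (θ : C.Multi x as m)
    (h : C.toMulti.IsClassifier (m := m) θ) : C.toMulti.IsLeftUniversal (m := m) θ := by
  cases θ using cases_on with
  | ofTight a as m f =>
    have h1 : IsIso f := isIso_of_subFirst_bijective (comp_one (ofList C as)).symm f fun c =>
      bijective_congr (fun g => sub_tight_tight _ _ _ _ _ _) (h c)
    exact fun r c => subFirst_bijective (ofList_append as r) f c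
  | ofLoose as m f =>
    have h1 : IsIso f := isIso_of_subFirst_bijective (comp_one (ofList C as)).symm f fun c =>
      bijective_congr (fun g => sub_tight_loose _ _ _ _ _ _) (h c)
    exact fun r c => subFirst_bijective (ofList_append as r) f c

theorem Multi.isClassifier_ofTight {a : C.Obj} {as : List C.Obj} {m : C.Obj}
    (f : (ofList C as).obj a ⟶ m) (_ : IsIso f) :
    C.toMulti.IsClassifier (x := tight) (m := m) (as := a :: as) (ofTight f) := fun c =>
  bijective_congr (fun _ => (sub_tight_tight _ _ _ _ _ _).symm)
    (subFirst_bijective (comp_one (ofList C as)).symm f c)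

theorem Multi.isClassifier_ofLoose {as : List C.Obj} {m : C.Obj}
    (f : (ofList C as).obj C.unit ⟶ m) (_ : IsIso f) :
    C.toMulti.IsClassifier (x := loose) (m := m) (as := as) (ofLoose f) := fun c =>
  bijective_congr (fun _ => (sub_tight_loose _ _ _ _ _ _).symm)
    (subFirst_bijective (comp_one (ofList C as)).symm f c)

theorem toMulti_isLeftRepresentable (C : SkewMonoidalCat.{v, u}) :
    SkewMulticategory.isLeftRepresentable C.toMulti := by
  refine ⟨fun x as hx => ?_, fun x as m θ h => isLeftUniversal θ h⟩
  match x, as with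
  | tight, [] => exact absurd rfl (hx rfl)
  | tight, a :: as => exact ⟨(ofList C as).obj a, ofTight (𝟙 _), isClassifier_ofTight _ inferInstance⟩
  | loose, as => exact ⟨(ofList C as).obj C.unit, ofLoose (𝟙 _), isClassifier_ofLoose _ inferInstance⟩

/-- The evident classifiers. -/
def toMultiClassifiers (C : SkewMonoidalCat.{v, u}) : C.toMulti.Classifiers where
  tensor := C.tensorObj
  θ a b := ofTight (as := [b]) (𝟙 (C.tensorObj a b))
  isClassifier_θ a b := isClassifier_ofTight (as := [b]) (𝟙 (C.tensorObj a b))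
    (inferInstanceAs (IsIso (𝟙 (C.tensorObj a b))))
  unit := C.unit
  w := ofLoose (as := []) (𝟙 C.unit)
  isClassifier_w := isClassifier_ofLoose (as := []) (𝟙 C.unit)
    (inferInstanceAs (IsIso (𝟙 C.unit)))

theorem toMulti_isClosed (h : C.isClosed) : SkewMulticategory.isClosed C.toMulti := by
  intro (b : C.Obj) (c : C.Obj)
  have := h b
  let G := (C.tensorRight b).rightAdjoint
  let adj := Adjunction.ofIsLeftAdjoint (C.tensorRight b)
  -- Substitution into the first variable of the counit is transposition along the adjunction with
  -- left adjoint `- ⊗ b`, up to an invertible `eqToHom`. The object `s` is again the first variable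
  -- for tight maps and the unit for loose ones.
  have key : ∀ {X A : ModEnd C} (hX : X = A.comp ((rightTensor C b).comp (one C))) (s : C.Obj),
      Function.Bijective fun f : A.obj s ⟶ G.obj c =>
        subFirst (B := (rightTensor C b).comp (one C)) (c := c) hX (adj.counit.app c) f := by
    intro X A hX s
    have h1 := isIso_app hX s
    have h2 : (fun f : A.obj s ⟶ G.obj c =>
        subFirst (B := (rightTensor C b).comp (one C)) (c := c) hX (adj.counit.app c) f) =
      (fun k => Hom.app (eqToHom hX) s ≫ k) ∘ (adj.homEquiv (A.obj s) c).symm := by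
      funext f
      simp only [Function.comp, Adjunction.homEquiv_counit]
      rfl
    rw [h2]
    refine Function.Bijective.comp ⟨fun _ _ e => (cancel_epi _).1 e, fun k => ?_⟩ (Equiv.bijective _)
    exact ⟨inv (Hom.app (eqToHom hX) s) ≫ k, by simp⟩
  refine ⟨G.obj c, ofTight (as := [b]) (adj.counit.app c), fun x as hx => ?_⟩
  match x, as with
  | tight, [] => exact absurd rfl (hx rfl)
  | tight, a :: as => exact key (ofList_append as [b]) a
  | loose, as => exact key (ofList_append as [b]) C.unit

end SkewMonoidalCat

/-! ### Morphisms of short skew multicategories determined by the images of the classifiers -/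

namespace ShortSkewMulticategory.Classifiers

variable {M N : ShortSkewMulticategory.{v, u}}

/-- The data, on a functor between the underlying categories, determining a morphism out of a left
representable short skew multicategory: the images of the classifiers. -/
structure MorphismData {c : M.Classifiers} (s : c.Structure) (N : ShortSkewMulticategory.{v, u}) where
  F : M.Obj ⥤ N.Obj
  Θ : ∀ a b, N.T₂.Hom (F.obj a) (F.obj b) (F.obj (c.tensor a b))
  W : N.L₀.Hom (F.obj c.unit)
  Θ_naturality : ∀ {a a' b b' : M.Obj} (p : a ⟶ a') (q : b ⟶ b'),
    N.T₂.act (𝟙 _) (𝟙 _) (F.map (s.tensorHom p q)) (Θ a b) =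
      N.T₂.act (F.map p) (F.map q) (𝟙 _) (Θ a' b')
  Θ_α : ∀ a b d : M.Obj,
    N.bb₁ (N.T₂.act (𝟙 _) (𝟙 _) (F.map (s.α a b d)) (Θ (c.tensor a b) d)) (Θ a b) =
      N.bb₂ (Θ a (c.tensor b d)) (Θ b d)
  Θ_lam : ∀ a : M.Obj,
    N.bn₁ (N.T₂.act (𝟙 _) (𝟙 _) (F.map (s.lam a)) (Θ c.unit a)) W = N.j₁ (𝟙 _)
  Θ_ρ : ∀ a : M.Obj, N.bn₂ (Θ a c.unit) W = F.map (M.bn₂ (c.θ a c.unit) c.w)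

theorem T₂_cases (c : M.Classifiers) {a b d : M.Obj} (f : M.T₂.Hom a b d) :
    ∃ k : c.tensor a b ⟶ d, M.T₂.act (𝟙 a) (𝟙 b) k (c.θ a b) = f := ((c.θ_univ a b).unary d).2 f

theorem T₃_cases (c : M.Classifiers) {a b x d : M.Obj} (f : M.T₃.Hom a b x d) :
    ∃ k : M.T₂.Hom (c.tensor a b) x d, M.bb₁ k (c.θ a b) = f := ((c.θ_univ a b).binary x d).2 f

theorem T₄_cases (c : M.Classifiers) {a b x y d : M.Obj} (f : M.T₄.Hom a b x y d) :
    ∃ k : M.T₃.Hom (c.tensor a b) x y d, M.tb₁ k (c.θ a b) = f := ((c.θ_univ a b).ternary x y d).2 f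

theorem L₀_cases (c : M.Classifiers) {d : M.Obj} (f : M.L₀.Hom d) :
    ∃ k : c.unit ⟶ d, M.L₀.act k c.w = f := (c.w_univ.unary d).2 f

theorem L₁_cases (c : M.Classifiers) {x d : M.Obj} (f : M.L₁.Hom x d) :
    ∃ k : M.T₂.Hom c.unit x d, M.bn₁ k c.w = f := (c.w_univ.binary x d).2 f

theorem L₂_cases (c : M.Classifiers) {x y d : M.Obj} (f : M.L₂.Hom x y d) :
    ∃ k : M.T₃.Hom c.unit x y d, M.tn₁ k c.w = f := (c.w_univ.ternary x y d).2 f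

namespace MorphismData

variable {c : M.Classifiers} {s : c.Structure} (t : MorphismData s N)

noncomputable def mapT₂ {a b d : M.Obj} (f : M.T₂.Hom a b d) :
    N.T₂.Hom (t.F.obj a) (t.F.obj b) (t.F.obj d) :=
  N.T₂.act (𝟙 _) (𝟙 _) (t.F.map (c.T₂_cases f).choose) (t.Θ a b)

noncomputable def mapT₃ {a b x d : M.Obj} (f : M.T₃.Hom a b x d) :
    N.T₃.Hom (t.F.obj a) (t.F.obj b) (t.F.obj x) (t.F.obj d) :=
  N.bb₁ (t.mapT₂ (c.T₃_cases f).choose) (t.Θ a b)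

noncomputable def mapT₄ {a b x y d : M.Obj} (f : M.T₄.Hom a b x y d) :
    N.T₄.Hom (t.F.obj a) (t.F.obj b) (t.F.obj x) (t.F.obj y) (t.F.obj d) :=
  N.tb₁ (t.mapT₃ (c.T₄_cases f).choose) (t.Θ a b)

noncomputable def mapL₀ {d : M.Obj} (f : M.L₀.Hom d) : N.L₀.Hom (t.F.obj d) :=
  N.L₀.act (t.F.map (c.L₀_cases f).choose) t.W

noncomputable def mapL₁ {x d : M.Obj} (f : M.L₁.Hom x d) : N.L₁.Hom (t.F.obj x) (t.F.obj d) :=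
  N.bn₁ (t.mapT₂ (c.L₁_cases f).choose) t.W

noncomputable def mapL₂ {x y d : M.Obj} (f : M.L₂.Hom x y d) :
    N.L₂.Hom (t.F.obj x) (t.F.obj y) (t.F.obj d) :=
  N.tn₁ (t.mapT₃ (c.L₂_cases f).choose) t.W

/-- Factorizations through `θ` are unique, so the one chosen in `mapT₂` must be `k`. This lemma and
its analogues in the other arities replace the chosen factorizations from here on. -/
theorem mapT₂_act_θ {a b d : M.Obj} (k : c.tensor a b ⟶ d) :
    t.mapT₂ (M.T₂.act (𝟙 a) (𝟙 b) k (c.θ a b)) = N.T₂.act (𝟙 _) (𝟙 _) (t.F.map k) (t.Θ a b) := by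
  rw [mapT₂, ((c.θ_univ a b).unary d).1 (c.T₂_cases (M.T₂.act (𝟙 a) (𝟙 b) k (c.θ a b))).choose_spec]

theorem mapT₂_θ (a b : M.Obj) : t.mapT₂ (c.θ a b) = t.Θ a b := by
  have := t.mapT₂_act_θ (𝟙 (c.tensor a b))
  rwa [M.T₂.act_id, t.F.map_id, N.T₂.act_id] at this

theorem mapT₃_bb₁_θ {a b x d : M.Obj} (k : M.T₂.Hom (c.tensor a b) x d) :
    t.mapT₃ (M.bb₁ k (c.θ a b)) = N.bb₁ (t.mapT₂ k) (t.Θ a b) := by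
  rw [mapT₃, ((c.θ_univ a b).binary x d).1 (c.T₃_cases (M.bb₁ k (c.θ a b))).choose_spec]

theorem mapT₄_tb₁_θ {a b x y d : M.Obj} (k : M.T₃.Hom (c.tensor a b) x y d) :
    t.mapT₄ (M.tb₁ k (c.θ a b)) = N.tb₁ (t.mapT₃ k) (t.Θ a b) := by
  rw [mapT₄, ((c.θ_univ a b).ternary x y d).1 (c.T₄_cases (M.tb₁ k (c.θ a b))).choose_spec]

theorem mapL₀_act_w {d : M.Obj} (k : c.unit ⟶ d) :
    t.mapL₀ (M.L₀.act k c.w) = N.L₀.act (t.F.map k) t.W := by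
  rw [mapL₀, (c.w_univ.unary d).1 (c.L₀_cases (M.L₀.act k c.w)).choose_spec]

theorem mapL₀_w : t.mapL₀ c.w = t.W := by
  have := t.mapL₀_act_w (𝟙 _)
  rwa [M.L₀.act_id, t.F.map_id, N.L₀.act_id] at this

theorem mapL₁_bn₁_w {x d : M.Obj} (k : M.T₂.Hom c.unit x d) :
    t.mapL₁ (M.bn₁ k c.w) = N.bn₁ (t.mapT₂ k) t.W := by
  rw [mapL₁, (c.w_univ.binary x d).1 (c.L₁_cases (M.bn₁ k c.w)).choose_spec]

theorem mapL₂_tn₁_w {x y d : M.Obj} (k : M.T₃.Hom c.unit x y d) :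
    t.mapL₂ (M.tn₁ k c.w) = N.tn₁ (t.mapT₃ k) t.W := by
  rw [mapL₂, (c.w_univ.ternary x y d).1 (c.L₂_cases (M.tn₁ k c.w)).choose_spec]

/-- Writing `f` as `k` after `θ`, the acted multimap is `tensorHom p q ≫ k ≫ h` after `θ`;
functoriality of `F` and `Θ_naturality` then conclude. Naturality in the other arities reduces to
this case. -/
theorem mapT₂_act {a a' b b' d d' : M.Obj} (p : a' ⟶ a) (q : b' ⟶ b) (h : d ⟶ d')
    (f : M.T₂.Hom a b d) : t.mapT₂ (M.T₂.act p q h f) =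
      N.T₂.act (t.F.map p) (t.F.map q) (t.F.map h) (t.mapT₂ f) := by
  obtain ⟨k, rfl⟩ := c.T₂_cases f
  have h1 := M.T₂.act_comp (𝟙 a) p (𝟙 b) q k h (c.θ a b)
  have h2 := N.T₂.act_comp (𝟙 _) (t.F.map p) (𝟙 _) (t.F.map q) (t.F.map k) (t.F.map h) (t.Θ a b)
  have h3 := N.T₂.act_comp (𝟙 _) (𝟙 _) (𝟙 _) (𝟙 _) (t.F.map (s.tensorHom p q)) (t.F.map (k ≫ h))
    (t.Θ a' b')
  have h4 := N.T₂.act_comp (t.F.map p) (𝟙 _) (t.F.map q) (𝟙 _) (𝟙 _) (t.F.map (k ≫ h)) (t.Θ a b)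
  simp only [Category.comp_id, Category.id_comp] at h1 h2 h3 h4
  rw [← h1, ← s.act_tensorHom, mapT₂_act_θ, mapT₂_act_θ, ← h2, Functor.map_comp, h3, t.Θ_naturality,
    ← h4, Functor.map_comp]

theorem mapT₃_act {a₁ a₁' a₂ a₂' a₃ a₃' d d' : M.Obj} (p₁ : a₁' ⟶ a₁) (p₂ : a₂' ⟶ a₂)
    (p₃ : a₃' ⟶ a₃) (h : d ⟶ d') (f : M.T₃.Hom a₁ a₂ a₃ d) :
    t.mapT₃ (M.T₃.act p₁ p₂ p₃ h f) = N.T₃.act (t.F.map p₁) (t.F.map p₂) (t.F.map p₃) (t.F.map h)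
      (t.mapT₃ f) := by
  obtain ⟨k, rfl⟩ := c.T₃_cases f
  rw [← M.bb₁_nat, ← s.tensorHom_θ, ← M.bb₁_dinat, mapT₃_bb₁_θ, mapT₃_bb₁_θ, ← N.bb₁_nat,
    ← t.Θ_naturality, ← N.bb₁_dinat, mapT₂_act, mapT₂_act]
  simp only [CategoryTheory.Functor.map_id]

theorem mapT₄_act {a₁ a₁' a₂ a₂' a₃ a₃' a₄ a₄' d d' : M.Obj} (p₁ : a₁' ⟶ a₁) (p₂ : a₂' ⟶ a₂)
    (p₃ : a₃' ⟶ a₃) (p₄ : a₄' ⟶ a₄) (h : d ⟶ d') (f : M.T₄.Hom a₁ a₂ a₃ a₄ d) :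
    t.mapT₄ (M.T₄.act p₁ p₂ p₃ p₄ h f) = N.T₄.act (t.F.map p₁) (t.F.map p₂) (t.F.map p₃)
      (t.F.map p₄) (t.F.map h) (t.mapT₄ f) := by
  obtain ⟨k, rfl⟩ := c.T₄_cases f
  rw [← M.tb₁_nat, ← s.tensorHom_θ, ← M.tb₁_dinat, mapT₄_tb₁_θ, mapT₄_tb₁_θ, ← N.tb₁_nat,
    ← t.Θ_naturality, ← N.tb₁_dinat, mapT₃_act, mapT₃_act]
  simp only [CategoryTheory.Functor.map_id]

theorem mapL₀_act {d d' : M.Obj} (h : d ⟶ d') (f : M.L₀.Hom d) :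
    t.mapL₀ (M.L₀.act h f) = N.L₀.act (t.F.map h) (t.mapL₀ f) := by
  obtain ⟨k, rfl⟩ := c.L₀_cases f
  rw [← M.L₀.act_comp, mapL₀_act_w, mapL₀_act_w, Functor.map_comp, N.L₀.act_comp]

theorem mapL₁_act {a a' d d' : M.Obj} (p : a' ⟶ a) (h : d ⟶ d') (f : M.L₁.Hom a d) :
    t.mapL₁ (M.L₁.act p h f) = N.L₁.act (t.F.map p) (t.F.map h) (t.mapL₁ f) := by
  obtain ⟨k, rfl⟩ := c.L₁_cases f
  rw [← M.bn₁_nat, mapL₁_bn₁_w, mapL₁_bn₁_w, ← N.bn₁_nat, mapT₂_act, t.F.map_id]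

theorem mapL₂_act {a a' b b' d d' : M.Obj} (p : a' ⟶ a) (q : b' ⟶ b) (h : d ⟶ d')
    (f : M.L₂.Hom a b d) :
    t.mapL₂ (M.L₂.act p q h f) = N.L₂.act (t.F.map p) (t.F.map q) (t.F.map h) (t.mapL₂ f) := by
  obtain ⟨k, rfl⟩ := c.L₂_cases f
  rw [← M.tn₁_nat, mapL₂_tn₁_w, mapL₂_tn₁_w, ← N.tn₁_nat, mapT₃_act, t.F.map_id]

theorem map_bb₁ {a₁ a₂ b₁ b₂ d : M.Obj} (g : M.T₂.Hom b₁ b₂ d) (f : M.T₂.Hom a₁ a₂ b₁) :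
    t.mapT₃ (M.bb₁ g f) = N.bb₁ (t.mapT₂ g) (t.mapT₂ f) := by
  obtain ⟨k, rfl⟩ := c.T₂_cases f
  rw [← M.bb₁_dinat, mapT₃_bb₁_θ, mapT₂_act_θ, ← N.bb₁_dinat, mapT₂_act]
  simp only [CategoryTheory.Functor.map_id]

theorem map_tb₁ {a₁ a₂ b₁ b₂ b₃ d : M.Obj} (g : M.T₃.Hom b₁ b₂ b₃ d) (f : M.T₂.Hom a₁ a₂ b₁) :
    t.mapT₄ (M.tb₁ g f) = N.tb₁ (t.mapT₃ g) (t.mapT₂ f) := by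
  obtain ⟨k, rfl⟩ := c.T₂_cases f
  rw [← M.tb₁_dinat, mapT₄_tb₁_θ, mapT₂_act_θ, ← N.tb₁_dinat, mapT₃_act]
  simp only [CategoryTheory.Functor.map_id]

/-- One argument is factored through a classifier, an axiom rewrites the substitution into ones
already known to be preserved, and the same axiom is applied backwards in `N`. Most of the
substitutions below follow this pattern. -/
theorem map_bt₁ {a₁ a₂ a₃ b₁ b₂ d : M.Obj} (g : M.T₂.Hom b₁ b₂ d) (f : M.T₃.Hom a₁ a₂ a₃ b₁) :
    t.mapT₄ (M.bt₁ g f) = N.bt₁ (t.mapT₂ g) (t.mapT₃ f) := by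
  obtain ⟨k, rfl⟩ := c.T₃_cases f
  rw [M.assoc_b₁₁, map_tb₁, map_bb₁, map_bb₁, N.assoc_b₁₁]

/-- The universal instance of substitution into the second variable. The defining equation of `α`
turns it into one in the first variable, where `Θ_α` applies. -/
theorem map_bb₂_θ_θ (a b d : M.Obj) : t.mapT₃ (M.bb₂ (c.θ a (c.tensor b d)) (c.θ b d)) =
    N.bb₂ (t.Θ a (c.tensor b d)) (t.Θ b d) := by
  rw [← s.act_α₀, mapT₃_bb₁_θ, mapT₂_act_θ, t.Θ_α]

/-- Factor `f` through `θ` and absorb the remaining unary map into `g` by dinaturality; then factor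
the new `g` through `θ`. Naturality leaves only the universal instance `map_bb₂_θ_θ`. -/
theorem map_bb₂ {a₁ a₂ b₁ b₂ d : M.Obj} (g : M.T₂.Hom b₁ b₂ d) (f : M.T₂.Hom a₁ a₂ b₂) :
    t.mapT₃ (M.bb₂ g f) = N.bb₂ (t.mapT₂ g) (t.mapT₂ f) := by
  obtain ⟨k, rfl⟩ := c.T₂_cases f
  rw [← M.bb₂_dinat, mapT₂_act_θ, ← N.bb₂_dinat]
  have e : N.T₂.act (𝟙 _) (t.F.map k) (𝟙 _) (t.mapT₂ g) = t.mapT₂ (M.T₂.act (𝟙 _) k (𝟙 _) g) := by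
    rw [mapT₂_act]; simp only [CategoryTheory.Functor.map_id]
  rw [e]
  obtain ⟨l, hl⟩ := c.T₂_cases (M.T₂.act (𝟙 _) k (𝟙 _) g)
  have h1 := M.bb₂_nat (𝟙 _) (𝟙 _) (𝟙 _) l (c.θ b₁ (c.tensor a₁ a₂)) (c.θ a₁ a₂)
  have h2 := N.bb₂_nat (𝟙 _) (𝟙 _) (𝟙 _) (t.F.map l) (t.Θ b₁ (c.tensor a₁ a₂)) (t.Θ a₁ a₂)
  rw [M.T₂.act_id] at h1
  rw [N.T₂.act_id] at h2
  rw [← hl, h1, mapT₃_act, map_bb₂_θ_θ, mapT₂_act_θ, h2]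
  simp only [CategoryTheory.Functor.map_id]

theorem map_tb₂ {a₁ a₂ b₁ b₂ b₃ d : M.Obj} (g : M.T₃.Hom b₁ b₂ b₃ d) (f : M.T₂.Hom a₁ a₂ b₂) :
    t.mapT₄ (M.tb₂ g f) = N.tb₂ (t.mapT₃ g) (t.mapT₂ f) := by
  obtain ⟨k, rfl⟩ := c.T₃_cases g
  rw [← M.assoc_b₁₂, map_bt₁, map_bb₂, map_bb₁, N.assoc_b₁₂]

theorem map_tb₃ {a₁ a₂ b₁ b₂ b₃ d : M.Obj} (g : M.T₃.Hom b₁ b₂ b₃ d) (f : M.T₂.Hom a₁ a₂ b₃) :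
    t.mapT₄ (M.tb₃ g f) = N.tb₃ (t.mapT₃ g) (t.mapT₂ f) := by
  obtain ⟨k, rfl⟩ := c.T₃_cases g
  rw [M.comm_bb, map_tb₁, map_bb₂, map_bb₁, N.comm_bb]

theorem map_bt₂ {a₁ a₂ a₃ b₁ b₂ d : M.Obj} (g : M.T₂.Hom b₁ b₂ d) (f : M.T₃.Hom a₁ a₂ a₃ b₂) :
    t.mapT₄ (M.bt₂ g f) = N.bt₂ (t.mapT₂ g) (t.mapT₃ f) := by
  obtain ⟨k, rfl⟩ := c.T₃_cases f
  rw [M.assoc_b₂₁, map_tb₂, map_bb₂, map_bb₁, N.assoc_b₂₁]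

theorem map_bn₁ {b₁ b₂ d : M.Obj} (g : M.T₂.Hom b₁ b₂ d) (f : M.L₀.Hom b₁) :
    t.mapL₁ (M.bn₁ g f) = N.bn₁ (t.mapT₂ g) (t.mapL₀ f) := by
  obtain ⟨k, rfl⟩ := c.L₀_cases f
  rw [← M.bn₁_dinat, mapL₁_bn₁_w, mapL₀_act_w, ← N.bn₁_dinat, mapT₂_act]
  simp only [CategoryTheory.Functor.map_id]

theorem map_tn₁ {b₁ b₂ b₃ d : M.Obj} (g : M.T₃.Hom b₁ b₂ b₃ d) (f : M.L₀.Hom b₁) :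
    t.mapL₂ (M.tn₁ g f) = N.tn₁ (t.mapT₃ g) (t.mapL₀ f) := by
  obtain ⟨k, rfl⟩ := c.L₀_cases f
  rw [← M.tn₁_dinat, mapL₂_tn₁_w, mapL₀_act_w, ← N.tn₁_dinat, mapT₃_act]
  simp only [CategoryTheory.Functor.map_id]

/-- The same reduction as for `map_bb₂`; the universal instance is now the definition of `ρ`, whose
preservation is `Θ_ρ`. -/
theorem map_bn₂ {b₁ b₂ d : M.Obj} (g : M.T₂.Hom b₁ b₂ d) (f : M.L₀.Hom b₂) :
    t.F.map (M.bn₂ g f) = N.bn₂ (t.mapT₂ g) (t.mapL₀ f) := by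
  obtain ⟨k, rfl⟩ := c.L₀_cases f
  rw [← M.bn₂_dinat, mapL₀_act_w, ← N.bn₂_dinat]
  have e : N.T₂.act (𝟙 _) (t.F.map k) (𝟙 _) (t.mapT₂ g) = t.mapT₂ (M.T₂.act (𝟙 _) k (𝟙 _) g) := by
    rw [mapT₂_act]; simp only [CategoryTheory.Functor.map_id]
  rw [e]
  obtain ⟨l, hl⟩ := c.T₂_cases (M.T₂.act (𝟙 _) k (𝟙 _) g)
  rw [← hl, mapT₂_act_θ, M.bn₂_post, N.bn₂_post, Functor.map_comp, t.Θ_ρ]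

theorem map_tn₂ {b₁ b₂ b₃ d : M.Obj} (g : M.T₃.Hom b₁ b₂ b₃ d) (f : M.L₀.Hom b₂) :
    t.mapT₂ (M.tn₂ g f) = N.tn₂ (t.mapT₃ g) (t.mapL₀ f) := by
  obtain ⟨k, rfl⟩ := c.T₃_cases g
  rw [← M.assoc_n₁₂, map_bb₁, ← N.assoc_n₁₂, mapT₂_act, map_bn₂]
  simp only [CategoryTheory.Functor.map_id]

theorem map_tn₃ {b₁ b₂ b₃ d : M.Obj} (g : M.T₃.Hom b₁ b₂ b₃ d) (f : M.L₀.Hom b₃) :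
    t.mapT₂ (M.tn₃ g f) = N.tn₃ (t.mapT₃ g) (t.mapL₀ f) := by
  obtain ⟨k, rfl⟩ := c.T₃_cases g
  rw [M.comm_bn, map_bb₁, N.comm_bn, mapT₂_act, map_bn₂]
  simp only [CategoryTheory.Functor.map_id]

theorem map_un {b d : M.Obj} (g : M.L₁.Hom b d) (f : M.L₀.Hom b) :
    t.mapL₀ (M.un g f) = N.un (t.mapL₁ g) (t.mapL₀ f) := by
  obtain ⟨k, rfl⟩ := c.L₁_cases g
  rw [M.comm_nn, mapL₀_act, map_bn₂, map_bn₁, N.comm_nn]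

theorem map_bu₁ {a b₁ b₂ d : M.Obj} (g : M.T₂.Hom b₁ b₂ d) (f : M.L₁.Hom a b₁) :
    t.mapL₂ (M.bu₁ g f) = N.bu₁ (t.mapT₂ g) (t.mapL₁ f) := by
  obtain ⟨k, rfl⟩ := c.L₁_cases f
  rw [M.assoc_n₁₁, map_tn₁, map_bb₁, map_bn₁, N.assoc_n₁₁]

theorem map_bu₂ {a b₁ b₂ d : M.Obj} (g : M.T₂.Hom b₁ b₂ d) (f : M.L₁.Hom a b₂) :
    t.mapT₂ (M.bu₂ g f) = N.bu₂ (t.mapT₂ g) (t.mapL₁ f) := by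
  obtain ⟨k, rfl⟩ := c.L₁_cases f
  rw [M.assoc_n₂₁, map_tn₂, map_bb₂, map_bn₁, N.assoc_n₂₁]

theorem map_ub {a₁ a₂ b d : M.Obj} (g : M.L₁.Hom b d) (f : M.T₂.Hom a₁ a₂ b) :
    t.mapL₂ (M.ub g f) = N.ub (t.mapL₁ g) (t.mapT₂ f) := by
  obtain ⟨k, rfl⟩ := c.L₁_cases g
  rw [M.comm_nb, map_tn₁, map_bb₂, map_bn₁, N.comm_nb]

/-- By naturality `j₁ f` is `j₁ (𝟙 a)` followed by `f`, and `j₁ (𝟙 a)` is expressed through `λ`, `θ`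
and `u` by the defining equation of `λ`. So `Θ_lam` is exactly what is needed. -/
theorem map_j₁ {a d : M.Obj} (f : a ⟶ d) : t.mapL₁ (M.j₁ f) = N.j₁ (t.F.map f) := by
  have h1 := M.j₁_nat (𝟙 _) f (𝟙 _)
  have h2 := N.j₁_nat (𝟙 _) (t.F.map f) (𝟙 _)
  simp only [Category.id_comp] at h1 h2
  rw [h1, mapL₁_act, ← s.lam_θ, map_bn₁, mapT₂_act_θ, mapL₀_w, t.Θ_lam, t.F.map_id, ← h2]

/-- `j₂ f` is the substitution of `f` into the loose unary map `j₁ (𝟙 d)`, and both ingredients are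
already preserved. -/
theorem map_j₂ {a₁ a₂ d : M.Obj} (f : M.T₂.Hom a₁ a₂ d) : t.mapL₂ (M.j₂ f) = N.j₂ (t.mapT₂ f) := by
  have h1 := M.ub_j (𝟙 _) f
  have h2 := N.ub_j (𝟙 _) (t.mapT₂ f)
  rw [M.T₂.act_id] at h1
  rw [N.T₂.act_id] at h2
  rw [← h1, map_ub, map_j₁, t.F.map_id, h2]

/-- The morphism determined by the images of the classifiers. -/
noncomputable def toMorphism : ShortSkewMultifunctor M N where
  toFunctor := t.F
  mapT₂ := t.mapT₂
  mapT₃ := t.mapT₃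
  mapT₄ := t.mapT₄
  mapL₀ := t.mapL₀
  mapL₁ := t.mapL₁
  mapL₂ := t.mapL₂
  mapT₂_nat := t.mapT₂_act
  mapT₃_nat := t.mapT₃_act
  mapT₄_nat := t.mapT₄_act
  mapL₀_nat := t.mapL₀_act
  mapL₁_nat := t.mapL₁_act
  mapL₂_nat := t.mapL₂_act
  map_j₁ := t.map_j₁
  map_j₂ := t.map_j₂
  map_bb₁ := t.map_bb₁
  map_bb₂ := t.map_bb₂
  map_tb₁ := t.map_tb₁
  map_tb₂ := t.map_tb₂
  map_tb₃ := t.map_tb₃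
  map_bt₁ := t.map_bt₁
  map_bt₂ := t.map_bt₂
  map_bn₁ := t.map_bn₁
  map_bn₂ := t.map_bn₂
  map_tn₁ := t.map_tn₁
  map_tn₂ := t.map_tn₂
  map_tn₃ := t.map_tn₃
  map_un := t.map_un
  map_bu₁ := t.map_bu₁
  map_bu₂ := t.map_bu₂
  map_ub := t.map_ub

/-- The images of the classifiers under a morphism. -/
def ofMorphism (s : c.Structure) (G : ShortSkewMultifunctor M N) : MorphismData s N where
  F := G.toFunctor
  Θ a b := G.mapT₂ (c.θ a b)
  W := G.mapL₀ c.w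
  Θ_naturality p q := by
    rw [MapStructure.map_act, s.tensorHom_θ, G.mapT₂_nat, G.toFunctor.map_id]
  Θ_α a b d := by rw [MapStructure.map_act, ← G.map_bb₁, ← G.map_bb₂, s.act_α₀]
  Θ_lam a := by rw [MapStructure.map_act, ← G.map_bn₁, s.lam_θ, G.map_j₁, G.toFunctor.map_id]
  Θ_ρ a := (G.map_bn₂ _ _).symm

/-- Every multimap factors through a classifier, where the two morphisms agree; the arities are
treated in the order in which their factorizations refer to one another. -/
theorem toMorphism_ofMorphism (s : c.Structure) (G : ShortSkewMultifunctor M N) :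
    (ofMorphism s G).toMorphism = G := by
  have h2 : ∀ {a b d : M.Obj} (f : M.T₂.Hom a b d), (ofMorphism s G).mapT₂ f = G.mapT₂ f := by
    intro a b d f
    obtain ⟨k, rfl⟩ := c.T₂_cases f
    rw [mapT₂_act_θ]
    exact MapStructure.map_act G k (c.θ a b)
  have h3 : ∀ {a b x d : M.Obj} (f : M.T₃.Hom a b x d), (ofMorphism s G).mapT₃ f = G.mapT₃ f := by
    intro a b x d f
    obtain ⟨k, rfl⟩ := c.T₃_cases f
    rw [mapT₃_bb₁_θ, h2, G.map_bb₁]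
    rfl
  have h4 : ∀ {a b x y d : M.Obj} (f : M.T₄.Hom a b x y d),
      (ofMorphism s G).mapT₄ f = G.mapT₄ f := by
    intro a b x y d f
    obtain ⟨k, rfl⟩ := c.T₄_cases f
    rw [mapT₄_tb₁_θ, h3, G.map_tb₁]
    rfl
  have l0 : ∀ {d : M.Obj} (f : M.L₀.Hom d), (ofMorphism s G).mapL₀ f = G.mapL₀ f := by
    intro d f
    obtain ⟨k, rfl⟩ := c.L₀_cases f
    rw [mapL₀_act_w, G.mapL₀_nat]
    rfl
  have l1 : ∀ {a d : M.Obj} (f : M.L₁.Hom a d), (ofMorphism s G).mapL₁ f = G.mapL₁ f := by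
    intro a d f
    obtain ⟨k, rfl⟩ := c.L₁_cases f
    rw [mapL₁_bn₁_w, G.map_bn₁, h2]
    rfl
  have l2 : ∀ {a b d : M.Obj} (f : M.L₂.Hom a b d), (ofMorphism s G).mapL₂ f = G.mapL₂ f := by
    intro a b d f
    obtain ⟨k, rfl⟩ := c.L₂_cases f
    rw [mapL₂_tn₁_w, G.map_tn₁, h3]
    rfl
  refine ShortSkewMultifunctor.ext rfl (heq_of_eq ?_) (heq_of_eq ?_) (heq_of_eq ?_) (heq_of_eq ?_)
    (heq_of_eq ?_) (heq_of_eq ?_)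
  · funext a b d f; exact h2 f
  · funext a b x d f; exact h3 f
  · funext a b x y d f; exact h4 f
  · funext d f; exact l0 f
  · funext a d f; exact l1 f
  · funext a b d f; exact l2 f

variable {c' : N.Classifiers} {s' : c'.Structure}

/-- The images of the classifiers given by a functor with the structure of a lax monoidal
functor. -/
def ofFunctor (s' : c'.Structure) (F : M.Obj ⥤ N.Obj) (f₀ : c'.unit ⟶ F.obj c.unit)
    (f₂ : ∀ a b, c'.tensor (F.obj a) (F.obj b) ⟶ F.obj (c.tensor a b))
    (nat : ∀ {a a' b b' : M.Obj} (p : a ⟶ a') (q : b ⟶ b'),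
      s'.tensorHom (F.map p) (F.map q) ≫ f₂ a' b' = f₂ a b ≫ F.map (s.tensorHom p q))
    (hα : ∀ a b d : M.Obj,
      s'.tensorHom (f₂ a b) (𝟙 (F.obj d)) ≫ f₂ (c.tensor a b) d ≫ F.map (s.α a b d) =
        s'.α (F.obj a) (F.obj b) (F.obj d) ≫ s'.tensorHom (𝟙 (F.obj a)) (f₂ b d) ≫
          f₂ a (c.tensor b d))
    (hlam : ∀ a : M.Obj,
      s'.tensorHom f₀ (𝟙 (F.obj a)) ≫ f₂ c.unit a ≫ F.map (s.lam a) = s'.lam (F.obj a))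
    (hρ : ∀ a : M.Obj, N.bn₂ (c'.θ (F.obj a) c'.unit) c'.w ≫
      s'.tensorHom (𝟙 (F.obj a)) f₀ ≫ f₂ a c.unit = F.map (M.bn₂ (c.θ a c.unit) c.w)) :
    MorphismData s N where
  F := F
  Θ a b := N.T₂.act (𝟙 (F.obj a)) (𝟙 (F.obj b)) (f₂ a b) (c'.θ _ _)
  W := N.L₀.act f₀ c'.w
  Θ_naturality {a a' b b'} p q := by
    have h1 := N.T₂.act_comp (𝟙 (F.obj a)) (𝟙 _) (𝟙 (F.obj b)) (𝟙 _)
      (f₂ a b) (F.map (s.tensorHom p q)) (c'.θ _ _)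
    have h2 := N.T₂.act_comp (𝟙 _) (F.map p) (𝟙 _) (F.map q) (f₂ a' b') (𝟙 _) (c'.θ _ _)
    simp only [Category.comp_id] at h1 h2
    rw [← h1, ← nat, s'.act_tensorHom, h2]
  Θ_α a b d := by
    have h1 := N.T₂.act_comp (𝟙 (F.obj (c.tensor a b))) (𝟙 _) (𝟙 (F.obj d)) (𝟙 _)
      (f₂ (c.tensor a b) d) (F.map (s.α a b d)) (c'.θ _ _)
    simp only [Category.comp_id] at h1
    rw [← h1, ← N.bb₁_dinat, ← N.bb₂_dinat, ← N.T₂.act_comp, ← N.T₂.act_comp]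
    simp only [Category.comp_id, Category.id_comp]
    rw [← s'.act_tensorHom (f₂ a b), ← s'.act_tensorHom (𝟙 _) (f₂ b d), ← s'.act_α, hα]
  Θ_lam a := by
    have h1 := N.T₂.act_comp (𝟙 (F.obj c.unit)) (𝟙 _) (𝟙 (F.obj a)) (𝟙 _)
      (f₂ c.unit a) (F.map (s.lam a)) (c'.θ _ _)
    simp only [Category.comp_id] at h1
    rw [← h1, ← N.bn₁_dinat, ← N.T₂.act_comp]
    simp only [Category.comp_id, Category.id_comp]
    rw [← s'.lam_θ, ← s'.act_tensorHom, hlam]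
  Θ_ρ a := by
    rw [← N.bn₂_dinat, ← N.T₂.act_comp]
    simp only [Category.comp_id, Category.id_comp]
    rw [← s'.act_tensorHom, N.bn₂_post, hρ]

/-- The images of the classifiers given by a lax monoidal functor. -/
def ofLax (L : LaxSkewMonoidalFunctor s.toSkewMonoidal s'.toSkewMonoidal) : MorphismData s N :=
  ofFunctor s' L.toFunctor L.f₀ L.f₂ L.f₂_naturality L.f₂_α L.f₂_lam L.f₂_ρ

end MorphismData

variable {c : M.Classifiers} {c' : N.Classifiers}

open MorphismData

/-- The components of `L` satisfy the universal properties characterising the structural maps of the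
morphism built from `L`, so uniqueness of those maps identifies them with `t`. -/
theorem toLax_toMorphism (s : c.Structure) (s' : c'.Structure)
    (L : LaxSkewMonoidalFunctor s.toSkewMonoidal s'.toSkewMonoidal)
    (t : MapStructure c c' (ofLax L).toMorphism) : t.toLax s s' = L := by
  have h : t = ⟨L.f₀, (mapL₀_w (ofLax L)).symm, L.f₂, fun a b => (mapT₂_θ (ofLax L) a b).symm⟩ :=
    MapStructure.unique _ _
  rw [h]
  rfl

theorem toMorphism_toLax (s : c.Structure) (s' : c'.Structure) (G : ShortSkewMultifunctor M N)
    (t : MapStructure c c' G) : (ofLax (t.toLax s s')).toMorphism = G := by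
  refine Eq.trans ?_ (toMorphism_ofMorphism s G)
  refine congrArg toMorphism ?_
  have h1 : N.L₀.act t.f₀ c'.w = G.mapL₀ c.w := t.f₀_w
  have h2 : (fun a b => N.T₂.act (𝟙 (G.toFunctor.obj a)) (𝟙 (G.toFunctor.obj b)) (t.f₂ a b)
      (c'.θ _ _)) = fun a b => G.mapT₂ (c.θ a b) := by
    funext a b; exact t.f₂_θ a b
  -- The functor on both sides is the same, so the data can differ only in `W` and `Θ`, which `h1`
  -- and `h2` compare.
  unfold ofLax ofFunctor ofMorphism
  congr

end ShortSkewMulticategory.Classifiers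

/-! ### Independence of the choices, and closedness of the resulting skew monoidal category -/

namespace ShortSkewMulticategory.Classifiers

variable {M : ShortSkewMulticategory.{v, u}}

/-- Different choices of classifiers and of structural maps give isomorphic skew monoidal
categories. -/
noncomputable def structureIso {c c' : M.Classifiers} (s : c.Structure) (s' : c'.Structure) :
    s.toSkewMonoidal ≅ s'.toSkewMonoidal where
  hom := (c.mapStructure c' (.id M)).toLax s s'
  inv := (c'.mapStructure c (.id M)).toLax s' s
  -- The composite carries structural maps over the identity morphism, and so does the identity;
  -- these maps are unique.
  hom_inv_id := congrArg (MapStructure.toLax · s s)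
    (((c.mapStructure c' (.id M)).comp (c'.mapStructure c (.id M))).unique (.id c))
  inv_hom_id := congrArg (MapStructure.toLax · s' s')
    (((c'.mapStructure c (.id M)).comp (c.mapStructure c' (.id M))).unique (.id c'))

/-- The maps `ab ⟶ d` correspond to binary multimaps `a, b → d` by the universal property of `θ`,
and these to maps `a ⟶ [b, d]` by closedness. The resulting bijection is natural in `a`, which
suffices for a right adjoint. -/
theorem isClosed_toSkewMonoidal {c : M.Classifiers} (s : c.Structure) (h : M.isClosed) :
    s.toSkewMonoidal.isClosed := by
  intro (b : M.Obj)
  choose k e he using h b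
  let eq (a d : M.Obj) : (c.tensor a b ⟶ d) ≃ (a ⟶ k d) :=
    (Equiv.ofBijective _ ((c.θ_univ a b).unary d)).trans (Equiv.ofBijective _ ((he d).1 a)).symm
  have heq : ∀ {a d : M.Obj} (f : c.tensor a b ⟶ d),
      M.T₂.act (eq a d f) (𝟙 b) (𝟙 d) (e d) = M.T₂.act (𝟙 a) (𝟙 b) f (c.θ a b) := fun {a d} f =>
    (Equiv.ofBijective _ ((he d).1 a)).apply_symm_apply _
  have nat : ∀ {a a' d : M.Obj} (p : a' ⟶ a) (f : c.tensor a b ⟶ d),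
      eq a' d (s.tensorHom p (𝟙 b) ≫ f) = p ≫ eq a d f := by
    intro a a' d p f
    refine ((he d).1 a').1 ?_
    have h1 := M.T₂.act_comp (eq a d f) p (𝟙 b) (𝟙 b) (𝟙 d) (𝟙 d) (e d)
    have h2 := M.T₂.act_comp (𝟙 a) p (𝟙 b) (𝟙 b) f (𝟙 d) (c.θ a b)
    simp only [Category.comp_id] at h1 h2
    exact (heq _).trans ((s.act_tensorHom p (𝟙 b) f).trans (h2.trans
      ((congrArg _ (heq f).symm).trans h1.symm)))
  exact ⟨_, ⟨Adjunction.adjunctionOfEquivRight (F := s.toSkewMonoidal.tensorRight b)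
    (fun a d => eq a d) fun a' a d p f => nat p f⟩⟩

end ShortSkewMulticategory.Classifiers

/-! ### Recovering a skew monoidal category from its skew multicategory -/

namespace SkewMonoidalCat

open ModEnd Multi ShortSkewMulticategory.Classifiers

/-- For explicit lists the objects on both sides are definitionally equal, so `e` can be taken to be
`rfl` and the `eqToHom` becomes an identity. The formulas below, with the analogous `whisk_app`, are
obtained in this way. -/
theorem ModEnd.subFirst_eq {C : SkewMonoidalCat.{v, u}} {X A B : ModEnd C} (h : X = A.comp B)
    {s b c : C.Obj} (g : B.obj b ⟶ c) (f : A.obj s ⟶ b) (e : X.obj s = B.obj (A.obj s)) :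
    subFirst h g f = eqToHom e ≫ B.map f ≫ g := by
  rw [subFirst, eqToHom_app]

theorem ModEnd.whisk_app {C : SkewMonoidalCat.{v, u}} {L P A B X Y : ModEnd C}
    (hX : X = (L.comp A).comp P) (hY : Y = (L.comp B).comp P) (t : A ⟶ B) (s : C.Obj)
    (e : X.obj s = P.obj (A.obj (L.obj s))) (e' : P.obj (B.obj (L.obj s)) = Y.obj s) :
    (whisk L P hX hY t).app s = eqToHom e ≫ P.map (t.app (L.obj s)) ≫ eqToHom e' := by
  rw [whisk, comp_app, comp_app, eqToHom_app, eqToHom_app]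

variable (C : SkewMonoidalCat.{v, u})

theorem toMulti_comp {a b c : C.Obj} (f : a ⟶ b) (g : b ⟶ c) :
    CategoryStruct.comp (obj := C.toMulti.Obj) (X := a) (Y := b) (Z := c) f g = f ≫ g :=
  (subFirst_eq (X := one C) (A := one C) (B := one C) _ g f rfl).trans (Category.id_comp _)

theorem toMulti_post₂ {a b c d : C.Obj} (h : c ⟶ d) (f : C.tensorObj a b ⟶ c) :
    SkewMulticategory.post (M := C.toMulti) (x := tight) (as := [a, b]) (b := c) (c := d) h f =
      f ≫ h :=
  (subFirst_eq (X := ofList C [b]) (A := ofList C [b]) (B := one C) (s := a) _ h f rfl).trans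
    (Category.id_comp _)

theorem toMulti_pre₂₁ {a a' b c : C.Obj} (p : a' ⟶ a) (f : C.tensorObj a b ⟶ c) :
    SkewMulticategory.pre (M := C.toMulti) (x := tight) [] [b] (bs := [a, b]) (bs' := [a', b])
        (b := a) rfl rfl f p = C.tensorHom p (𝟙 b) ≫ f :=
  (subFirst_eq (X := ofList C [b]) (A := one C) (B := ofList C [b]) (s := a') _ f p rfl).trans
    (Category.id_comp _)

theorem toMulti_pre₂₂ {a b b' c : C.Obj} (q : b' ⟶ b) (f : C.tensorObj a b ⟶ c) :
    SkewMulticategory.pre (M := C.toMulti) (x := tight) [a] [] (bs := [a, b]) (bs' := [a, b'])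
        (b := b) rfl rfl f q = C.tensorHom (𝟙 a) q ≫ f := by
  refine (congrArg (· ≫ f) (whisk_app (X := ofList C [b']) (L := one C) (P := one C)
    (A := ofList C [b'])
    (B := rightTensor C b) (Y := ofList C [b]) _ _ _ _ rfl rfl)).trans ?_
  exact ((congrArg (· ≫ f) ((Category.id_comp _).trans ((Category.comp_id _).trans (Category.id_comp _)))))

theorem toMulti_act₂ {a a' b b' c d : C.Obj} (p : a' ⟶ a) (q : b' ⟶ b) (h : c ⟶ d)
    (f : C.tensorObj a b ⟶ c) :
    C.toMulti.toShort.T₂.act (a₁ := a) (a₁' := a') (a₂ := b) (a₂' := b') (c := c) (c' := d) p q h f =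
      C.tensorHom p q ≫ f ≫ h := by
  refine (congrArg (SkewMulticategory.post (M := C.toMulti) (b := c) (c := d) h)
    ((congrArg (SkewMulticategory.pre (M := C.toMulti) (b := b) [a'] [] rfl rfl · q)
      (C.toMulti_pre₂₁ p f)).trans (C.toMulti_pre₂₂ q _))).trans ?_
  refine (C.toMulti_post₂ h (C.tensorHom (𝟙 a') q ≫ C.tensorHom p (𝟙 b) ≫ f)).trans ?_
  rw [Category.assoc, Category.assoc, ← Category.assoc, ← C.tensorHom_comp, Category.id_comp,
    Category.comp_id]

theorem toMulti_bb₁ {a b b' c d : C.Obj} (g : C.tensorObj b b' ⟶ d) (f : C.tensorObj a c ⟶ b) :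
    C.toMulti.toShort.bb₁ (a₁ := a) (a₂ := c) (b₁ := b) (b₂ := b') (c := d) g f =
      C.tensorHom f (𝟙 b') ≫ g :=
  (subFirst_eq (X := ofList C [c, b']) (A := ofList C [c]) (B := ofList C [b']) (s := a) _ g f
    rfl).trans (Category.id_comp _)

theorem toMulti_bn₁ {b b' d : C.Obj} (g : C.tensorObj b b' ⟶ d) (f : C.unit ⟶ b) :
    C.toMulti.toShort.bn₁ (b₁ := b) (b₂ := b') (c := d) g f = C.tensorHom f (𝟙 b') ≫ g :=
  (subFirst_eq (X := ofList C [b']) (A := one C) (B := ofList C [b']) (s := C.unit) _ g f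
    rfl).trans (Category.id_comp _)

/-- The `α` is the strength of `- ⊗ c`, which enters through `hatTight`. In the nullary analogue
below, `ρ` enters through `hatLoose`. -/
theorem toMulti_bb₂ {a b b' c d : C.Obj} (g : C.tensorObj b b' ⟶ d) (f : C.tensorObj a c ⟶ b') :
    C.toMulti.toShort.bb₂ (a₁ := a) (a₂ := c) (b₁ := b) (b₂ := b') (c := d) g f =
      C.α b a c ≫ C.tensorHom (𝟙 b) f ≫ g := by
  refine (congrArg (· ≫ g) (whisk_app (X := ofList C [a, c]) (L := one C) (P := one C)
    (A := ofList C [a, c]) (B := rightTensor C b') (Y := ofList C [b']) _ _ _ _ rfl rfl)).trans ?_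
  exact (congrArg (· ≫ g) ((Category.id_comp _).trans ((Category.comp_id _).trans
    (congrArg (· ≫ C.tensorHom (𝟙 b) f) (Category.comp_id _))))).trans (Category.assoc _ _ _)

theorem toMulti_bn₂ {b b' d : C.Obj} (g : C.tensorObj b b' ⟶ d) (f : C.unit ⟶ b') :
    C.toMulti.toShort.bn₂ (b₁ := b) (b₂ := b') (c := d) g f =
      C.ρ b ≫ C.tensorHom (𝟙 b) f ≫ g := by
  refine (congrArg (· ≫ g) (whisk_app (X := one C) (L := one C) (P := one C)
    (A := one C) (B := rightTensor C b') (Y := ofList C [b']) _ _ _ _ rfl rfl)).trans ?_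
  exact (congrArg (· ≫ g) ((Category.id_comp _).trans ((Category.comp_id _).trans
    (congrArg (C.ρ b ≫ ·) (Category.id_comp _))))).trans (Category.assoc _ _ _)

theorem tensorHom_id_comp {a b c : C.Obj} (f : C.tensorObj a b ⟶ c) :
    C.tensorHom (𝟙 a) (𝟙 b) ≫ f = f := by
  rw [C.tensorHom_id, Category.id_comp]

/-- The structure given by that of `C`. -/
def toMultiStructure : (C.toMultiClassifiers.toShort C.toMulti_isLeftRepresentable).Structure where
  tensorHom f g := C.tensorHom f g
  tensorHom_θ {a a' b b'} f g := by
    have h : ∀ {a a' b b' : C.Obj} (f : a ⟶ a') (g : b ⟶ b'),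
        C.tensorHom (𝟙 a) (𝟙 b) ≫ 𝟙 (C.tensorObj a b) ≫ C.tensorHom f g =
          C.tensorHom f g ≫ 𝟙 (C.tensorObj a' b') ≫ 𝟙 (C.tensorObj a' b') := by
      simp [tensorHom_id_comp]
    exact (C.toMulti_act₂ (𝟙 a) (𝟙 b) (C.tensorHom f g) (𝟙 _)).trans
      ((h f g).trans (C.toMulti_act₂ f g (𝟙 (C.tensorObj a' b')) (𝟙 _)).symm)
  α a b c := C.α a b c
  α_θ a b c := by
    have h : ∀ a b c : C.Obj, C.tensorHom (𝟙 (C.tensorObj a b)) (𝟙 c) ≫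
        C.tensorHom (𝟙 (C.tensorObj a b)) (𝟙 c) ≫ 𝟙 (C.tensorObj (C.tensorObj a b) c) ≫ C.α a b c =
          C.α a b c ≫ C.tensorHom (𝟙 a) (𝟙 (C.tensorObj b c)) ≫ 𝟙 _ := by
      simp [C.tensorHom_id]
    refine (act_bb₁ _ _ _).trans ?_
    refine (congrArg (C.toMulti.toShort.bb₁ (b₁ := C.tensorObj a b) (b₂ := c) · _)
      (C.toMulti_act₂ (𝟙 (C.tensorObj a b)) (𝟙 c) (C.α a b c) (𝟙 _))).trans ?_
    exact (C.toMulti_bb₁ _ (𝟙 (C.tensorObj a b))).trans ((h a b c).trans (C.toMulti_bb₂ (𝟙 _) (𝟙 _)).symm)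
  lam a := C.lam a
  lam_θ a := by
    have h : ∀ a : C.Obj, C.tensorHom (𝟙 C.unit) (𝟙 a) ≫ C.tensorHom (𝟙 C.unit) (𝟙 a) ≫
        𝟙 (C.tensorObj C.unit a) ≫ C.lam a = C.lam a ≫ 𝟙 a := by
      simp [tensorHom_id_comp]
    refine (congrArg (C.toMulti.toShort.bn₁ (b₁ := C.unit) (b₂ := a) · _)
      (C.toMulti_act₂ (𝟙 C.unit) (𝟙 a) (C.lam a) (𝟙 _))).trans ?_
    exact (C.toMulti_bn₁ _ (𝟙 C.unit)).trans (h a)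

/-- `ρ` is not a field of `Structure` but is defined by substituting `u` into `θ`, so its agreement
with the given `ρ` has to be computed. -/
theorem toMultiStructure_ρ (a : C.Obj) :
    C.toMultiStructure.toSkewMonoidal.ρ a = C.ρ a := by
  have h : C.ρ a ≫ C.tensorHom (𝟙 a) (𝟙 C.unit) ≫ 𝟙 (C.tensorObj a C.unit) = C.ρ a := by
    simp [C.tensorHom_id]
  exact (C.toMulti_bn₂ (𝟙 (C.tensorObj a C.unit)) (𝟙 _)).trans h

/-- The skew monoidal category associated to the skew multicategory of `C` is `C`. -/
def toMultiIso : C.toMultiStructure.toSkewMonoidal ≅ C where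
  hom :=
    { toFunctor :=
        { obj a := a
          map f := f
          -- All data are identities, but composition in `C.toMulti` is a substitution and agrees
          -- with that of `C` only propositionally; the same holds for `ρ`.
          map_comp f g := C.toMulti_comp f g }
      f₀ := 𝟙 C.unit
      f₂ a b := 𝟙 (C.tensorObj a b)
      f₂_naturality := (LaxSkewMonoidalFunctor.id C).f₂_naturality
      f₂_α := (LaxSkewMonoidalFunctor.id C).f₂_α
      f₂_lam := (LaxSkewMonoidalFunctor.id C).f₂_lam
      f₂_ρ a := ((LaxSkewMonoidalFunctor.id C).f₂_ρ a).trans (C.toMultiStructure_ρ a).symm }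
  inv :=
    { toFunctor :=
        { obj a := a
          map f := f
          map_comp f g := (C.toMulti_comp f g).symm }
      f₀ := 𝟙 C.unit
      f₂ a b := 𝟙 (C.tensorObj a b)
      f₂_naturality := (LaxSkewMonoidalFunctor.id C.toMultiStructure.toSkewMonoidal).f₂_naturality
      f₂_α := (LaxSkewMonoidalFunctor.id C.toMultiStructure.toSkewMonoidal).f₂_α
      f₂_lam := (LaxSkewMonoidalFunctor.id C.toMultiStructure.toSkewMonoidal).f₂_lam
      f₂_ρ a := ((LaxSkewMonoidalFunctor.id C.toMultiStructure.toSkewMonoidal).f₂_ρ a).trans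
        (C.toMultiStructure_ρ a) }
  hom_inv_id := LaxSkewMonoidalFunctor.ext rfl
    (heq_of_eq (Category.comp_id (𝟙 C.toMultiStructure.toSkewMonoidal.unit)))
    (heq_of_eq (funext fun a => funext fun b =>
      Category.comp_id (𝟙 (C.toMultiStructure.toSkewMonoidal.tensorObj a b))))
  inv_hom_id := LaxSkewMonoidalFunctor.ext rfl (heq_of_eq (Category.comp_id (𝟙 C.unit)))
    (heq_of_eq (funext fun a => funext fun b => Category.comp_id (𝟙 (C.tensorObj a b))))

end SkewMonoidalCat

/-! ### Extension of morphisms of short skew multicategories to all arities -/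

namespace SkewMulticategory

variable {M N : SkewMulticategory.{v, u}}

theorem comm_of_eq {l m r l₁ l₂ r₁ r₂ : List M.Obj} {x y z w w' o : Tightness}
    {as gs bs hs hs' os : List M.Obj} {b c d : M.Obj} (hl₁ : l₁ = l ++ gs ++ m)
    (hl₂ : l₂ = l ++ b :: m) (hr₁ : r₁ = m ++ c :: r) (hr₂ : r₂ = m ++ as ++ r)
    (hw : w = x.sub l y) (hbs : bs = l ++ b :: r₁) (hhs : hs = l ++ gs ++ r₁)
    (ho : o = w.sub l₁ z) (hhs' : hs = l₁ ++ c :: r) (hos : os = l₁ ++ as ++ r)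
    (hw' : w' = x.sub l₂ z) (hbs' : bs = l₂ ++ c :: r) (hks : hs' = l₂ ++ as ++ r)
    (ho' : o = w'.sub l y) (hks' : hs' = l ++ b :: r₂) (hos' : os = l ++ gs ++ r₂)
    (h : M.Hom x bs d) (g : M.Hom y gs b) (f : M.Hom z as c) :
    M.sub l₁ r ho hhs' hos (M.sub l r₁ hw hbs hhs h g) f =
      M.sub l r₂ ho' hks' hos' (M.sub l₂ r hw' hbs' hks h f) g := by
  subst hl₁ hl₂ hr₁ hr₂
  exact M.comm l m r hw hbs hhs ho hhs' hos hw' hbs' hks ho' hks' hos' h g f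

section Compat

variable {o : M.Obj → N.Obj}
  (mp : ∀ {x : Tightness} {as : List M.Obj} {b : M.Obj}, M.Hom x as b → N.Hom x (as.map o) (o b))

/-- The assignment `mp` preserves the substitution of `f` into `g` after the variables `l`. -/
def Compat (l r : List M.Obj) {x y : Tightness} {as bs : List M.Obj} {b c : M.Obj}
    (g : M.Hom x bs c) (f : M.Hom y as b) : Prop :=
  ∀ (z : Tightness) (cs : List M.Obj) (hz : z = x.sub l y) (hb : bs = l ++ b :: r)
    (hc : cs = l ++ as ++ r) (hz' : z = x.sub (l.map o) y)
    (hb' : bs.map o = l.map o ++ o b :: r.map o)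
    (hc' : cs.map o = l.map o ++ as.map o ++ r.map o),
    mp (M.sub l r hz hb hc g f) = N.sub (l.map o) (r.map o) hz' hb' hc' (mp g) (mp f)

variable {mp}

/-- Apply the associativity axiom in `M` and in `N`: once the substitutions of `f` into `g` and of
`g` into `h` are preserved, the two remaining ones are two readings of the same equation. Both
directions serve to move classifiers from one argument to the other. -/
theorem Compat.assoc {l r l' r' : List M.Obj} {x y z w w' : Tightness}
    {as bs gs cs hs : List M.Obj} {b c d : M.Obj}
    (hw : w = y.sub l' z) (hgs : gs = l' ++ b :: r') (hcs : cs = l' ++ as ++ r')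
    (hbs : bs = l ++ c :: r)
    (hw' : w' = x.sub l y) (hhs : hs = l ++ gs ++ r)
    {h : M.Hom x bs d} {g : M.Hom y gs c} {f : M.Hom z as b}
    (h₁ : Compat mp l' r' g f) (h₂ : Compat mp l r h g) :
    Compat mp l r h (M.sub l' r' hw hgs hcs g f) ↔
      Compat mp (l ++ l') (r' ++ r) (M.sub l r hw' hbs hhs h g) f := by
  have hl : l.map o ++ l'.map o = (l ++ l').map o := (List.map_append ..).symm
  have hr : r'.map o ++ r.map o = (r' ++ r).map o := (List.map_append ..).symm
  have e (u : Tightness) : x.sub l u = x.sub (l.map o) u := Tightness.sub_congr _ _ (by simp)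
  have e' (u : Tightness) : y.sub l' u = y.sub (l'.map o) u := Tightness.sub_congr _ _ (by simp)
  have hw'' := hw.trans (e' z)
  have hgs' : gs.map o = l'.map o ++ o b :: r'.map o := by simp [hgs]
  have hcs' : cs.map o = l'.map o ++ as.map o ++ r'.map o := by simp [hcs]
  have hbs' : bs.map o = l.map o ++ o c :: r.map o := by simp [hbs]
  have hhs' : hs.map o = l.map o ++ gs.map o ++ r.map o := by simp [hhs]
  constructor
  · intro H z' cs' hz hb hc hz' hb' hc'
    have hz₁ : z' = x.sub l w := by
      subst hz hw hw'; cases x <;> cases y <;> cases l <;> cases l' <;> rfl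
    have hc₁ : cs' = l ++ cs ++ r := by simp [hc, hcs]
    have hz₂ := hz₁.trans (e w)
    have hc₂ : cs'.map o = l.map o ++ cs.map o ++ r.map o := by simp [hc₁]
    rw [h₂ _ _ hw' hbs hhs (hw'.trans (e y)) hbs' hhs']
    rw [← M.assoc l r l' r' hw hgs hcs hz₁ hbs hc₁, H _ _ hz₁ hbs hc₁ hz₂ hbs' hc₂,
      h₁ _ _ hw hgs hcs hw'' hgs' hcs']
    refine (N.assoc _ _ _ _ _ _ _ _ _ _ (hw'.trans (e y)) hhs' (by rw [hl]; exact hz')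
      (by rw [hl, hr]; exact hb') (by rw [hl, hr]; exact hc') _ _ _).trans ?_
    exact sub_eq hl hr _ _ _ _ _ _ _ _
  · intro H z' cs' hz hb hc hz' hb' hc'
    have hz₁ : z' = w'.sub (l ++ l') z := by
      subst hz hw hw'; cases x <;> cases y <;> cases l <;> cases l' <;> rfl
    have hb₁ : hs = (l ++ l') ++ b :: (r' ++ r) := by simp [hhs, hgs]
    have hc₁ : cs' = (l ++ l') ++ as ++ (r' ++ r) := by simp [hc, hcs]
    have hz₂ : z' = w'.sub ((l ++ l').map o) z := hz₁.trans (Tightness.sub_congr _ _ (by simp))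
    have hb₂ : hs.map o = (l ++ l').map o ++ o b :: (r' ++ r).map o := by simp [hb₁]
    have hc₂ : cs'.map o = (l ++ l').map o ++ as.map o ++ (r' ++ r).map o := by simp [hc₁]
    rw [M.assoc l r l' r' hw hgs hcs hz hb hc hw' hhs hz₁ hb₁ hc₁, H _ _ hz₁ hb₁ hc₁ hz₂ hb₂ hc₂,
      h₁ _ _ hw hgs hcs hw'' hgs' hcs', h₂ _ _ hw' hbs hhs (hw'.trans (e y)) hbs' hhs']
    refine Eq.symm ((N.assoc _ _ _ _ _ _ _ _ _ _ (hw'.trans (e y)) hhs' (by rw [hl]; exact hz₂)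
      (by rw [hl, hr]; exact hb₂) (by rw [hl, hr]; exact hc₂) _ _ _).trans ?_)
    exact sub_eq hl hr _ _ _ _ _ _ _ _

/-- The commutation axiom in both `M` and `N`. With `g` a classifier in the first variable, it
reduces a substitution into a later variable of `h ∘ g` to one into `h`. -/
theorem Compat.comm {l m r : List M.Obj} {x y z w w' : Tightness}
    {as gs bs hs hs' : List M.Obj} {b c d : M.Obj}
    (hw : w = x.sub l y) (hbs : bs = l ++ b :: (m ++ c :: r)) (hhs : hs = l ++ gs ++ (m ++ c :: r))
    (hw' : w' = x.sub (l ++ b :: m) z) (hbs' : bs = (l ++ b :: m) ++ c :: r)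
    (hks : hs' = (l ++ b :: m) ++ as ++ r)
    {h : M.Hom x bs d} {g : M.Hom y gs b} {f : M.Hom z as c}
    (h₁ : Compat mp l (m ++ c :: r) h g) (h₂ : Compat mp (l ++ b :: m) r h f)
    (H : Compat mp l (m ++ as ++ r) (M.sub (l ++ b :: m) r hw' hbs' hks h f) g) :
    Compat mp (l ++ gs ++ m) r (M.sub l (m ++ c :: r) hw hbs hhs h g) f := by
  intro z' cs' hz hb hc hz' hb' hc'
  have hz₁ : z' = w'.sub l y := by
    subst hz hw hw'
    -- If `g` were tight and nullary, with `l` and `m` empty and `h` tight, then `h ∘ g` would have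
    -- a new first variable and a loose `f` would break the equality of types. Such a `g` does not
    -- exist.
    cases gs with
    | nil =>
      cases y with
      | tight => exact ((M.isEmpty_nil _).false g).elim
      | loose => cases x <;> cases l <;> rfl
    | cons => cases x <;> cases y <;> cases z <;> cases l <;> rfl
  have e (u : Tightness) : x.sub l u = x.sub (l.map o) u := Tightness.sub_congr _ _ (by simp)
  have hb₁ : hs' = l ++ b :: (m ++ as ++ r) := by simp [hks]
  have hc₁ : cs' = l ++ gs ++ (m ++ as ++ r) := by simp [hc]
  have hbs₁ : bs.map o = l.map o ++ o b :: (m ++ c :: r).map o := by simp [hbs]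
  have hbs₂ : bs.map o = (l ++ b :: m).map o ++ o c :: r.map o := by simp [hbs]
  have hhs₁ : hs.map o = l.map o ++ gs.map o ++ (m ++ c :: r).map o := by simp [hhs]
  have hks₁ : hs'.map o = (l ++ b :: m).map o ++ as.map o ++ r.map o := by simp [hks]
  have hb₂ : hs'.map o = l.map o ++ o b :: (m ++ as ++ r).map o := by simp [hb₁]
  have hc₂ : cs'.map o = l.map o ++ gs.map o ++ (m ++ as ++ r).map o := by simp [hc₁]
  rw [h₁ _ _ hw hbs hhs (hw.trans (e y)) hbs₁ hhs₁,
    M.comm l m r hw hbs hhs hz hb hc hw' hbs' hks hz₁ hb₁ hc₁,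
    H _ _ hz₁ hb₁ hc₁ (hz₁.trans (Tightness.sub_congr _ _ (by simp))) hb₂ hc₂,
    h₂ _ _ hw' hbs' hks (hw'.trans (Tightness.sub_congr _ _ (by simp))) hbs₂ hks₁]
  exact (comm_of_eq (m := m.map o) (by simp) (by simp) (by simp) (by simp) _ _ _ _ _ _ _ _ _ _ _ _
    _ _ _).symm

end Compat

variable (d : M.Classifiers) (hM : isLeftRepresentable M)
  (G : ShortSkewMultifunctor M.toShort N.toShort)

namespace Extension

/-- The action on objects. -/
def obj (a : M.Obj) : N.Obj := G.toFunctor.obj a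

def Θ (a b : M.Obj) : N.Hom tight [obj G a, obj G b] (obj G (d.tensor a b)) := G.mapT₂ (d.θ a b)

def W : N.Hom loose [] (obj G d.unit) := G.mapL₀ d.w

theorem tight_cases (hM : isLeftRepresentable M) {a b c : M.Obj} {r : List M.Obj} (f : M.Hom tight (a :: b :: r) c) :
    ∃ k : M.Hom tight (d.tensor a b :: r) c,
      M.sub (z := tight) (cs := a :: b :: r) [] r rfl rfl rfl k (d.θ a b) = f :=
  (hM.2 _ _ _ _ (d.isClassifier_θ a b) r c).2 f

theorem loose_cases (hM : isLeftRepresentable M) {as : List M.Obj} {c : M.Obj} (f : M.Hom loose as c) :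
    ∃ k : M.Hom tight (d.unit :: as) c,
      M.sub (z := loose) (cs := as) [] as rfl rfl rfl k d.w = f :=
  (hM.2 _ _ _ _ d.isClassifier_w as c).2 f

/-- The action on tight multimaps. -/
noncomputable def mapTight : ∀ (r : List M.Obj) {a c : M.Obj}, M.Hom tight (a :: r) c →
    N.Hom tight (obj G a :: r.map (obj G)) (obj G c)
  | [], _, _, f => G.toFunctor.map f
  | b :: r, a, _, f => N.sub [] (r.map (obj G)) rfl rfl rfl
      (mapTight r (tight_cases d hM f).choose) (Θ d G a b)

/-- The action on multimaps. -/
noncomputable def map : ∀ {x : Tightness} {as : List M.Obj} {c : M.Obj}, M.Hom x as c →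
    N.Hom x (as.map (obj G)) (obj G c)
  | tight, [], c, f => ((M.isEmpty_nil c).false f).elim
  | tight, _ :: r, _, f => mapTight d hM G r f
  | loose, as, _, f => N.sub [] (as.map (obj G)) rfl rfl rfl
      (mapTight d hM G as (loose_cases d hM f).choose) (W d G)

/-- By uniqueness of factorizations through the left universal `θ`, the choice made in the recursion
is immaterial. -/
theorem mapTight_θ (r : List M.Obj) {a b c : M.Obj} (k : M.Hom tight (d.tensor a b :: r) c) :
    mapTight d hM G (b :: r) (M.sub [] r rfl rfl rfl k (d.θ a b)) =
      N.sub [] (r.map (obj G)) rfl rfl rfl (mapTight d hM G r k) (Θ d G a b) :=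
  congrArg (fun k => N.sub [] (r.map (obj G)) rfl rfl rfl (mapTight d hM G r k) (Θ d G a b))
    ((hM.2 _ _ _ _ (d.isClassifier_θ a b) r c).1 (tight_cases d hM _).choose_spec)

theorem map_loose_w (r : List M.Obj) {c : M.Obj} (k : M.Hom tight (d.unit :: r) c) :
    map d hM G (M.sub (z := loose) (cs := r) [] r rfl rfl rfl k d.w) =
      N.sub [] (r.map (obj G)) rfl rfl rfl (mapTight d hM G r k) (W d G) :=
  congrArg (fun k => N.sub [] (r.map (obj G)) rfl rfl rfl (mapTight d hM G r k) (W d G))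
    ((hM.2 _ _ _ _ d.isClassifier_w r c).1 (loose_cases d hM _).choose_spec)

theorem map_id (a : M.Obj) : map d hM G (M.id a) = N.id (obj G a) := G.toFunctor.map_id a

theorem map_θ (a b : M.Obj) : map d hM G (d.θ a b) = Θ d G a b := by
  refine (congrArg (map d hM G) (M.id_sub rfl rfl rfl (d.θ a b)).symm).trans ?_
  refine (mapTight_θ d hM G [] (M.id _)).trans ?_
  exact (congrArg (N.sub [] [] rfl rfl rfl · _) (map_id d hM G _)).trans (N.id_sub rfl rfl rfl _)

theorem map_w : map d hM G d.w = W d G := by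
  refine (congrArg (map d hM G) (M.id_sub rfl rfl rfl d.w).symm).trans ?_
  refine (map_loose_w d hM G [] (M.id _)).trans ?_
  exact (congrArg (N.sub [] [] rfl rfl rfl · _) (map_id d hM G _)).trans (N.id_sub rfl rfl rfl _)

theorem compat_θ (r : List M.Obj) {a b c : M.Obj} {bs : List M.Obj} (k : M.Hom tight bs c) :
    Compat (map d hM G) [] r k (d.θ a b) := by
  intro z cs hz hb hc hz' hb' hc'
  subst hz hb hc
  exact (mapTight_θ d hM G r k).trans
    (congrArg (N.sub [] (r.map (obj G)) rfl rfl rfl _) (map_θ d hM G a b).symm)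

theorem compat_w (r : List M.Obj) {c : M.Obj} {bs : List M.Obj} (k : M.Hom tight bs c) :
    Compat (map d hM G) [] r k d.w := by
  intro z cs hz hb hc hz' hb' hc'
  subst hz hb
  have hc₁ : r = cs := hc.symm
  subst hc₁
  exact (map_loose_w d hM G r k).trans
    (congrArg (N.sub [] (r.map (obj G)) rfl rfl rfl _) (map_w d hM G).symm)

theorem act₂_id {a b c c' : M.Obj} (k : M.Hom tight [c] c') (f : M.Hom tight [a, b] c) :
    M.toShort.T₂.act (a₁ := a) (a₂ := b) (c := c) (c' := c') (𝟙 _) (𝟙 _) k f =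
      M.sub (z := tight) (cs := [a, b]) [] [] rfl rfl rfl k f :=
  congrArg (post (b := c) k) ((pre_id _ _ _ _).trans (pre_id _ _ _ _))

/-- This and the next five lemmas say that the extension agrees with `G` in the arities on which `G`
is given. They let the axioms of `G` enter the base cases below, and they make the restriction of
the extension equal to `G`. -/
theorem map_T₂ {a b c : M.Obj} (f : M.Hom tight [a, b] c) : map d hM G f = G.mapT₂ f := by
  obtain ⟨k, rfl⟩ := tight_cases d hM f
  refine (mapTight_θ d hM G [] k).trans ?_
  refine (act₂_id (M := N) _ _).symm.trans ?_
  refine (ShortSkewMulticategory.Classifiers.MapStructure.map_act G _ _).trans ?_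
  exact congrArg G.mapT₂ (act₂_id k (d.θ a b))

theorem map_T₃ {a b x c : M.Obj} (f : M.Hom tight [a, b, x] c) : map d hM G f = G.mapT₃ f := by
  obtain ⟨k, rfl⟩ := tight_cases d hM f
  refine (mapTight_θ d hM G [x] k).trans ?_
  refine Eq.trans ?_ (G.map_bb₁ k (d.θ a b)).symm
  exact congrArg (N.sub [] [obj G x] rfl rfl rfl · _) (map_T₂ d hM G k)

theorem map_T₄ {a b x y c : M.Obj} (f : M.Hom tight [a, b, x, y] c) : map d hM G f = G.mapT₄ f := by
  obtain ⟨k, rfl⟩ := tight_cases d hM f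
  refine (mapTight_θ d hM G [x, y] k).trans ?_
  refine Eq.trans ?_ (G.map_tb₁ k (d.θ a b)).symm
  exact congrArg (N.sub [] [obj G x, obj G y] rfl rfl rfl · _) (map_T₃ d hM G k)

theorem map_L₀ {c : M.Obj} (f : M.Hom loose [] c) : map d hM G f = G.mapL₀ f := by
  obtain ⟨k, rfl⟩ := loose_cases d hM f
  refine (map_loose_w d hM G [] k).trans ?_
  exact (G.mapL₀_nat k d.w).symm

theorem map_L₁ {a c : M.Obj} (f : M.Hom loose [a] c) : map d hM G f = G.mapL₁ f := by
  obtain ⟨k, rfl⟩ := loose_cases d hM f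
  refine (map_loose_w d hM G [a] k).trans ?_
  refine Eq.trans ?_ (G.map_bn₁ k d.w).symm
  exact congrArg (N.sub [] [obj G a] rfl rfl rfl · _) (map_T₂ d hM G k)

theorem map_L₂ {a b c : M.Obj} (f : M.Hom loose [a, b] c) : map d hM G f = G.mapL₂ f := by
  obtain ⟨k, rfl⟩ := loose_cases d hM f
  refine (map_loose_w d hM G [a, b] k).trans ?_
  refine Eq.trans ?_ (G.map_tn₁ k d.w).symm
  exact congrArg (N.sub [] [obj G a, obj G b] rfl rfl rfl · _) (map_T₃ d hM G k)

theorem compat_unary {a b c : M.Obj} (g : M.Hom tight [b] c) (f : M.Hom tight [a] b) :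
    Compat (map d hM G) [] [] g f := by
  intro z cs hz hb hc hz' hb' hc'
  subst hz hc
  exact G.toFunctor.map_comp f g

/-- Substitution of a tight unary map is the functorial action, so this is the naturality of
`G.mapT₂`. -/
theorem compat_θ_first {a b e : M.Obj} (p : M.Hom tight [a] b) :
    Compat (map d hM G) [] [e] (d.θ b e) p := by
  intro z cs hz hb hc hz' hb' hc'
  subst hz hc
  refine (map_T₂ d hM G _).trans ?_
  have h : M.toShort.T₂.act (a₁ := b) (a₂ := e) (a₁' := a) p (𝟙 _) (𝟙 _) (d.θ b e) =
      M.sub (z := tight) (cs := [a, e]) [] [e] rfl rfl rfl (d.θ b e) p :=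
    (post_id _).trans (pre_id _ _ _ _)
  refine (congrArg G.mapT₂ h.symm).trans ((G.mapT₂_nat _ _ _ _).trans ?_)
  have h' : N.toShort.T₂.act (G.toFunctor.map p) (G.toFunctor.map (𝟙 e)) (G.toFunctor.map (𝟙 _))
      (G.mapT₂ (d.θ b e)) = N.toShort.T₂.act (G.toFunctor.map p) (𝟙 _) (𝟙 _) (G.mapT₂ (d.θ b e)) :=
    congrArg₂ (fun x y => N.toShort.T₂.act (G.toFunctor.map p) x y (G.mapT₂ (d.θ b e)))
      (G.toFunctor.map_id _) (G.toFunctor.map_id _)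
  refine (h'.trans ((post_id _).trans (pre_id _ _ _ _))).trans ?_
  exact congrArg (N.sub [] [obj G e] rfl rfl rfl · _) (map_θ d hM G b e).symm

theorem compat_θ_second {a b e : M.Obj} (p : M.Hom tight [a] b) :
    Compat (map d hM G) [e] [] (d.θ e b) p := by
  intro z cs hz hb hc hz' hb' hc'
  subst hz hc
  refine (map_T₂ d hM G _).trans ?_
  have h : M.toShort.T₂.act (a₁ := e) (a₂ := b) (a₂' := a) (𝟙 _) p (𝟙 _) (d.θ e b) =
      M.sub (z := tight) (cs := [e, a]) [e] [] rfl rfl rfl (d.θ e b) p :=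
    (post_id _).trans (congrArg (pre [e] [] rfl rfl · p) (pre_id _ _ _ _))
  refine (congrArg G.mapT₂ h.symm).trans ((G.mapT₂_nat _ _ _ _).trans ?_)
  have h' : N.toShort.T₂.act (G.toFunctor.map (𝟙 e)) (G.toFunctor.map p) (G.toFunctor.map (𝟙 _))
      (G.mapT₂ (d.θ e b)) = N.toShort.T₂.act (𝟙 _) (G.toFunctor.map p) (𝟙 _) (G.mapT₂ (d.θ e b)) :=
    congrArg₂ (fun x y => N.toShort.T₂.act x (G.toFunctor.map p) y (G.mapT₂ (d.θ e b)))
      (G.toFunctor.map_id _) (G.toFunctor.map_id _)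
  refine (h'.trans ((post_id _).trans <| congrArg (pre [obj G e] [] rfl rfl · (G.toFunctor.map p))
    (pre_id _ _ _ _))).trans ?_
  exact congrArg (N.sub [obj G e] [] rfl rfl rfl · _) (map_θ d hM G e b).symm

/-- Substitution of `θ` into the second variable of `θ` is ternary, where `G` preserves it by
assumption. This and `compat_θ_w` are the base cases for substituting classifiers beyond the first
variable. -/
theorem compat_θ_θ (a b e : M.Obj) :
    Compat (map d hM G) [e] [] (d.θ e (d.tensor a b)) (d.θ a b) := by
  intro z cs hz hb hc hz' hb' hc'
  subst hz hc
  refine (map_T₃ d hM G _).trans ((G.map_bb₂ (d.θ e (d.tensor a b)) (d.θ a b)).trans ?_)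
  exact congrArg₂ (N.sub [obj G e] [] rfl rfl rfl) (map_θ d hM G _ _).symm (map_θ d hM G _ _).symm

theorem compat_θ_w (e : M.Obj) :
    Compat (map d hM G) [e] [] (d.θ e d.unit) d.w := by
  intro z cs hz hb hc hz' hb' hc'
  subst hz hc
  refine (G.map_bn₂ (d.θ e d.unit) d.w).trans ?_
  exact congrArg₂ (N.sub [obj G e] [] rfl rfl rfl) (map_θ d hM G _ _).symm (map_w d hM G).symm

/-- Induction on the variables of `g` after the first. Factor `g` through `θ b e`, so that `p`
enters `θ b e`, and factor the result through `θ a e` as some `t` (playing the role of `p ⊗ 1`).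
Then `t` is a unary map entering a multimap with one variable fewer. -/
theorem compat_first_unary (r : List M.Obj) {a b c : M.Obj} (g : M.Hom tight (b :: r) c)
    (p : M.Hom tight [a] b) : Compat (map d hM G) [] r g p := by
  induction r generalizing a b with
  | nil => exact compat_unary d hM G g p
  | cons e r ih =>
    obtain ⟨g, rfl⟩ := tight_cases d hM g
    refine (Compat.assoc (l := []) (l' := []) (r' := [e]) (r := r) (cs := [a, e]) (w := tight)
      rfl rfl rfl rfl rfl rfl (compat_θ_first d hM G p) (compat_θ d hM G r g)).1 ?_
    obtain ⟨t, ht⟩ := tight_cases d hM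
      (M.sub (z := tight) (cs := [a, e]) [] [e] rfl rfl rfl (d.θ b e) p)
    rw [← ht]
    exact (Compat.assoc (l := []) (l' := []) (r' := []) (r := r) (hs := d.tensor a e :: r)
      (w' := tight) rfl rfl rfl rfl rfl rfl
      (compat_θ d hM G [] t) (ih g t)).2 (compat_θ d hM G r _)

/-- Peel classifiers off `f` until it is unary; associativity transfers each of them to the
composite, where `compat_θ` handles it. -/
theorem compat_first_tight (as : List M.Obj) {r : List M.Obj} {b c : M.Obj}
    (g : M.Hom tight (b :: r) c) {a : M.Obj} (f : M.Hom tight (a :: as) b) :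
    Compat (map d hM G) [] r g f := by
  induction as generalizing a with
  | nil => exact compat_first_unary d hM G r g f
  | cons e as ih =>
    obtain ⟨f, rfl⟩ := tight_cases d hM f
    exact (Compat.assoc (l := []) (l' := []) (r' := as) (r := r) (hs := d.tensor a e :: (as ++ r))
      (w' := tight) rfl rfl rfl rfl rfl rfl
      (compat_θ d hM G as f) (ih f)).2 (compat_θ d hM G _ _)

theorem compat_first {r : List M.Obj} {b c : M.Obj}
    (g : M.Hom tight (b :: r) c) {y : Tightness} {as : List M.Obj} (f : M.Hom y as b) :
    Compat (map d hM G) [] r g f := by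
  match y, as, f with
  | tight, [], f => exact ((M.isEmpty_nil _).false f).elim
  | tight, a :: as, f => exact compat_first_tight d hM G as g f
  | loose, as, f =>
    obtain ⟨f, rfl⟩ := loose_cases d hM f
    exact (Compat.assoc (l := []) (l' := []) (r' := as) (r := r) (hs := d.unit :: (as ++ r))
      (w' := tight) rfl rfl rfl rfl rfl rfl
      (compat_w d hM G as f) (compat_first_tight d hM G as g f)).2 (compat_w d hM G _ _)

/-- Factor `g` through `θ e b`: the substitution then takes place inside `θ e b`, and its result
enters the first variable of the remaining factor, which `compat_first` covers. -/
theorem compat_second_of_θ {e b c : M.Obj} {r : List M.Obj} (g : M.Hom tight (e :: b :: r) c)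
    {y : Tightness} {as : List M.Obj} {f : M.Hom y as b}
    (h : Compat (map d hM G) [e] [] (d.θ e b) f) : Compat (map d hM G) [e] r g f := by
  obtain ⟨g, rfl⟩ := tight_cases d hM g
  exact (Compat.assoc (l := []) (l' := [e]) (r' := []) (r := r) (cs := e :: as) (w := tight)
    rfl rfl (by simp) rfl rfl rfl h (compat_θ d hM G r g)).1 (compat_first d hM G g _)

theorem compat_second_tight (as : List M.Obj) {r : List M.Obj} {e b c : M.Obj}
    (g : M.Hom tight (e :: b :: r) c) {a : M.Obj} (f : M.Hom tight (a :: as) b) :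
    Compat (map d hM G) [e] r g f := by
  induction as generalizing a with
  | nil => exact compat_second_of_θ d hM G g (compat_θ_second d hM G f)
  | cons x as ih =>
    obtain ⟨f, rfl⟩ := tight_cases d hM f
    exact (Compat.assoc (l := [e]) (l' := []) (r' := as) (r := r)
      (hs := e :: d.tensor a x :: (as ++ r)) (w' := tight) rfl rfl rfl rfl rfl rfl
      (compat_θ d hM G as f) (ih f)).2 (compat_second_of_θ d hM G _ (compat_θ_θ d hM G _ _ _))

theorem compat_second {r : List M.Obj} {e b c : M.Obj} (g : M.Hom tight (e :: b :: r) c)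
    {y : Tightness} {as : List M.Obj} (f : M.Hom y as b) :
    Compat (map d hM G) [e] r g f := by
  match y, as, f with
  | tight, [], f => exact ((M.isEmpty_nil _).false f).elim
  | tight, a :: as, f => exact compat_second_tight d hM G as g f
  | loose, as, f =>
    obtain ⟨f, rfl⟩ := loose_cases d hM f
    exact (Compat.assoc (l := [e]) (l' := []) (r' := as) (r := r)
      (hs := e :: d.unit :: (as ++ r)) (w' := tight) rfl rfl rfl rfl rfl rfl
      (compat_w d hM G as f) (compat_second_tight d hM G as g f)).2
      (compat_second_of_θ d hM G _ (compat_θ_w d hM G _))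

/-- Induction on the variables between the first and the one substituted into. Factoring `g` through
a `θ` on its first two variables lowers the position by one, and `Compat.comm` restores the `θ`. -/
theorem compat_tight_cons (l : List M.Obj) {r : List M.Obj} {e b c : M.Obj}
    (g : M.Hom tight (e :: (l ++ b :: r)) c) {y : Tightness} {as : List M.Obj} (f : M.Hom y as b) :
    Compat (map d hM G) (e :: l) r g f := by
  induction l generalizing e with
  | nil => exact compat_second d hM G g f
  | cons x l ih =>
    obtain ⟨g, rfl⟩ := tight_cases d hM g
    exact Compat.comm (l := []) (gs := [e, x]) (m := l) (r := r) (w' := tight)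
      (hs' := d.tensor e x :: (l ++ as ++ r)) rfl rfl rfl rfl rfl rfl
      (compat_θ d hM G _ g) (ih g) (compat_θ d hM G _ _)

theorem compat (l r : List M.Obj) {x y : Tightness} {as bs : List M.Obj} {b c : M.Obj}
    (g : M.Hom x bs c) (f : M.Hom y as b) : Compat (map d hM G) l r g f := by
  intro z cs hz hb
  subst hb
  revert z cs
  suffices h : Compat (map d hM G) l r g f from fun z cs hz => h z cs hz rfl
  match x, l, g with
  | tight, [], g => exact compat_first d hM G g f
  | tight, e :: l, g => exact compat_tight_cons d hM G l g f
  | loose, l, g =>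
    -- A loose `g` is a tight one with `u` in an additional first variable, so `f` enters after the
    -- first variable of that tight map, and `u` commutes with it.
    obtain ⟨g, rfl⟩ := loose_cases d hM g
    exact Compat.comm (l := []) (gs := []) (m := l) (r := r) (w' := tight)
      (hs' := d.unit :: (l ++ as ++ r)) rfl rfl rfl rfl rfl rfl
      (compat_w d hM G _ g) (compat_tight_cons d hM G l g f) (compat_w d hM G _ _)

/-- The loosening of `f` is the substitution of `f` into the loosened identity of its codomain.
Preservation of substitution leaves the loosened identity, a loose unary map, on which the extension
is `G`. -/
theorem map_j {as : List M.Obj} {b : M.Obj} (f : M.Hom tight as b) :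
    map d hM G (M.j f) = N.j (map d hM G f) := by
  have h₁ := M.loosen_sub [] [] (x := tight) (x' := loose) (y := tight) (y' := tight) (z := tight)
    (z' := loose) (as := as) (bs := [b]) (cs := as) rfl rfl rfl (by simp) trivial trivial trivial
    (M.id b) f
  have h₂ := N.loosen_sub [] [] (x := tight) (x' := loose) (y := tight) (y' := tight) (z := tight)
    (z' := loose) (as := as.map (obj G)) (bs := [obj G b]) (cs := as.map (obj G)) rfl rfl rfl
    (by simp) trivial trivial trivial (N.id _) (map d hM G f)
  have h₃ : map d hM G (M.j (M.id b)) = N.j (N.id (obj G b)) :=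
    (map_L₁ d hM G _).trans ((G.map_j₁ (𝟙 b)).trans (congrArg N.j (G.toFunctor.map_id b)))
  refine (congrArg (fun f => map d hM G (M.j f)) (M.id_sub rfl rfl (by simp) f)).symm.trans
    ((congrArg (map d hM G) h₁).trans (Eq.trans ?_ (h₂.symm.trans
      (congrArg N.j (N.id_sub rfl rfl (by simp) _)))))
  refine (compat d hM G [] [] _ _ _ _ _ _ _ rfl rfl (by simp)).trans ?_
  exact congrArg (N.sub [] [] rfl rfl (by simp) · (map d hM G f)) h₃

end Extension

open Extension in
/-- The extension of a morphism between the underlying short skew multicategories. -/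
noncomputable def extend : SkewMultifunctor M N where
  obj := obj G
  map h f := h.symm ▸ map d hM G f
  map_id a _ := map_id d hM G a
  map_j h f := by subst h; exact map_j d hM G f
  map_sub l r x y z as bs cs b c as' bs' cs' hz hbs hcs has' hbs' hcs' hz' hbs'' hcs'' g f := by
    subst has' hbs' hcs'
    exact compat d hM G l r g f _ _ hz hbs hcs hz' hbs'' hcs''

theorem toShort_extend : (extend d hM G).toShort = G := by
  refine ShortSkewMultifunctor.ext rfl (heq_of_eq ?_) (heq_of_eq ?_) (heq_of_eq ?_) (heq_of_eq ?_)
    (heq_of_eq ?_) (heq_of_eq ?_)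
  · funext a b c f; exact Extension.map_T₂ d hM G f
  · funext a b x c f; exact Extension.map_T₃ d hM G f
  · funext a b x y c f; exact Extension.map_T₄ d hM G f
  · funext c f; exact Extension.map_L₀ d hM G f
  · funext a c f; exact Extension.map_L₁ d hM G f
  · funext a b c f; exact Extension.map_L₂ d hM G f

/-- A skew multifunctor obeys the recursion which defines the extension, since it preserves
substitution of the classifiers. -/
theorem mapTight_toShort (F : SkewMultifunctor M N) (r : List M.Obj) {a c : M.Obj}
    (f : M.Hom tight (a :: r) c) : Extension.mapTight d hM F.toShort r f = F.map rfl f := by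
  induction r generalizing a with
  | nil => rfl
  | cons b r ih =>
    obtain ⟨k, rfl⟩ := Extension.tight_cases d hM f
    refine (Extension.mapTight_θ d hM _ r k).trans ?_
    rw [ih]
    exact (F.map_sub [] r _ _ _ _ _ _ _ _ _ _ _).symm

theorem extend_toShort (F : SkewMultifunctor M N) : extend d hM F.toShort = F := by
  refine SkewMultifunctor.ext rfl (heq_of_eq ?_)
  funext x as c as' h f
  subst h
  match x, as, f with
  | tight, [], f => exact ((M.isEmpty_nil _).false f).elim
  | tight, a :: r, f => exact mapTight_toShort d hM F r f
  | loose, as, f =>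
    obtain ⟨k, rfl⟩ := Extension.loose_cases d hM f
    refine (Extension.map_loose_w d hM F.toShort as k).trans ?_
    rw [mapTight_toShort]
    exact (F.map_sub [] as _ _ _ _ _ _ _ _ _ _ _).symm

end SkewMulticategory

/-! ### The equivalence `K` and its restriction to closed objects -/

section

variable (c : ∀ M : ShortSkewMulticategory.isLeftRepresentable.{v, u}.FullSubcategory,
  M.obj.Classifiers)

open ShortSkewMulticategory.Classifiers

/-- Rebuilding a morphism from its lax monoidal functor inverts the action of `K` on morphisms. -/
instance shortToSkewMonoidal_faithful : (shortToSkewMonoidal c).Faithful where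
  map_injective {M N F F'} h := by
    refine ObjectProperty.hom_ext _ ?_
    refine (toMorphism_toLax (c M).canonicalStructure (c N).canonicalStructure F.hom
      (mapStructure _ _ _)).symm.trans (Eq.trans ?_
        (toMorphism_toLax (c M).canonicalStructure (c N).canonicalStructure F'.hom
          (mapStructure _ _ _)))
    exact congrArg (fun L : LaxSkewMonoidalFunctor (c M).canonicalStructure.toSkewMonoidal
      (c N).canonicalStructure.toSkewMonoidal => (MorphismData.ofLax L).toMorphism) h

instance shortToSkewMonoidal_full : (shortToSkewMonoidal c).Full where
  map_surjective {M N} L :=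
    ⟨ObjectProperty.homMk (MorphismData.ofLax (s := (c M).canonicalStructure)
      (s' := (c N).canonicalStructure) L).toMorphism, toLax_toMorphism _ _ L _⟩

/-- The skew monoidal category associated to the short skew multicategory underlying the skew
multicategory of `C` is `C`. -/
noncomputable def shortToSkewMonoidalIso (C : SkewMonoidalCat.{v, u}) :
    (shortToSkewMonoidal c).obj ⟨C.toMulti.toShort, C.toMulti_isLeftRepresentable.toShort⟩ ≅ C :=
  structureIso _ C.toMultiStructure ≪≫ C.toMultiIso

instance shortToSkewMonoidal_isEquivalence : (shortToSkewMonoidal c).IsEquivalence where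
  essSurj := ⟨fun C => ⟨_, ⟨shortToSkewMonoidalIso c C⟩⟩⟩

variable (hK : ∀ (M : ShortSkewMulticategory.{v, u}) (hM : M.isLeftRepresentable), M.isClosed →
  ((shortToSkewMonoidal c).obj ⟨M, hM⟩).isClosed)

/-- The restriction of `shortToSkewMonoidalIso` to closed objects. -/
noncomputable def restrictClosedIso (C : SkewMonoidalCat.isClosed.{v, u}.FullSubcategory) :
    (restrictClosed (shortToSkewMonoidal c) hK).obj (SkewMulticategory.forgetClosed.obj
      ⟨C.obj.toMulti, C.obj.toMulti_isLeftRepresentable, SkewMonoidalCat.toMulti_isClosed C.property⟩) ≅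
      C :=
  ObjectProperty.isoMk _ (shortToSkewMonoidalIso c C.obj)

theorem restrictClosed_fullyFaithful :
    (restrictClosed (shortToSkewMonoidal c) hK).Full ∧
      (restrictClosed (shortToSkewMonoidal c) hK).Faithful := by
  unfold restrictClosed
  constructor <;> infer_instance

theorem restrictClosed_isEquivalence :
    (restrictClosed (shortToSkewMonoidal c) hK).IsEquivalence where
  faithful := (restrictClosed_fullyFaithful c hK).2
  full := (restrictClosed_fullyFaithful c hK).1
  essSurj := ⟨fun C => ⟨_, ⟨restrictClosedIso c hK C⟩⟩⟩

end

/-! ### The forgetful functor as an equivalence, and the comparison of choices -/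

namespace SkewMulticategory

/-- Extension and restriction are mutually inverse once classifiers of the source are fixed;
closedness only cuts out a full subcategory. -/
instance forgetClosed_faithful : forgetClosed.{v, u}.Faithful where
  map_injective {M N F F'} h := by
    obtain ⟨d⟩ := M.property.1.nonempty_classifiers
    refine ObjectProperty.hom_ext _ ?_
    refine (extend_toShort d M.property.1 F.hom).symm.trans (Eq.trans ?_
      (extend_toShort d M.property.1 F'.hom))
    exact congrArg (extend d M.property.1) (congrArg (·.hom) h)

instance forgetClosed_full : forgetClosed.{v, u}.Full where
  map_surjective {M N} G := by
    obtain ⟨d⟩ := M.property.1.nonempty_classifiers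
    exact ⟨ObjectProperty.homMk (extend d M.property.1 G.hom),
      ObjectProperty.hom_ext _ (toShort_extend d M.property.1 G.hom)⟩

theorem forgetClosed_isEquivalence : forgetClosed.{v, u}.IsEquivalence where
  essSurj := ⟨fun X => by
    let c (M : ShortSkewMulticategory.isLeftRepresentable.{v, u}.FullSubcategory) :
      M.obj.Classifiers := M.property.nonempty_classifiers.some
    have hK (M : ShortSkewMulticategory.{v, u}) (hM : M.isLeftRepresentable) (h : M.isClosed) :
        ((shortToSkewMonoidal c).obj ⟨M, hM⟩).isClosed :=
      ShortSkewMulticategory.Classifiers.isClosed_toSkewMonoidal _ h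
    have := restrictClosed_isEquivalence c hK
    -- The preimage of `X` is the skew multicategory of `K X`. Its image under `K ∘ U` is isomorphic
    -- to `K X`, and the full and faithful `K` lifts this to an isomorphism with `X`.
    exact ⟨_, ⟨(restrictClosed (shortToSkewMonoidal c) hK).preimageIso
      (restrictClosedIso c hK ((restrictClosed (shortToSkewMonoidal c) hK).obj X))⟩⟩⟩

/-- The functor to closed skew monoidal categories determined by classifiers of the underlying
short skew multicategories and the induced structural maps. -/
def closedToSkewMonoidal
    (e : ∀ M : (isLeftRepresentable.{v, u} ⊓ isClosed).FullSubcategory, M.obj.toShort.Classifiers)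
    (s : ∀ M, (e M).Structure)
    (t : ∀ {M N : (isLeftRepresentable.{v, u} ⊓ isClosed).FullSubcategory} (F : M ⟶ N),
      ShortSkewMulticategory.Classifiers.MapStructure (e M) (e N) F.hom.toShort) :
    (isLeftRepresentable.{v, u} ⊓ isClosed).FullSubcategory ⥤
      SkewMonoidalCat.isClosed.{v, u}.FullSubcategory where
  obj M := ⟨(s M).toSkewMonoidal,
    ShortSkewMulticategory.Classifiers.isClosed_toSkewMonoidal _ M.property.2.toShort⟩
  map F := ObjectProperty.homMk ((t F).toLax (s _) (s _))
  map_id M := ObjectProperty.hom_ext _ (congrArg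
    (ShortSkewMulticategory.Classifiers.MapStructure.toLax · (s M) (s M))
    ((t (𝟙 M)).unique (.id (e M))))
  map_comp {M _ P} F G := ObjectProperty.hom_ext _ (congrArg
    (ShortSkewMulticategory.Classifiers.MapStructure.toLax · (s M) (s P))
    ((t (F ≫ G)).unique ((t F).comp (t G))))

section

variable {e e' : ∀ M : (isLeftRepresentable.{v, u} ⊓ isClosed).FullSubcategory,
    M.obj.toShort.Classifiers}
  (s : ∀ M, (e M).Structure) (s' : ∀ M, (e' M).Structure)
  (t : ∀ {M N : (isLeftRepresentable.{v, u} ⊓ isClosed).FullSubcategory} (F : M ⟶ N),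
    ShortSkewMulticategory.Classifiers.MapStructure (e M) (e N) F.hom.toShort)
  (t' : ∀ {M N : (isLeftRepresentable.{v, u} ⊓ isClosed).FullSubcategory} (F : M ⟶ N),
    ShortSkewMulticategory.Classifiers.MapStructure (e' M) (e' N) F.hom.toShort)

/-- Different choices give isomorphic functors. -/
noncomputable def closedToSkewMonoidalIso :
    closedToSkewMonoidal e s t ≅ closedToSkewMonoidal e' s' t' :=
  NatIso.ofComponents
    (fun M => ObjectProperty.isoMk _
      (ShortSkewMulticategory.Classifiers.structureIso (s M) (s' M)))
    fun {M N} F => ObjectProperty.hom_ext _ (congrArg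
      (ShortSkewMulticategory.Classifiers.MapStructure.toLax · (s M) (s' N))
      (((t F).comp ((e N).mapStructure (e' N) (.id N.obj.toShort))).unique
        (((e M).mapStructure (e' M) (.id M.obj.toShort)).comp (t' F))))

/-- The structural maps on objects and on morphisms are unique for given classifiers, so equal
classifiers force equal functors, however the structural maps were chosen. -/
theorem closedToSkewMonoidal_eq (h : ∀ M, e M = e' M) :
    closedToSkewMonoidal e s t = closedToSkewMonoidal e' s' t' := by
  obtain rfl : e = e' := funext h
  obtain rfl : s = s' := funext fun M => (s M).unique (s' M)
  have : @t = @t' := by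
    funext M N F
    exact (t F).unique (t' F)
  subst this
  rfl

end

end SkewMulticategory

theorem mainTheorem6
    (c : ∀ M : ShortSkewMulticategory.isLeftRepresentable.{v, u}.FullSubcategory,
      M.obj.Classifiers) :
    (shortToSkewMonoidal c).IsEquivalence ∧
    ∃ hK : ∀ (M : ShortSkewMulticategory.{v, u}) (hM : M.isLeftRepresentable), M.isClosed →
        ((shortToSkewMonoidal c).obj ⟨M, hM⟩).isClosed,
      (restrictClosed (shortToSkewMonoidal c) hK).IsEquivalence ∧
      SkewMulticategory.forgetClosed.{v, u}.IsEquivalence ∧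
      ∀ d : ∀ M : SkewMulticategory.isLeftRepresentable.{v, u}.FullSubcategory, M.obj.Classifiers,
        ∃ hT : ∀ (M : SkewMulticategory.{v, u}) (hM : M.isLeftRepresentable), M.isClosed →
            ((SkewMulticategory.toSkewMonoidal d).obj ⟨M, hM⟩).isClosed,
          (restrictClosed (SkewMulticategory.toSkewMonoidal d) hT).IsEquivalence ∧
          Nonempty (SkewMulticategory.forgetClosed ⋙ restrictClosed (shortToSkewMonoidal c) hK ≅
            restrictClosed (SkewMulticategory.toSkewMonoidal d) hT) ∧
          ((∀ M, d M = .ofShort (c (SkewMulticategory.forgetLR.obj M))) →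
            SkewMulticategory.forgetClosed ⋙ restrictClosed (shortToSkewMonoidal c) hK =
              restrictClosed (SkewMulticategory.toSkewMonoidal d) hT) := by
  have hK (M : ShortSkewMulticategory.{v, u}) (hM : M.isLeftRepresentable) (h : M.isClosed) :
      ((shortToSkewMonoidal c).obj ⟨M, hM⟩).isClosed :=
    ShortSkewMulticategory.Classifiers.isClosed_toSkewMonoidal _ h
  have h₁ := restrictClosed_isEquivalence c hK
  have h₂ := SkewMulticategory.forgetClosed_isEquivalence.{v, u}
  refine ⟨inferInstance, hK, h₁, h₂, fun d => ?_⟩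
  have hT (M : SkewMulticategory.{v, u}) (hM : M.isLeftRepresentable) (h : M.isClosed) :
      ((SkewMulticategory.toSkewMonoidal d).obj ⟨M, hM⟩).isClosed :=
    ShortSkewMulticategory.Classifiers.isClosed_toSkewMonoidal _ h.toShort
  -- Both legs of the triangle are instances of one construction, differing only in classifiers and
  -- structural maps; this reduces their comparison to independence of the choices.
  have e₁ : SkewMulticategory.forgetClosed ⋙ restrictClosed (shortToSkewMonoidal c) hK =
      SkewMulticategory.closedToSkewMonoidal
        (fun M => c (SkewMulticategory.forgetLR.obj ⟨M.obj, M.property.1⟩))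
        (fun M => (c (SkewMulticategory.forgetLR.obj ⟨M.obj, M.property.1⟩)).canonicalStructure)
        (fun {M N} F => (c (SkewMulticategory.forgetLR.obj ⟨M.obj, M.property.1⟩)).mapStructure
          (c (SkewMulticategory.forgetLR.obj ⟨N.obj, N.property.1⟩)) F.hom.toShort) := rfl
  have e₂ : restrictClosed (SkewMulticategory.toSkewMonoidal d) hT =
      SkewMulticategory.closedToSkewMonoidal
        (fun M => (d ⟨M.obj, M.property.1⟩).toShort M.property.1)
        (fun M => (d _).canonicalStructure M.property.1)
        (fun {M N} F => (d ⟨M.obj, M.property.1⟩).mapStructure M.property.1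
          (d ⟨N.obj, N.property.1⟩) N.property.1 F.hom) := rfl
  let i : SkewMulticategory.forgetClosed ⋙ restrictClosed (shortToSkewMonoidal c) hK ≅
      restrictClosed (SkewMulticategory.toSkewMonoidal d) hT :=
    eqToIso e₁ ≪≫ SkewMulticategory.closedToSkewMonoidalIso _ _ _ _ ≪≫ eqToIso e₂.symm
  refine ⟨hT, Functor.isEquivalence_of_iso i, ⟨i⟩, fun hd => ?_⟩
  rw [e₁, e₂]
  refine SkewMulticategory.closedToSkewMonoidal_eq _ _ _ _ fun M => ?_
  -- Passing classifiers of the underlying short skew multicategory through `ofShort` and back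
  -- through `toShort` leaves the data untouched, so the remaining equality is definitional.
  rw [hd]
  rfl
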